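/- Let $\mathbb T$ be the unit circle, $1<p<\infty$, $\frac1p+\frac1q=1$, and for $r\in\{p,q\}$ let $H^r=\{f\in L^r(\mathbb T):\hat f_n=0 \text{ for } n<0\}$, $\overline{H^r}=\{f\in L^r(\mathbb T):\hat f_n=0\text{ for }n>0\}$. Let $P:\sum_{n\in\mathbb Z}\hat f_nt^n\mapsto\sum_{n\ge0}\hat f_nt^n$ be the Riesz projection on $L^r(\mathbb T)$ and $Q=I-P$. Fix $\beta\in\mathbb C$ with $|\beta|>1$ and put $$\alpha(t)=\frac{t-\beta}{\overline\beta t-1},\quad \lambda=i\sqrt{|\beta|^2-1},\quad \alpha_-(t)=\frac{\lambda t}{\overline\beta t-1},\quad \chi(t)=\frac{t}{\alpha_-(t)},\quad (J_\alpha f)(t)=t^{-1}\alpha_-(t)f(\alpha(t)),$$ and $g_\alpha=g\circ\alpha$. For $g\in L^\infty(\mathbb T)$ put $T(g)f=P(gf)$ and $H_\alpha(g)f=PgQJ_\alpha f$ on $H^r$. For an operator $A$ on $H^p$ let $\operatorname{coker}A=\{g\in H^q:\int_{\mathbb T}(Af)\,\overline g\,|dt|=0\text{ for all }f\in H^p\}$,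 i.e. the kernel of $A^*$, which acts on $H^q$. *Signature.* If $g=g_-t^{-n}g_+$ with $n\in\mathbb Z$, $g_+\in H^{r'}$, $g_+^{-1}\in H^{r}$, $g_-\in\overline{H^{r}}$, $g_-^{-1}\in\overline{H^{r'}}$, $g_-(\infty)=1$ (where $\frac1r+\frac1{r'}=1$) is the Wiener–Hopf factorization of $g$ in $H^r$, put $\boldsymbol\sigma_\alpha(g)=(\lambda/\overline\beta)^n\,g_+^{-1}(1/\overline\beta)$. *Projections.* If $g\in L^\infty(\mathbb T)$ and $gg_\alpha=1$, let $\mathbf P_\alpha^{\pm}(g)=\frac12(I\pm J_\alpha QgP)$ on $\ker T(g)\subset H^r$. *The maps $\varphi_\alpha^\pm$.* If $T(g)$ is Fredholm on $H^r$ with index $\kappa\ge0$, let $T_r^{-1}(g)=T(gt^{\kappa})^{-1}T(t^{\kappa})$. Given functions $a',b'$ and $c'=a'/b'$ with $T(c')$ Fredholm of index $\ge 0$, put $$\varphi_\alpha^{\pm}(s)=\tfrac12\Big(T_r^{-1}(c')T((a'_\alpha)^{-1})s\mp J_\alpha Qc'P\,T_r^{-1}(c')T((a'_\alpha)^{-1})s\pm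 J_\alpha Q(a'_\alpha)^{-1}s\Big).$$ **Theorem.** Let $a,b\in L^\infty(\mathbb T)$ with $a$ invertible in $L^\infty(\mathbb T)$ and $aa_\alpha=bb_\alpha$, and put $c=ab^{-1}$, $d=ba_\alpha^{-1}$. Assume that $T(c)$ and $T(d)$ are Fredholm on $H^p$, with indices $\kappa_1=\operatorname{ind}T(c)<0$ and $\kappa_2=\operatorname{ind}T(d)>0$. Let $m\in\mathbb N$ satisfy $0\le 2m-\kappa_2\le1$. In what follows $T(\chi^{\pm m})$, $\mathbf P_\alpha^\pm(\overline c)$ and $\boldsymbol\sigma_\alpha(\overline d)$ are taken on $H^q$, and $\varphi_\alpha^\pm$ are the maps on $H^q$ belonging to the pair $a'=\overline a\chi^{-m}$, $b'=\overline{b_\alpha}\chi^{m}$. 1. If $\kappa_2$ is odd, then $d$ has a Wiener–Hopf factorization $d=d_-t^{-\kappa_2}d_+$, $d_-(\infty)=1$, in $H^p$, and $$\operatorname{coker}(T(a)\pm H_\alpha(b))=T(\chi^{-m})\left(\left\{\frac{1\mp\boldsymbol\sigma_\alpha(\overline d)}{2}\,\overline{d_-^{-1}}\,\mathbb C\dotplus\varphi_\alpha^\pm(\operatorname{im}\mathbf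 P_\alpha^\pm(\overline c))\right\}\cap\operatorname{im}T(\chi^m)\right),$$ where $\dotplus$ denotes a direct sum. 2. If $\kappa_2$ is even, then $$\operatorname{coker}(T(a)\pm H_\alpha(b))=T(\chi^{-m})\left(\varphi_\alpha^\pm(\operatorname{im}\mathbf P_\alpha^\pm(\overline c))\cap\operatorname{im}T(\chi^m)\right).$$ -/

import Mathlib

open MeasureTheory Complex ComplexConjugate
open scoped ENNReal NNReal

noncomputable section

namespace ToeplitzHankel

/-! ### The unit circle, its normalised arc length, and Fourier coefficients -/

instance instMeasurableSpaceCircle : MeasurableSpace Circle := borel Circle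

instance instBorelSpaceCircle : BorelSpace Circle := ⟨rfl⟩

instance instFactTwoPi : Fact (0 < 2 * Real.pi) := ⟨Real.two_pi_pos⟩

/-- Normalised arc length `|dt| / 2π` on the unit circle: the image of the normalised Lebesgue
measure of `ℝ / 2πℤ` under `θ ↦ e ^ (i θ)`. -/
def arc : Measure Circle :=
  Measure.map (AddCircle.toCircle (T := 2 * Real.pi)) AddCircle.haarAddCircle

instance instProbArc : IsProbabilityMeasure arc :=
  Measure.isProbabilityMeasure_map AddCircle.continuous_toCircle.measurable.aemeasurable

/-- The Fourier coefficient `(1 / 2π) ∫ f (e ^ (i θ)) e ^ (- i n θ) dθ`. -/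
def coeff (f : Circle → ℂ) (n : ℤ) : ℂ := ∫ t, f t * (t : ℂ) ^ (-n) ∂arc

theorem integrable_mul_zpow {f : Circle → ℂ} (hf : Integrable f arc) (n : ℤ) :
    Integrable (fun t : Circle => f t * (t : ℂ) ^ n) arc := by
  refine hf.mul_bdd (c := 1) ?_ ?_
  · have h : Continuous fun t : Circle => (t : ℂ) ^ n :=
      Continuous.zpow₀ (by fun_prop) n fun t => Or.inl (Circle.coe_ne_zero t)
    exact h.aestronglyMeasurable
  · exact Filter.Eventually.of_forall fun t => by rw [norm_zpow, Circle.norm_coe, one_zpow]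

/-! ### Hardy spaces and the Riesz projection -/

/-- The space `L^p` of the unit circle. -/
abbrev LpT (p : ℝ≥0∞) : Type := Lp ℂ p arc

theorem integrable_LpT {p : ℝ≥0∞} [hp : Fact (1 ≤ p)] (f : LpT p) : Integrable f arc :=
  (Lp.memLp f).integrable hp.out

/-- The Hardy space `H^p`: the functions in `L^p` whose Fourier coefficients of negative index
vanish. -/
def hardy (p : ℝ≥0∞) [Fact (1 ≤ p)] : Submodule ℂ (LpT p) where
  carrier := {f | ∀ n : ℤ, n < 0 → coeff f n = 0}
  zero_mem' := fun n _ => by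
    have h : coeff (0 : LpT p) n = ∫ _ : Circle, (0 : ℂ) ∂arc := by
      refine integral_congr_ae ?_
      filter_upwards [Lp.coeFn_zero ℂ p arc] with t ht
      rw [ht, Pi.zero_apply, zero_mul]
    rw [h, integral_zero]
  add_mem' := fun {f g} hf hg n hn => by
    have h : coeff (f + g : LpT p) n = coeff f n + coeff g n := by
      unfold coeff
      rw [← integral_add (integrable_mul_zpow (integrable_LpT f) _)
        (integrable_mul_zpow (integrable_LpT g) _)]
      refine integral_congr_ae ?_
      filter_upwards [Lp.coeFn_add f g] with t ht
      rw [ht, Pi.add_apply, add_mul]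
    rw [h, hf n hn, hg n hn, add_zero]
  smul_mem' := fun c f hf n hn => by
    have h : coeff (c • f : LpT p) n = c * coeff f n := by
      unfold coeff
      rw [← integral_const_mul]
      refine integral_congr_ae ?_
      filter_upwards [Lp.coeFn_smul c f] with t ht
      rw [ht, Pi.smul_apply, smul_eq_mul, mul_assoc]
    rw [h, hf n hn, mul_zero]

/-- `P` acts on `L^p` as the Riesz projection `∑ f̂ₙ tⁿ ↦ ∑_{n ≥ 0} f̂ₙ tⁿ`. -/
def IsRieszProjection (p : ℝ≥0∞) [Fact (1 ≤ p)] (P : LpT p →L[ℂ] LpT p) : Prop :=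
  ∀ (f : LpT p) (n : ℤ), coeff (P f) n = if 0 ≤ n then coeff f n else 0

open Classical in
/-- The Riesz projection on `L^p`, as a bounded operator. For `1 < p < ∞` such an operator
exists (theorem of M. Riesz) and it is unique; for the other exponents the value is `0`. -/
def rieszP (p : ℝ≥0∞) [Fact (1 ≤ p)] : LpT p →L[ℂ] LpT p :=
  if h : ∃ P : LpT p →L[ℂ] LpT p, IsRieszProjection p P then h.choose else 0

theorem rieszP_mem (p : ℝ≥0∞) [Fact (1 ≤ p)] (f : LpT p) : rieszP p f ∈ hardy p := by
  unfold rieszP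
  split_ifs with h
  · intro n hn
    rw [h.choose_spec f n, if_neg (not_le.mpr hn)]
  · exact (hardy p).zero_mem

/-- The Riesz projection `P`, with its values in `H^p`. -/
def projP (p : ℝ≥0∞) [Fact (1 ≤ p)] : LpT p →L[ℂ] hardy p :=
  (rieszP p).codRestrict (hardy p) (rieszP_mem p)

/-- The complementary projection `Q = I - P`. -/
def projQ (p : ℝ≥0∞) [Fact (1 ≤ p)] : LpT p →L[ℂ] LpT p :=
  ContinuousLinearMap.id ℂ (LpT p) - rieszP p

open Classical in
/-- The operator of multiplication by a function `g ∈ L^∞` on `L^p`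
(by convention `0` if `g` is not in `L^∞`). -/
def mulOp (p : ℝ≥0∞) [Fact (1 ≤ p)] (g : Circle → ℂ) : LpT p →L[ℂ] LpT p :=
  if h : MemLp g ∞ arc then (ContinuousLinearMap.mul ℂ ℂ).holderL arc ∞ p p (h.toLp g) else 0

theorem mulOp_ae (p : ℝ≥0∞) [Fact (1 ≤ p)] {g : Circle → ℂ} (hg : MemLp g ∞ arc) (f : LpT p) :
    mulOp p g f =ᵐ[arc] fun t => g t * f t := by
  unfold mulOp
  rw [dif_pos hg]
  refine ((ContinuousLinearMap.mul ℂ ℂ).coeFn_holder (hg.toLp g) f).trans ?_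
  filter_upwards [hg.coeFn_toLp] with t ht
  rw [ht]
  rfl

/-! ### The shift `α` and the weighted shift operator `J_α` -/

theorem denom_ne_zero {β : ℂ} (hβ : 1 < ‖β‖) (t : Circle) : conj β * (t : ℂ) - 1 ≠ 0 := by
  intro h
  have h1 : ‖conj β * (t : ℂ)‖ = 1 := by rw [sub_eq_zero.mp h, norm_one]
  rw [norm_mul, Complex.norm_conj, Circle.norm_coe, mul_one] at h1
  linarith

theorem norm_shift {β : ℂ} (hβ : 1 < ‖β‖) (t : Circle) :
    ‖((t : ℂ) - β) / (conj β * (t : ℂ) - 1)‖ = 1 := by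
  have h : ‖(t : ℂ) - β‖ = ‖conj β * (t : ℂ) - 1‖ := by
    have e : conj β * (t : ℂ) - 1 = -((t : ℂ) * conj ((t : ℂ) - β)) := by
      have ht : (t : ℂ) * conj (t : ℂ) = 1 := by
        rw [Complex.mul_conj, Circle.normSq_coe, Complex.ofReal_one]
      rw [map_sub, mul_sub, ht]
      ring
    rw [e, norm_neg, norm_mul, Circle.norm_coe, one_mul, Complex.norm_conj]
  rw [norm_div, h, div_self]
  exact norm_ne_zero_iff.mpr (denom_ne_zero hβ t)

/-- The shift `α(t) = (t - β) / (β̄ t - 1)` of the unit circle, where `|β| > 1`. -/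
def shift {β : ℂ} (hβ : 1 < ‖β‖) (t : Circle) : Circle :=
  ⟨((t : ℂ) - β) / (conj β * (t : ℂ) - 1), mem_sphere_zero_iff_norm.mpr (norm_shift hβ t)⟩

theorem coe_shift {β : ℂ} (hβ : 1 < ‖β‖) (t : Circle) :
    (shift hβ t : ℂ) = ((t : ℂ) - β) / (conj β * (t : ℂ) - 1) := rfl

theorem continuous_shift {β : ℂ} (hβ : 1 < ‖β‖) : Continuous (shift hβ) := by
  refine Continuous.subtype_mk ?_ _
  exact Continuous.div (by fun_prop) (by fun_prop) (denom_ne_zero hβ)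

/-- The number `λ = i √(|β|² - 1)`. -/
def lam (β : ℂ) : ℂ := I * (Real.sqrt (‖β‖ ^ 2 - 1) : ℂ)

/-- The function `α₋(t) = λ t / (β̄ t - 1)`. -/
def alphaMinus (β : ℂ) (t : Circle) : ℂ := lam β * (t : ℂ) / (conj β * (t : ℂ) - 1)

/-- The function `χ(t) = t / α₋(t)`. -/
def chi (β : ℂ) (t : Circle) : ℂ := (t : ℂ) / alphaMinus β t

theorem lam_sq {β : ℂ} (hβ : 1 < ‖β‖) : lam β ^ 2 = 1 - (‖β‖ : ℂ) ^ 2 := by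
  have h : (0 : ℝ) ≤ ‖β‖ ^ 2 - 1 := by nlinarith
  rw [lam, mul_pow, I_sq, ← ofReal_pow, Real.sq_sqrt h]
  push_cast
  ring

theorem lam_ne_zero {β : ℂ} (hβ : 1 < ‖β‖) : lam β ≠ 0 := by
  intro h
  have h2 := lam_sq hβ
  rw [h] at h2
  have h3 : (0 : ℝ) ^ 2 = 1 - ‖β‖ ^ 2 := by exact_mod_cast h2
  nlinarith

theorem chi_eq {β : ℂ} (t : Circle) : chi β t = (conj β * (t : ℂ) - 1) / lam β := by
  have ht : (t : ℂ) ≠ 0 := Circle.coe_ne_zero t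
  rw [chi, alphaMinus, div_div_eq_mul_div, mul_comm (lam β), mul_div_mul_left _ _ ht]

theorem continuous_chi (β : ℂ) : Continuous (chi β) := by
  have h : chi β = fun t : Circle => (conj β * (t : ℂ) - 1) / lam β := funext chi_eq
  rw [h]
  fun_prop

theorem chi_ne_zero {β : ℂ} (hβ : 1 < ‖β‖) (t : Circle) : chi β t ≠ 0 := by
  rw [chi_eq]
  exact div_ne_zero (denom_ne_zero hβ t) (lam_ne_zero hβ)

theorem shift_shift {β : ℂ} (hβ : 1 < ‖β‖) (t : Circle) : shift hβ (shift hβ t) = t := by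
  apply Subtype.ext
  have h1 := denom_ne_zero hβ t
  have h2 := denom_ne_zero hβ (shift hβ t)
  change ((shift hβ t : ℂ) - β) / (conj β * (shift hβ t : ℂ) - 1) = (t : ℂ)
  rw [coe_shift] at h2 ⊢
  rw [div_eq_iff h2]
  generalize (t : ℂ) = z at h1 ⊢
  generalize conj β = w at h1 ⊢
  rw [div_sub' h1, mul_div_assoc', div_sub_one h1, mul_div_assoc']
  congr 1
  ring

theorem lipschitz_shift {β : ℂ} (hβ : 1 < ‖β‖) : ∃ K : ℝ≥0, LipschitzWith K (shift hβ) := by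
  have hpos : 0 < ‖β‖ - 1 := by linarith
  have hden : ∀ t : Circle, ‖β‖ - 1 ≤ ‖conj β * (t : ℂ) - 1‖ := by
    intro t
    have h := norm_sub_norm_le (conj β * (t : ℂ)) 1
    rwa [norm_mul, Complex.norm_conj, Circle.norm_coe, mul_one, norm_one] at h
  refine ⟨(‖β‖₊ ^ 2 + 1) / (‖β‖ - 1).toNNReal ^ 2, LipschitzWith.of_dist_le_mul fun s t => ?_⟩
  have e : (shift hβ s : ℂ) - (shift hβ t : ℂ) =
      (β * conj β - 1) * ((s : ℂ) - (t : ℂ)) /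
        ((conj β * (s : ℂ) - 1) * (conj β * (t : ℂ) - 1)) := by
    have h1 := denom_ne_zero hβ s
    have h2 := denom_ne_zero hβ t
    rw [coe_shift, coe_shift, div_sub_div _ _ h1 h2]
    congr 1
    ring
  have hd : dist (shift hβ s) (shift hβ t) = ‖(shift hβ s : ℂ) - (shift hβ t : ℂ)‖ := by
    rw [← dist_eq_norm]
    rfl
  have hd' : dist s t = ‖(s : ℂ) - (t : ℂ)‖ := by
    rw [← dist_eq_norm]
    rfl
  have hn : ‖β * conj β - 1‖ ≤ ‖β‖ ^ 2 + 1 := by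
    refine (norm_sub_le _ _).trans ?_
    rw [norm_mul, Complex.norm_conj, norm_one, sq]
  rw [hd, hd', e, norm_div, norm_mul, norm_mul]
  push_cast
  rw [Real.coe_toNNReal _ hpos.le, div_mul_eq_mul_div]
  have hs := hden s
  have ht := hden t
  gcongr
  rw [sq]
  gcongr

/-- Arc length is invariant under rotations. -/
instance instInvariantArc : arc.IsMulLeftInvariant := by
  refine ⟨fun c => ?_⟩
  obtain ⟨x, rfl⟩ := (AddCircle.homeomorphCircle Real.two_pi_pos.ne').surjective c
  rw [AddCircle.homeomorphCircle_apply]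
  have hm : Measurable (AddCircle.toCircle (T := 2 * Real.pi)) :=
    AddCircle.continuous_toCircle.measurable
  have e : (fun y : Circle => AddCircle.toCircle x * y) ∘
      (AddCircle.toCircle (T := 2 * Real.pi)) =
      (AddCircle.toCircle (T := 2 * Real.pi)) ∘ fun y => x + y := by
    funext y
    exact (AddCircle.toCircle_add x y).symm
  unfold arc
  rw [Measure.map_map (measurable_const_mul _) hm, e,
    ← Measure.map_map hm (measurable_const_add _), map_add_left_eq_self]

theorem lipschitz_exp : LipschitzWith 1 Circle.exp := by
  refine LipschitzWith.of_dist_le_mul fun x y => ?_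
  have hd : dist (Circle.exp x) (Circle.exp y) = ‖(Circle.exp x : ℂ) - (Circle.exp y : ℂ)‖ := by
    rw [← dist_eq_norm]
    rfl
  have e : (Circle.exp x : ℂ) - (Circle.exp y : ℂ) =
      (Circle.exp y : ℂ) * (Complex.exp (I * ((x - y : ℝ) : ℂ)) - 1) := by
    rw [Circle.coe_exp, Circle.coe_exp, mul_sub, ← Complex.exp_add]
    push_cast
    ring_nf
  rw [hd, e, norm_mul, Circle.norm_coe, one_mul, NNReal.coe_one, one_mul, Real.dist_eq,
    ← Real.norm_eq_abs]
  exact Real.norm_exp_I_mul_ofReal_sub_one_le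

/-- One-dimensional Hausdorff measure on the circle is a finite nonzero multiple of `arc`. -/
theorem hausdorff_eq_smul_arc :
    ∃ c : ℝ≥0∞, c ≠ 0 ∧ c ≠ ∞ ∧ (Measure.hausdorffMeasure 1 : Measure Circle) = c • arc := by
  have hfin : (Measure.hausdorffMeasure 1 : Measure Circle) Set.univ < ∞ := by
    have hsub : (Set.univ : Set Circle) ⊆ Circle.exp '' Set.Icc (-Real.pi) Real.pi := by
      intro t _
      exact ⟨Complex.arg t, ⟨(Complex.neg_pi_lt_arg _).le, Complex.arg_le_pi _⟩,
        Circle.exp_arg t⟩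
    calc (Measure.hausdorffMeasure 1 : Measure Circle) Set.univ
        ≤ Measure.hausdorffMeasure 1 (Circle.exp '' Set.Icc (-Real.pi) Real.pi) :=
          measure_mono hsub
      _ ≤ ((1 : ℝ≥0) : ℝ≥0∞) ^ (1 : ℝ) *
          Measure.hausdorffMeasure 1 (Set.Icc (-Real.pi) Real.pi) :=
          lipschitz_exp.hausdorffMeasure_image_le zero_le_one _
      _ < ∞ := by
          rw [hausdorffMeasure_real]
          simp
  have : IsFiniteMeasure (Measure.hausdorffMeasure 1 : Measure Circle) := ⟨hfin⟩
  have : IsIsometricSMul Circle Circle := ⟨fun c => by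
    refine Isometry.of_dist_eq fun x y => ?_
    have h : ∀ u v : Circle, dist u v = ‖(u : ℂ) - (v : ℂ)‖ := fun u v => by
      rw [← dist_eq_norm]
      rfl
    rw [h, h, smul_eq_mul, smul_eq_mul, Circle.coe_mul, Circle.coe_mul, ← mul_sub, norm_mul,
      Circle.norm_coe, one_mul]⟩
  have h0 : (Measure.hausdorffMeasure 1 : Measure Circle) Set.univ ≠ 0 := by
    intro h
    have hre : LipschitzWith 1 fun t : Circle => (t : ℂ).re := by
      refine LipschitzWith.of_dist_le_mul fun x y => ?_
      have h : dist x y = ‖(x : ℂ) - (y : ℂ)‖ := by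
        rw [← dist_eq_norm]
        rfl
      rw [h, NNReal.coe_one, one_mul, Real.dist_eq, ← Complex.sub_re]
      exact Complex.abs_re_le_norm _
    have hsub : Set.Icc (-1 : ℝ) 1 ⊆ (fun t : Circle => (t : ℂ).re) '' Set.univ := by
      intro x hx
      refine ⟨Circle.exp (Real.arccos x), trivial, ?_⟩
      change (Circle.exp (Real.arccos x) : ℂ).re = x
      rw [Circle.coe_exp, Complex.exp_ofReal_mul_I_re, Real.cos_arccos hx.1 hx.2]
    have h1 := hre.hausdorffMeasure_image_le zero_le_one Set.univ
    rw [h, mul_zero] at h1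
    have h2 := (measure_mono hsub).trans h1
    rw [hausdorffMeasure_real, Real.volume_Icc] at h2
    norm_num at h2
  refine ⟨Measure.hausdorffMeasure 1 (Set.univ : Set Circle), h0, hfin.ne, ?_⟩
  have hA := Measure.haarMeasure_unique (Measure.hausdorffMeasure 1 : Measure Circle) ⊤
  have hB := Measure.haarMeasure_unique arc ⊤
  have hC : arc ((⊤ : TopologicalSpace.PositiveCompacts Circle) : Set Circle) = 1 := by
    rw [TopologicalSpace.PositiveCompacts.coe_top]
    exact measure_univ
  rw [hC, one_smul] at hB
  rw [← hB, TopologicalSpace.PositiveCompacts.coe_top] at hA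
  exact hA

/-- The shift distorts arc length by a bounded factor. -/
theorem map_shift_le {β : ℂ} (hβ : 1 < ‖β‖) :
    ∃ K : ℝ≥0∞, K ≠ ∞ ∧ Measure.map (shift hβ) arc ≤ K • arc := by
  obtain ⟨K, hK⟩ := lipschitz_shift hβ
  obtain ⟨c, hc0, hc, hH⟩ := hausdorff_eq_smul_arc
  refine ⟨(K : ℝ≥0∞), ENNReal.coe_ne_top, Measure.le_iff.mpr fun s hs => ?_⟩
  rw [Measure.map_apply (continuous_shift hβ).measurable hs]
  have hsub : shift hβ ⁻¹' s = shift hβ '' s := by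
    ext t
    constructor
    · intro h
      exact ⟨shift hβ t, h, shift_shift hβ t⟩
    · rintro ⟨u, hu, rfl⟩
      change shift hβ (shift hβ u) ∈ s
      rwa [shift_shift]
  have h1 := hK.hausdorffMeasure_image_le zero_le_one s
  rw [hH, ENNReal.rpow_one, Measure.smul_apply, Measure.smul_apply, smul_eq_mul, smul_eq_mul,
    mul_left_comm, ENNReal.mul_le_mul_iff_right hc0 hc] at h1
  rwa [hsub, Measure.smul_apply, smul_eq_mul]

theorem ae_shift {β : ℂ} (hβ : 1 < ‖β‖) {r : Circle → Prop} (h : ∀ᵐ t ∂arc, r t) :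
    ∀ᵐ t ∂arc, r (shift hβ t) := by
  obtain ⟨K, _, hK⟩ := map_shift_le hβ
  exact ae_of_ae_map (continuous_shift hβ).measurable.aemeasurable
    ((Measure.absolutelyContinuous_of_le_smul hK).ae_le h)

theorem memLp_comp_shift {β : ℂ} (hβ : 1 < ‖β‖) {p : ℝ≥0∞} {f : Circle → ℂ}
    (hf : MemLp f p arc) : MemLp (fun t => f (shift hβ t)) p arc := by
  obtain ⟨K, hK, hle⟩ := map_shift_le hβ
  exact (hf.of_measure_le_smul hK hle).comp_of_map
    (continuous_shift hβ).measurable.aemeasurable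

/-- The composition operator `f ↦ f ∘ α` on `L^p`. -/
def compOp {β : ℂ} (hβ : 1 < ‖β‖) (p : ℝ≥0∞) [Fact (1 ≤ p)] : LpT p →L[ℂ] LpT p :=
  LinearMap.mkContinuousOfExistsBound
    { toFun := fun f => (memLp_comp_shift hβ (Lp.memLp f)).toLp _
      map_add' := fun f g => by
        rw [← MemLp.toLp_add]
        refine MemLp.toLp_congr _ _ ?_
        exact ae_shift hβ (Lp.coeFn_add f g)
      map_smul' := fun c f => by
        rw [RingHom.id_apply, ← MemLp.toLp_const_smul]
        refine MemLp.toLp_congr _ _ ?_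
        exact ae_shift hβ (Lp.coeFn_smul c f) }
    (by
      obtain ⟨K, hK, hle⟩ := map_shift_le hβ
      refine ⟨(K ^ (1 / p).toReal).toReal, fun f => ?_⟩
      have hb : eLpNorm (fun t => f (shift hβ t)) p arc ≤
          K ^ (1 / p).toReal * eLpNorm f p arc := by
        have hf : AEStronglyMeasurable f (Measure.map (shift hβ) arc) :=
          ((Lp.memLp f).of_measure_le_smul hK hle).aestronglyMeasurable
        have h := eLpNorm_map_measure (p := p) hf
          (continuous_shift hβ).measurable.aemeasurable
        refine h.symm.le.trans ?_
        exact eLpNorm_le_of_measure_le_smul hle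
      change ‖(memLp_comp_shift hβ (Lp.memLp f)).toLp _‖ ≤ _
      rw [Lp.norm_toLp, Lp.norm_def, ← ENNReal.toReal_mul]
      refine ENNReal.toReal_mono (ENNReal.mul_ne_top ?_ (Lp.eLpNorm_ne_top f)) hb
      exact ENNReal.rpow_ne_top_of_nonneg ENNReal.toReal_nonneg hK)

theorem compOp_ae {β : ℂ} (hβ : 1 < ‖β‖) (p : ℝ≥0∞) [Fact (1 ≤ p)] (f : LpT p) :
    compOp hβ p f =ᵐ[arc] fun t => f (shift hβ t) :=
  (memLp_comp_shift hβ (Lp.memLp f)).coeFn_toLp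

theorem memLp_chi_inv {β : ℂ} (hβ : 1 < ‖β‖) : MemLp (chi β)⁻¹ ∞ arc := by
  have hc : Continuous (chi β)⁻¹ := (continuous_chi β).inv₀ (chi_ne_zero hβ)
  obtain ⟨C, hC⟩ := (isCompact_range hc).isBounded.exists_norm_le
  exact memLp_top_of_bound hc.aestronglyMeasurable C
    (Filter.Eventually.of_forall fun t => hC _ ⟨t, rfl⟩)

/-- The weighted shift operator `(J_α f)(t) = t⁻¹ α₋(t) f(α(t)) = χ(t)⁻¹ f(α(t))` on `L^p`. -/
def flipJ {β : ℂ} (hβ : 1 < ‖β‖) (p : ℝ≥0∞) [Fact (1 ≤ p)] : LpT p →L[ℂ] LpT p :=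
  mulOp p (chi β)⁻¹ ∘L compOp hβ p

theorem flipJ_ae {β : ℂ} (hβ : 1 < ‖β‖) (p : ℝ≥0∞) [Fact (1 ≤ p)] (f : LpT p) :
    flipJ hβ p f =ᵐ[arc] fun t => (t : ℂ)⁻¹ * alphaMinus β t * f (shift hβ t) := by
  refine (mulOp_ae p (memLp_chi_inv hβ) (compOp hβ p f)).trans ?_
  filter_upwards [compOp_ae hβ p f] with t ht
  rw [ht, Pi.inv_apply, chi, inv_div, div_eq_inv_mul]

/-! ### Toeplitz and generalised Hankel operators -/

/-- The Toeplitz operator `T(g) f = P (g f)` on `H^p`. -/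
def toeplitz (p : ℝ≥0∞) [Fact (1 ≤ p)] (g : Circle → ℂ) : hardy p →L[ℂ] hardy p :=
  projP p ∘L mulOp p g ∘L (hardy p).subtypeL

/-- The generalised Hankel operator `H_α(g) f = P g Q J_α f` on `H^p`. -/
def hankel {β : ℂ} (hβ : 1 < ‖β‖) (p : ℝ≥0∞) [Fact (1 ≤ p)] (g : Circle → ℂ) :
    hardy p →L[ℂ] hardy p :=
  projP p ∘L mulOp p g ∘L projQ p ∘L flipJ hβ p ∘L (hardy p).subtypeL

/-- The index `dim ker A - dim (F / im A)` of a Fredholm operator `A : E → F`. -/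
def fredholmIndex {E F : Type*} [NormedAddCommGroup E] [NormedSpace ℂ E]
    [NormedAddCommGroup F] [NormedSpace ℂ F] (A : E →L[ℂ] F) : ℤ :=
  (Module.finrank ℂ A.ker : ℤ) - (Module.finrank ℂ (F ⧸ A.range) : ℤ)

theorem integrable_pairing {p q : ℝ≥0∞} [ENNReal.HolderConjugate p q] (f : LpT p) (g : LpT q) :
    Integrable (fun t => f t * conj (g t)) arc :=
  (Lp.memLp f).integrable_mul (Lp.memLp g).star

/-- The cokernel of `A : H^p → H^p`, that is the kernel of the adjoint operator of `A`, the dual of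
`H^p` being identified with `H^q`, `1/p + 1/q = 1`, through the pairing `∫ f ḡ |dt|`. -/
def coker (p q : ℝ≥0∞) [Fact (1 ≤ p)] [Fact (1 ≤ q)] [ENNReal.HolderConjugate p q]
    (A : hardy p →L[ℂ] hardy p) : Submodule ℂ (hardy q) where
  carrier := {g | ∀ f : hardy p, ∫ t, (A f : LpT p) t * conj ((g : LpT q) t) ∂arc = 0}
  zero_mem' := fun f => by
    rw [← integral_zero Circle ℂ (μ := arc)]
    refine integral_congr_ae ?_
    filter_upwards [Lp.coeFn_zero ℂ q arc] with t ht
    rw [ZeroMemClass.coe_zero, ht, Pi.zero_apply, map_zero, mul_zero]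
  add_mem' := fun {g h} hg hh f => by
    have e : ∫ t, (A f : LpT p) t * conj (((g + h : hardy q) : LpT q) t) ∂arc =
        ∫ t, (A f : LpT p) t * conj ((g : LpT q) t) ∂arc +
          ∫ t, (A f : LpT p) t * conj ((h : LpT q) t) ∂arc := by
      rw [← integral_add (integrable_pairing _ _) (integrable_pairing _ _)]
      refine integral_congr_ae ?_
      filter_upwards [Lp.coeFn_add (g : LpT q) (h : LpT q)] with t ht
      rw [Submodule.coe_add, ht, Pi.add_apply, map_add, mul_add]
    rw [e, hg f, hh f, add_zero]
  smul_mem' := fun c g hg f => by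
    have e : ∫ t, (A f : LpT p) t * conj (((c • g : hardy q) : LpT q) t) ∂arc = conj c * 0 := by
      rw [← hg f, ← integral_const_mul]
      refine integral_congr_ae ?_
      filter_upwards [Lp.coeFn_smul c (g : LpT q)] with t ht
      rw [Submodule.coe_smul, ht, Pi.smul_apply, smul_eq_mul, map_mul, mul_left_comm]
    rw [e, mul_zero]

/-! ### Matching pairs -/

/-- `(a, b)` is an `α`-matching pair: `a, b ∈ L^∞`, `a` is invertible in `L^∞`, and
`a (a ∘ α) = b (b ∘ α)`. -/
structure IsMatchingPair {β : ℂ} (hβ : 1 < ‖β‖) (a b : Circle → ℂ) : Prop where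
  left_mem : MemLp a ∞ arc
  right_mem : MemLp b ∞ arc
  left_ne_zero : ∀ᵐ t ∂arc, a t ≠ 0
  left_inv_mem : MemLp a⁻¹ ∞ arc
  matching : ∀ᵐ t ∂arc, a t * a (shift hβ t) = b t * b (shift hβ t)

/-- The first entry `c = a b⁻¹` of the pair subordinated to `(a, b)`. -/
def subC (a b : Circle → ℂ) : Circle → ℂ := fun t => a t * (b t)⁻¹

/-- The second entry `d = b (a ∘ α)⁻¹` of the pair subordinated to `(a, b)`. -/
def subD {β : ℂ} (hβ : 1 < ‖β‖) (a b : Circle → ℂ) : Circle → ℂ :=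
  fun t => b t * (a (shift hβ t))⁻¹

/-- The complex conjugate of a function. -/
def cj (g : Circle → ℂ) : Circle → ℂ := fun t => conj (g t)

/-! ### Wiener–Hopf factorization and the `α`-signature -/

/-- The function `f` belongs to `H^p`. -/
def MemHardy (p : ℝ≥0∞) (f : Circle → ℂ) : Prop :=
  MemLp f p arc ∧ ∀ n : ℤ, n < 0 → coeff f n = 0

/-- The function `f` belongs to the conjugate Hardy space of exponent `p`. -/
def MemHardyConj (p : ℝ≥0∞) (f : Circle → ℂ) : Prop :=
  MemLp f p arc ∧ ∀ n : ℤ, 0 < n → coeff f n = 0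

/-- `g = g₋ tⁿ g₊`, `g₋(∞) = 1`, is a (weak) Wiener–Hopf factorization of `g` in `H^p`
(`q` is the conjugate exponent), with index `n` and factors `g₋`, `g₊`. It is unique if it exists;
so, if `T(g)` is Fredholm on `H^p`, it is the Wiener–Hopf factorization of `g` in `H^p`. -/
structure IsWeakWienerHopf (p q : ℝ≥0∞) (g : Circle → ℂ) (n : ℤ) (gm gp : Circle → ℂ) : Prop where
  plus_mem : MemHardy q gp
  plus_inv_mem : MemHardy p gp⁻¹
  minus_mem : MemHardyConj p gm
  minus_inv_mem : MemHardyConj q gm⁻¹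
  ne_zero : ∀ᵐ t ∂arc, gm t ≠ 0 ∧ gp t ≠ 0
  at_infinity : coeff gm 0 = 1
  eq : ∀ᵐ t ∂arc, g t = gm t * (t : ℂ) ^ n * gp t

/-- The value at the point `z`, `|z| < 1`, of the holomorphic extension to the unit disc of a
function `f` in a Hardy space, by Cauchy's integral formula. -/
def diskValue (f : Circle → ℂ) (z : ℂ) : ℂ := ∫ t, f t * (t : ℂ) / ((t : ℂ) - z) ∂arc

open Classical in
/-- The `α`-signature `σ_α(g) = (λ / β̄)ⁿ g₊⁻¹(1 / β̄)` of `g`, where `g = g₋ t⁻ⁿ g₊` is the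
Wiener–Hopf factorization of `g` in `H^p` (which is unique if it exists). -/
def alphaSignature (β : ℂ) (p q : ℝ≥0∞) (g : Circle → ℂ) : ℂ :=
  if h : ∃ x : ℤ × (Circle → ℂ) × (Circle → ℂ), IsWeakWienerHopf p q g (-x.1) x.2.1 x.2.2 then
    (lam β / conj β) ^ h.choose.1 * diskValue (h.choose.2.2)⁻¹ (1 / conj β)
  else 0

/-! ### The kernel decomposition -/

/-- The operator `J_α Q` with values in `H^p`; since `J_α Q = P J_α`, the outer projection only
records that its values lie in `H^p`. -/
def flipQ {β : ℂ} (hβ : 1 < ‖β‖) (p : ℝ≥0∞) [Fact (1 ≤ p)] : LpT p →L[ℂ] hardy p :=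
  projP p ∘L flipJ hβ p ∘L projQ p

/-- The operator `J_α Q g P` on `H^p`, whose restriction to `ker T(g)` is `𝐏_α(g)`. -/
def pAlpha {β : ℂ} (hβ : 1 < ‖β‖) (p : ℝ≥0∞) [Fact (1 ≤ p)] (g : Circle → ℂ) :
    hardy p →L[ℂ] hardy p :=
  flipQ hβ p ∘L mulOp p g ∘L (hardy p).subtypeL

/-- The image of `𝐏_α^±(g) = (I ± 𝐏_α(g)) / 2` on `ker T(g)`, where `ε = ± 1` is the sign. -/
def imPAlpha {β : ℂ} (hβ : 1 < ‖β‖) (p : ℝ≥0∞) [Fact (1 ≤ p)] (ε : ℂ) (g : Circle → ℂ) :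
    Submodule ℂ (hardy p) :=
  Submodule.map ((1 / 2 : ℂ) • (ContinuousLinearMap.id ℂ (hardy p) + ε • pAlpha hβ p g)).toLinearMap
    (toeplitz p g).ker

/-- The right inverse `T_r⁻¹(g) = T(g t^κ)⁻¹ T(t^κ)` of a Fredholm Toeplitz operator `T(g)` of
index `κ ≥ 0`. -/
def toeplitzRightInv (p : ℝ≥0∞) [Fact (1 ≤ p)] (g : Circle → ℂ) : hardy p →L[ℂ] hardy p :=
  Ring.inverse (toeplitz p fun t => g t * (t : ℂ) ^ fredholmIndex (toeplitz p g)) ∘L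
    toeplitz p fun t => (t : ℂ) ^ fredholmIndex (toeplitz p g)

/-- The map `φ_α^±` of the matching pair `(a, b)` with subordinated pair `(c, d)`,
`2 φ_α^±(s) = T_r⁻¹(c) T(a_α⁻¹) s ∓ J_α Q c P T_r⁻¹(c) T(a_α⁻¹) s ± J_α Q a_α⁻¹ s`,
where `ε = ± 1` is the sign. -/
def phiAlpha {β : ℂ} (hβ : 1 < ‖β‖) (p : ℝ≥0∞) [Fact (1 ≤ p)] (ε : ℂ) (a b : Circle → ℂ) :
    hardy p →L[ℂ] hardy p :=
  let u : hardy p →L[ℂ] hardy p :=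
    toeplitzRightInv p (subC a b) ∘L toeplitz p fun t => (a (shift hβ t))⁻¹
  (1 / 2 : ℂ) • (u - ε • (pAlpha hβ p (subC a b) ∘L u) + ε • pAlpha hβ p fun t => (a (shift hβ t))⁻¹)

/-- The line (or zero space) `z f ℂ` in `H^p` spanned by the function `z f`. -/
def lineSpan (p : ℝ≥0∞) [Fact (1 ≤ p)] (z : ℂ) (f : Circle → ℂ) : Submodule ℂ (hardy p) :=
  Submodule.span ℂ {h | (h : LpT p) =ᵐ[arc] fun t => z * f t}

end ToeplitzHankel

end

open ToeplitzHankel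

noncomputable section

namespace ToeplitzHankel

/-! ### Bounded functionals on `L^p` -/

section Duality

variable {Ω : Type*} [MeasurableSpace Ω] {μ : Measure Ω} [IsFiniteMeasure μ] {p q : ℝ≥0∞}

/-! The space L^r splits into H^r and the functions with only negative frequencies (`MemNeg`), and
T(g)f = u says exactly that gf - u lies in the second summand. The weighted shift J = J_α is a
symmetric involution exchanging the two summands (`memNeg_flip`, `memHardy_flip`). Hence H_α(b)f =
P(b Jf), and by symmetry of J the cokernel of T(a) + εH_α(b) consists of the g in H^q for which ā g
+ ε conj(b_α) Jg has only negative frequencies (`mem_coker_iff`). Since J(χ^m g) = χ^(-m) Jg, this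
says that χ^m g lies in the kernel of T(a') + εH_α(b') for the pair a' = ā χ^(-m), b' = conj(b_α)
χ^m. As T(χ^(-m)) undoes T(χ^m), the outer shape of the formula follows (`coker_eq_map`).

The gain is that the pair (a', b') has the subordinated functions c' = conj(d) χ^(-2m) and d' =
conj(c). Because T(d) has positive index, Coburn's lemma makes it onto, and a dimension count makes
T(d t^κ₂) invertible (`bijective_toeplitz_of_index_pos`); its adjoint is then invertible too. Now
χ^(-2m) = α₋^(2m) t^(-2m), where α₋ and its inverse are antianalytic, so T(c' t^(2m-κ₂)) is
invertible on H^q. As 2m - κ₂ is 0 or 1, T(c') is onto, its kernel has that dimension, and T_r⁻¹(c')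
is a right inverse.

A right inverse is all that the kernel formula needs (`ker_toeplitz_add_hankel`). The image of
𝐏^ε(g) is {u : gu = εJu} (`mem_imPAlpha_iff`), so the argument becomes pointwise algebra: f ↦ εJ(a'f
+ εb'Jf) maps the kernel into im 𝐏^ε(d'), it annihilates exactly im 𝐏^(-ε)(c'), and φ^ε is a section
of it. The kernel is therefore the direct sum of im 𝐏^(-ε)(c') and φ^ε(im 𝐏^ε(d')).

If κ₂ is even, ker T(c') = 0 and the first summand disappears. If κ₂ is odd, ker T(c') is the line
through conj(d₋⁻¹), on which c'u = μJu with a sign μ; the first summand is the whole line when μ =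
-ε and zero when μ = ε. Pairing with α₋ identifies μ with the signature of conj(d)
(`alphaSignature_eq`).

The analytic background is built from duality of L^p, which carries the Riesz projection from L^p to
L^q, and from the theorem that a nonzero Hardy function vanishes only on a null set. The projection
on L^p itself comes for free: with the default value 0 for P no Toeplitz operator could have nonzero
index. -/

theorem hasSum_indicatorConstLp [Fact (1 ≤ p)] (hp : p ≠ ∞) {E : ℕ → Set Ω}
    (hE : ∀ i, MeasurableSet (E i)) (hd : Pairwise (Function.onFun Disjoint E)) :
    HasSum (fun i => indicatorConstLp p (hE i) (measure_ne_top μ _) (1 : ℂ))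
      (indicatorConstLp p (MeasurableSet.iUnion hE) (measure_ne_top μ _) (1 : ℂ)) := by
  have hfin : ∀ s : Finset ℕ, ∑ i ∈ s, indicatorConstLp p (hE i) (measure_ne_top μ _) (1 : ℂ) =
      indicatorConstLp p (Finset.measurableSet_biUnion s fun i _ => hE i)
        (measure_ne_top μ (⋃ i ∈ s, E i)) (1 : ℂ) := by
    intro s
    induction s using Finset.induction_on with
    | empty =>
      rw [Finset.sum_empty]
      simp
    | insert a s ha ih =>
      rw [Finset.sum_insert ha, ih, ← indicatorConstLp_disjoint_union]
      · congr 1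
        rw [Finset.set_biUnion_insert]
      · rw [Set.disjoint_iUnion₂_right]
        intro i hi
        exact hd fun h => ha (h ▸ hi)
  unfold HasSum
  simp_rw [hfin]
  refine tendsto_indicatorConstLp_set hp ?_
  -- A finite partial union misses a set of measure at most the tail of this convergent series.
  have h0 : ∑' i, μ (E i) ≠ ∞ := by
    rw [← measure_iUnion hd hE]
    exact measure_ne_top μ _
  refine tendsto_of_tendsto_of_tendsto_of_le_of_le tendsto_const_nhds
    (ENNReal.tendsto_tsum_compl_atTop_zero h0) (fun _ => zero_le) fun s => ?_
  refine le_trans (measure_mono ?_) (measure_iUnion_le _)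
  rintro x (⟨hx, hx'⟩ | ⟨hx, hx'⟩)
  · simp only [Set.mem_iUnion] at hx hx'
    obtain ⟨i, -, hi⟩ := hx
    exact absurd ⟨i, hi⟩ hx'
  · simp only [Set.mem_iUnion] at hx hx' ⊢
    obtain ⟨i, hi⟩ := hx
    exact ⟨⟨i, fun h => hx' ⟨i, h, hi⟩⟩, hi⟩

open Classical in
/-- The signed measure `E ↦ ℓ (1_E)` attached to a bounded real functional `ℓ` on `L^p`. -/
def functionalMeasure [Fact (1 ≤ p)] (hp : p ≠ ∞) (l : Lp ℂ p μ →L[ℝ] ℝ) : SignedMeasure Ω where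
  measureOf' E := if hE : MeasurableSet E then
    l (indicatorConstLp p hE (measure_ne_top μ E) (1 : ℂ)) else 0
  empty' := by
    rw [dif_pos MeasurableSet.empty, indicatorConstLp_empty, map_zero]
  not_measurable' E hE := dif_neg hE
  m_iUnion' E hE hd := by
    rw [dif_pos (MeasurableSet.iUnion hE)]
    simp_rw [dif_pos (hE _)]
    exact (hasSum_indicatorConstLp hp hE hd).mapL l

theorem functionalMeasure_apply [Fact (1 ≤ p)] (hp : p ≠ ∞) (l : Lp ℂ p μ →L[ℝ] ℝ) {E : Set Ω}
    (hE : MeasurableSet E) :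
    functionalMeasure hp l E = l (indicatorConstLp p hE (measure_ne_top μ E) (1 : ℂ)) :=
  dif_pos hE

/-- Radon–Nikodym: the measure attached to l is absolutely continuous, because the indicator of a
null set is zero in L^p. -/
theorem exists_real_density [Fact (1 ≤ p)] (hp : p ≠ ∞) (l : Lp ℂ p μ →L[ℝ] ℝ) :
    ∃ g : Ω → ℝ, Integrable g μ ∧ ∀ (E : Set Ω) (hE : MeasurableSet E),
      l (indicatorConstLp p hE (measure_ne_top μ E) (1 : ℂ)) = ∫ x in E, g x ∂μ := by
  refine ⟨(functionalMeasure hp l).rnDeriv μ, SignedMeasure.integrable_rnDeriv _ _, ?_⟩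
  intro E hE
  have hac : functionalMeasure hp l ≪ᵥ μ.toENNRealVectorMeasure := by
    refine VectorMeasure.AbsolutelyContinuous.mk fun s hs h0 => ?_
    rw [Measure.toENNRealVectorMeasure_apply_measurable hs] at h0
    rw [functionalMeasure_apply hp l hs]
    have : indicatorConstLp p hs (measure_ne_top μ s) (1 : ℂ) = 0 := by
      rw [← norm_eq_zero, norm_indicatorConstLp (zero_lt_one.trans_le Fact.out).ne' hp,
        measureReal_def, h0, ENNReal.toReal_zero, Real.zero_rpow, mul_zero]
      exact one_div_ne_zero (ENNReal.toReal_pos (zero_lt_one.trans_le Fact.out).ne' hp).ne'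
    rw [this, map_zero]
  have h := SignedMeasure.withDensityᵥ_rnDeriv_eq _ μ hac
  rw [← withDensityᵥ_apply (SignedMeasure.integrable_rnDeriv _ _) hE, h,
    functionalMeasure_apply hp l hE]

theorem exists_density [Fact (1 ≤ p)] (hp : p ≠ ∞) (l : Lp ℂ p μ →L[ℂ] ℂ) :
    ∃ g : Ω → ℂ, Integrable g μ ∧ ∀ (E : Set Ω) (hE : MeasurableSet E),
      l (indicatorConstLp p hE (measure_ne_top μ E) (1 : ℂ)) = ∫ x in E, g x ∂μ := by
  obtain ⟨u, hu, hu'⟩ := exists_real_density hp (reCLM ∘L l.restrictScalars ℝ)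
  obtain ⟨v, hv, hv'⟩ := exists_real_density hp (imCLM ∘L l.restrictScalars ℝ)
  refine ⟨fun x => (u x : ℂ) + (v x : ℂ) * I, hu.ofReal.add (hv.ofReal.mul_const I), ?_⟩
  intro E hE
  change _ = ∫ x in E, ((u x : ℂ) + (v x : ℂ) * I) ∂μ
  have hu1 : Integrable (fun x => (u x : ℂ)) (μ.restrict E) := hu.ofReal.integrableOn
  have hv1 : Integrable (fun x => (v x : ℂ) * I) (μ.restrict E) :=
    (hv.ofReal.mul_const I).integrableOn
  rw [integral_add hu1 hv1, integral_mul_const, integral_complex_ofReal, integral_complex_ofReal,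
    ← hu' E hE, ← hv' E hE]
  exact (re_add_im _).symm

/-- Pairing with a bounded function. -/
theorem functional_eq_of_indicator [Fact (1 ≤ p)] (hp : p ≠ ∞) [ENNReal.HolderConjugate p q]
    (l : Lp ℂ p μ →L[ℂ] ℂ)
    {g : Ω → ℂ} (hg : MemLp g q μ) (h : ∀ (E : Set Ω) (hE : MeasurableSet E),
      l (indicatorConstLp p hE (measure_ne_top μ E) (1 : ℂ)) = ∫ x in E, g x ∂μ)
    (f : Lp ℂ p μ) : l f = ∫ x, f x * g x ∂μ := by
  have hq : Fact (1 ≤ q) := ⟨ENNReal.HolderConjugate.one_le q p⟩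
  have key : ∀ f : Lp ℂ p μ, ((ContinuousLinearMap.mul ℂ ℂ).lpPairing μ p q).flip (hg.toLp g) f =
      ∫ x, f x * g x ∂μ := by
    intro f
    rw [ContinuousLinearMap.flip_apply, ContinuousLinearMap.lpPairing_eq_integral]
    refine integral_congr_ae ?_
    filter_upwards [hg.coeFn_toLp] with x hx
    rw [hx]
    rfl
  rw [← key]
  -- Both sides are continuous and linear in f, so indicators suffice.
  refine Lp.induction hp (fun f => l f =
    ((ContinuousLinearMap.mul ℂ ℂ).lpPairing μ p q).flip (hg.toLp g) f) ?_ ?_ ?_ f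
  · intro c E hE hμE
    have e : (Lp.simpleFunc.indicatorConst p hE hμE.ne c : Lp ℂ p μ) =
        c • indicatorConstLp p hE (measure_ne_top μ E) (1 : ℂ) := by
      rw [Lp.simpleFunc.coe_indicatorConst]
      refine Lp.ext ?_
      filter_upwards [indicatorConstLp_coeFn (p := p) (hs := hE) (hμs := hμE.ne) (c := c),
        indicatorConstLp_coeFn (p := p) (hs := hE) (hμs := measure_ne_top μ E) (c := (1 : ℂ)),
        Lp.coeFn_smul c (indicatorConstLp p hE (measure_ne_top μ E) (1 : ℂ))] with x h1 h2 h3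
      rw [h1, h3, Pi.smul_apply, h2]
      by_cases hxE : x ∈ E <;> simp [hxE]
    rw [e, map_smul, map_smul, key, h E hE]
    congr 1
    rw [← integral_indicator hE]
    refine integral_congr_ae ?_
    filter_upwards [indicatorConstLp_coeFn (p := p) (hs := hE) (hμs := measure_ne_top μ E)
      (c := (1 : ℂ))] with x hx
    rw [hx]
    by_cases hxE : x ∈ E <;> simp [hxE]
  · intro f g hf hg _ h1 h2
    rw [map_add, map_add, h1, h2]
  · exact isClosed_eq l.continuous (ContinuousLinearMap.continuous _)


/-- Converse Hölder inequality for bounded functions. -/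
theorem eLpNorm_le_of_functional [Fact (1 ≤ p)] (hp1 : 1 < p) (hp : p ≠ ∞)
    [ENNReal.HolderConjugate p q] {C : ℝ} (l : Lp ℂ p μ →L[ℂ] ℂ) (hC : ‖l‖ ≤ C)
    {g : Ω → ℂ} (hg : MemLp g ∞ μ) (h : ∀ f : Lp ℂ p μ, l f = ∫ x, f x * g x ∂μ) :
    eLpNorm g q μ ≤ ENNReal.ofReal C := by
  have hq1 : 1 < q := (ENNReal.HolderConjugate.lt_top_iff_one_lt p q).1 hp.lt_top
  have hq : q ≠ ∞ := by
    have := ENNReal.HolderConjugate.symm (p := p) (q := q)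
    exact ((ENNReal.HolderConjugate.lt_top_iff_one_lt q p).2 hp1).ne
  have hq0 : q ≠ 0 := (zero_lt_one.trans hq1).ne'
  have hp0 : p ≠ 0 := (zero_lt_one.trans hp1).ne'
  have hpq : p.toReal.HolderConjugate q.toReal := by
    refine ENNReal.HolderConjugate.toReal ?_
    rw [← ENNReal.toReal_one]
    exact (ENNReal.toReal_lt_toReal ENNReal.one_ne_top hp).2 hp1
  have hgq : MemLp g q μ := hg.mono_exponent le_top
  set A : ℝ := ∫ x, ‖g x‖ ^ q.toReal ∂μ with hA
  have hA0 : 0 ≤ A := integral_nonneg fun x => by positivity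
  have hgn : eLpNorm g q μ = ENNReal.ofReal (A ^ q.toReal⁻¹) :=
    hgq.eLpNorm_eq_integral_rpow_norm hq0 hq
  rw [hgn]
  refine ENNReal.ofReal_le_ofReal ?_
  have hC0 : 0 ≤ C := (norm_nonneg _).trans hC
  rcases hA0.eq_or_lt with h0 | hApos
  · rw [← h0, Real.zero_rpow (inv_ne_zero hpq.symm.pos.ne')]
    exact hC0
  -- The extremal function for Hölder's inequality: fg = |g|^q and |f|^p = |g|^q. Thus l(f) = A and
  -- ‖f‖ = A^(1/p), so A ≤ C A^(1/p), that is A^(1/q) ≤ C.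
  let f : Ω → ℂ := fun x => conj (g x) * ((‖g x‖ ^ (q.toReal - 2) : ℝ) : ℂ)
  have hfn : ∀ x, ‖f x‖ = ‖g x‖ ^ (q.toReal - 1) := by
    intro x
    rw [norm_mul, Complex.norm_conj, Complex.norm_real, Real.norm_of_nonneg (by positivity)]
    rcases eq_or_ne ‖g x‖ 0 with hx | hx
    · rw [hx, zero_mul, Real.zero_rpow hpq.symm.sub_one_pos.ne']
    · rw [show q.toReal - 1 = 1 + (q.toReal - 2) by ring,
        Real.rpow_add ((norm_nonneg _).lt_of_ne' hx), Real.rpow_one]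
  have hfg : ∀ x, f x * g x = ((‖g x‖ ^ q.toReal : ℝ) : ℂ) := by
    intro x
    have e : f x * g x = ((‖g x‖ * ‖g x‖ * ‖g x‖ ^ (q.toReal - 2) : ℝ) : ℂ) := by
      push_cast
      rw [← sq, ← Complex.conj_mul']
      ring
    rw [e]
    congr 1
    rcases eq_or_ne ‖g x‖ 0 with hx | hx
    · rw [hx, zero_mul, zero_mul, Real.zero_rpow hpq.symm.pos.ne']
    · rw [mul_assoc]
      nth_rw 1 [← Real.rpow_one ‖g x‖]
      nth_rw 2 [← Real.rpow_one ‖g x‖]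
      have hx' : 0 < ‖g x‖ := (norm_nonneg _).lt_of_ne' hx
      rw [← Real.rpow_add hx', ← Real.rpow_add hx']
      congr 1
      ring
  have hfm : AEStronglyMeasurable f μ := by
    have h1 := hg.aestronglyMeasurable
    have h2 : AEMeasurable g μ := h1.aemeasurable
    refine AEMeasurable.aestronglyMeasurable ?_
    exact (Complex.continuous_conj.measurable.comp_aemeasurable h2).mul
      (Complex.measurable_ofReal.comp_aemeasurable (h2.norm.pow_const _))
  have hfp : MemLp f p μ := by
    refine MemLp.mono_exponent (q := ∞) ?_ le_top
    obtain ⟨K, hK⟩ : ∃ K : ℝ, ∀ᵐ x ∂μ, ‖g x‖ ≤ K :=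
      ⟨(eLpNormEssSup g μ).toReal, by
        filter_upwards [ae_le_eLpNormEssSup (f := g) (μ := μ)] with x hx
        have := ENNReal.toReal_mono (by simpa using hg.2.ne) hx
        simpa using this⟩
    refine memLp_top_of_bound hfm (K ^ (q.toReal - 1)) ?_
    filter_upwards [hK] with x hx
    rw [hfn]
    exact Real.rpow_le_rpow (norm_nonneg _) hx hpq.symm.sub_one_pos.le
  have hfnorm : ‖hfp.toLp f‖ = A ^ p.toReal⁻¹ := by
    rw [Lp.norm_toLp, hfp.eLpNorm_eq_integral_rpow_norm hp0 hp,
      ENNReal.toReal_ofReal (by positivity)]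
    congr 1
    refine integral_congr_ae (Filter.Eventually.of_forall fun x => ?_)
    change ‖f x‖ ^ p.toReal = ‖g x‖ ^ q.toReal
    rw [hfn, ← Real.rpow_mul (norm_nonneg _), hpq.symm.sub_one_mul_conj]
  have hlf : l (hfp.toLp f) = (A : ℂ) := by
    rw [h, hA, ← integral_complex_ofReal]
    refine integral_congr_ae ?_
    filter_upwards [hfp.coeFn_toLp] with x hx
    rw [hx, hfg]
  have hle : A ≤ C * A ^ p.toReal⁻¹ := by
    have h1 := l.le_of_opNorm_le hC (hfp.toLp f)
    rwa [hlf, hfnorm, Complex.norm_real, Real.norm_of_nonneg hA0] at h1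
  have hpos : 0 < A ^ p.toReal⁻¹ := Real.rpow_pos_of_pos hApos _
  refine le_of_mul_le_mul_right ?_ hpos
  rwa [← Real.rpow_add hApos, add_comm, hpq.inv_add_inv_eq_one, Real.rpow_one]

/-- Every bounded functional on `L^p`, `1 < p < ∞`, is represented by a function in `L^q`. -/
theorem exists_memLp_forall_eq_integral [Fact (1 ≤ p)] (hp1 : 1 < p) (hp : p ≠ ∞)
    [ENNReal.HolderConjugate p q] (l : Lp ℂ p μ →L[ℂ] ℂ) :
    ∃ g : Ω → ℂ, MemLp g q μ ∧ ∀ f : Lp ℂ p μ, l f = ∫ x, f x * g x ∂μ := by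
  obtain ⟨g₀, hg₀, hl₀⟩ := exists_density hp l
  let g := hg₀.1.mk g₀
  have hgm : StronglyMeasurable g := hg₀.1.stronglyMeasurable_mk
  have hgg : g₀ =ᵐ[μ] g := hg₀.1.ae_eq_mk
  have hl : ∀ (E : Set Ω) (hE : MeasurableSet E),
      l (indicatorConstLp p hE (measure_ne_top μ E) (1 : ℂ)) = ∫ x in E, g x ∂μ := by
    intro E hE
    rw [hl₀ E hE]
    exact integral_congr_ae (ae_restrict_of_ae hgg)
  -- The density is cut off where it exceeds n. The bounded truncation represents l composed with
  -- multiplication by an indicator, of norm at most ‖l‖, so its L^q norm is bounded uniformly in n;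
  -- Fatou's lemma then puts g itself in L^q.
  let S : ℕ → Set Ω := fun n => {x | ‖g x‖ ≤ n}
  have hS : ∀ n, MeasurableSet (S n) := fun n =>
    measurableSet_le hgm.norm.measurable measurable_const
  have hbd : ∀ n, eLpNorm ((S n).indicator g) q μ ≤ ENNReal.ofReal ‖l‖ := by
    intro n
    let M : Lp ℂ p μ →L[ℂ] Lp ℂ p μ := (ContinuousLinearMap.mul ℂ ℂ).holderL μ ∞ p p
      (indicatorConstLp ∞ (hS n) (measure_ne_top μ _) 1)
    have hM : ∀ f : Lp ℂ p μ, M f =ᵐ[μ] (S n).indicator f := by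
      intro f
      refine ((ContinuousLinearMap.mul ℂ ℂ).coeFn_holder _ f).trans ?_
      filter_upwards [indicatorConstLp_coeFn (p := ∞) (hs := hS n) (hμs := measure_ne_top μ _)
        (c := (1 : ℂ))] with x hx
      rw [hx]
      by_cases hxS : x ∈ S n <;> simp [hxS]
    have hM1 : ‖M‖ ≤ 1 := by
      refine ContinuousLinearMap.opNorm_le_bound _ zero_le_one fun f => ?_
      rw [one_mul]
      refine Lp.norm_le_norm_of_ae_le ?_
      filter_upwards [hM f] with x hx
      rw [hx]
      exact norm_indicator_le_norm_self _ _
    have hgn : MemLp ((S n).indicator g) ∞ μ := by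
      refine memLp_top_of_bound (hgm.indicator (hS n)).aestronglyMeasurable n ?_
      refine Filter.Eventually.of_forall fun x => ?_
      by_cases hxS : x ∈ S n
      · rw [Set.indicator_of_mem hxS]
        exact hxS
      · rw [Set.indicator_of_notMem hxS, norm_zero]
        exact Nat.cast_nonneg n
    refine eLpNorm_le_of_functional hp1 hp (l ∘L M) ?_ hgn fun f => ?_
    · refine (ContinuousLinearMap.opNorm_comp_le _ _).trans ?_
      exact mul_le_of_le_one_right (norm_nonneg _) hM1
    · refine functional_eq_of_indicator (q := q) hp (l ∘L M) (hgn.mono_exponent le_top) ?_ f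
      intro E hE
      have e : M (indicatorConstLp p hE (measure_ne_top μ E) (1 : ℂ)) =
          indicatorConstLp p (hE.inter (hS n)) (measure_ne_top μ _) (1 : ℂ) := by
        refine Lp.ext ?_
        filter_upwards [hM (indicatorConstLp p hE (measure_ne_top μ E) (1 : ℂ)),
          indicatorConstLp_coeFn (p := p) (hs := hE) (hμs := measure_ne_top μ _) (c := (1 : ℂ)),
          indicatorConstLp_coeFn (p := p) (hs := hE.inter (hS n)) (hμs := measure_ne_top μ _)
            (c := (1 : ℂ))] with x h1 h2 h3
        rw [h1, h3]
        by_cases hxS : x ∈ S n <;> by_cases hxE : x ∈ E <;> simp [hxS, hxE, h2]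
      rw [ContinuousLinearMap.comp_apply, e, hl, setIntegral_indicator (hS n)]
  have hgq : MemLp g q μ := by
    refine ⟨hgm.aestronglyMeasurable, lt_of_le_of_lt ?_ (ENNReal.ofReal_lt_top (r := ‖l‖))⟩
    refine (Lp.eLpNorm_lim_le_liminf_eLpNorm (f := fun n => (S n).indicator g)
      (fun n => (hgm.indicator (hS n)).aestronglyMeasurable) g ?_).trans ?_
    · refine Filter.Eventually.of_forall fun x => ?_
      obtain ⟨N, hN⟩ := exists_nat_ge ‖g x‖
      refine tendsto_const_nhds.congr' ?_
      filter_upwards [Filter.eventually_ge_atTop N] with n hn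
      have : x ∈ S n := hN.trans (Nat.cast_le.2 hn)
      rw [Set.indicator_of_mem this]
    · exact Filter.liminf_le_of_frequently_le' (Filter.Frequently.of_forall hbd)
  exact ⟨g, hgq, functional_eq_of_indicator hp l hgq hl⟩

end Duality

/-! ### Fourier coefficients -/

theorem measurableEmbedding_toCircle :
    MeasurableEmbedding (AddCircle.toCircle (T := 2 * Real.pi)) := by
  have h := (AddCircle.homeomorphCircle Real.two_pi_pos.ne').measurableEmbedding
  have e : ⇑(AddCircle.homeomorphCircle Real.two_pi_pos.ne') =
      AddCircle.toCircle (T := 2 * Real.pi) :=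
    funext fun x => AddCircle.homeomorphCircle_apply _ x
  rwa [e] at h

theorem integral_arc (f : Circle → ℂ) :
    ∫ t, f t ∂arc = ∫ x, f (AddCircle.toCircle (T := 2 * Real.pi) x) ∂AddCircle.haarAddCircle :=
  measurableEmbedding_toCircle.integral_map f

theorem integrable_arc_iff {f : Circle → ℂ} : Integrable f arc ↔
    Integrable (fun x => f (AddCircle.toCircle (T := 2 * Real.pi) x)) AddCircle.haarAddCircle :=
  measurableEmbedding_toCircle.integrable_map_iff

theorem continuous_coe_zpow (n : ℤ) : Continuous fun t : Circle => (t : ℂ) ^ n :=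
  Continuous.zpow₀ (by fun_prop) n fun t => Or.inl (Circle.coe_ne_zero t)

theorem memLp_of_continuous {g : Circle → ℂ} (hg : Continuous g) (p : ℝ≥0∞) : MemLp g p arc := by
  obtain ⟨C, hC⟩ := (isCompact_range hg).isBounded.exists_norm_le
  exact (memLp_top_of_bound hg.aestronglyMeasurable C
    (Filter.Eventually.of_forall fun t => hC _ ⟨t, rfl⟩)).mono_exponent le_top

/-- Integration against f is a bounded functional on the continuous functions which kills the
monomials, and these span a dense subspace. -/
theorem integral_mul_continuous_eq_zero {f : Circle → ℂ} (hf : Integrable f arc)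
    (h : ∀ n, coeff f n = 0) {g : Circle → ℂ} (hg : Continuous g) : ∫ t, f t * g t ∂arc = 0 := by
  have hF := integrable_arc_iff.1 hf
  set F : AddCircle (2 * Real.pi) → ℂ := fun x => f (AddCircle.toCircle x) with hFdef
  have hint : ∀ ψ : C(AddCircle (2 * Real.pi), ℂ),
      Integrable (fun x => F x * ψ x) AddCircle.haarAddCircle := fun ψ =>
    hF.mul_bdd (c := ‖ψ‖) ψ.continuous.aestronglyMeasurable
      (Filter.Eventually.of_forall fun x => ψ.norm_coe_le_norm x)
  let L : C(AddCircle (2 * Real.pi), ℂ) →L[ℂ] ℂ := LinearMap.mkContinuous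
    { toFun := fun ψ => ∫ x, F x * ψ x ∂AddCircle.haarAddCircle
      map_add' := fun ψ φ => by
        rw [← integral_add (hint ψ) (hint φ)]
        refine integral_congr_ae (Filter.Eventually.of_forall fun x => ?_)
        exact mul_add _ _ _
      map_smul' := fun c ψ => by
        rw [RingHom.id_apply, smul_eq_mul, ← integral_const_mul]
        refine integral_congr_ae (Filter.Eventually.of_forall fun x => ?_)
        exact mul_left_comm _ _ _ }
    (∫ x, ‖F x‖ ∂AddCircle.haarAddCircle) (fun ψ => by
      rw [← integral_mul_const]
      refine norm_integral_le_of_norm_le (hF.norm.mul_const _)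
        (Filter.Eventually.of_forall fun x => ?_)
      rw [norm_mul]
      exact mul_le_mul_of_nonneg_left (ψ.norm_coe_le_norm x) (norm_nonneg _))
  have hL : ∀ ψ, L ψ = 0 := by
    intro ψ
    have hle : (Submodule.span ℂ (Set.range (fourier (T := 2 * Real.pi)))).topologicalClosure ≤
        L.ker := by
      refine Submodule.topologicalClosure_minimal _ ?_ L.isClosed_ker
      rw [Submodule.span_le]
      rintro _ ⟨n, rfl⟩
      have hn := h (-n)
      rw [coeff, integral_arc] at hn
      rw [SetLike.mem_coe, LinearMap.mem_ker]
      refine Eq.trans (integral_congr_ae (Filter.Eventually.of_forall fun x => ?_)) hn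
      change F x * fourier n x = F x * _
      rw [fourier_apply, AddCircle.toCircle_zsmul, neg_neg, Circle.coe_zpow]
    rw [span_fourier_closure_eq_top] at hle
    exact hle (Submodule.mem_top (x := ψ))
  rw [integral_arc]
  exact hL ⟨fun x => g (AddCircle.toCircle x), hg.comp AddCircle.continuous_toCircle⟩

/-- An integrable function all of whose Fourier coefficients vanish is zero. -/
theorem ae_eq_zero_of_coeff {f : Circle → ℂ} (hf : Integrable f arc)
    (h : ∀ n, coeff f n = 0) : f =ᵐ[arc] 0 := by
  -- Closed sets suffice, and the indicator of a closed set is the pointwise limit of continuous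
  -- thickened indicators bounded by 1.
  refine ae_eq_zero_of_forall_setIntegral_isClosed_eq_zero hf fun s hs => ?_
  have hδ : ∀ n : ℕ, (0 : ℝ) < 1 / ((n : ℝ) + 1) := fun n => by positivity
  have hlim := thickenedIndicator_tendsto_indicator_closure hδ
    tendsto_one_div_add_atTop_nhds_zero_nat s
  rw [hs.closure_eq, tendsto_pi_nhds] at hlim
  rw [← integral_indicator hs.measurableSet]
  have hz : ∀ n : ℕ, ∫ t, f t * (((thickenedIndicator (hδ n) s t : ℝ≥0) : ℝ) : ℂ) ∂arc = 0 :=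
    fun n => integral_mul_continuous_eq_zero hf h (by fun_prop)
  have ht := tendsto_integral_of_dominated_convergence (μ := arc)
    (F := fun (n : ℕ) t => f t * (((thickenedIndicator (hδ n) s t : ℝ≥0) : ℝ) : ℂ))
    (f := s.indicator f) (fun t => ‖f t‖) ?_ hf.norm ?_ ?_
  · simp_rw [hz] at ht
    exact (tendsto_nhds_unique ht tendsto_const_nhds)
  · intro n
    refine hf.aestronglyMeasurable.mul (Continuous.aestronglyMeasurable (by fun_prop))
  · intro n
    refine Filter.Eventually.of_forall fun t => ?_
    rw [norm_mul, Complex.norm_real, Real.norm_of_nonneg NNReal.zero_le_coe]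
    refine mul_le_of_le_one_right (norm_nonneg _) ?_
    exact_mod_cast thickenedIndicator_le_one (hδ n) s t
  · refine Filter.Eventually.of_forall fun t => ?_
    have h1 : Filter.Tendsto (fun n : ℕ => (((thickenedIndicator (hδ n) s t : ℝ≥0) : ℝ) : ℂ))
        Filter.atTop (nhds (((s.indicator (fun _ => (1 : ℝ≥0)) t : ℝ≥0) : ℝ) : ℂ)) := by
      have hc : Continuous fun x : ℝ≥0 => ((x : ℝ) : ℂ) := by fun_prop
      exact (hc.tendsto _).comp (hlim t)
    have h2 := h1.const_mul (f t)
    convert h2 using 2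
    by_cases hts : t ∈ s <;> simp [hts]

section Coeff

theorem coeff_congr {f g : Circle → ℂ} (h : f =ᵐ[arc] g) (n : ℤ) : coeff f n = coeff g n :=
  integral_congr_ae (by filter_upwards [h] with t ht; rw [ht])

theorem coeff_add {f g : Circle → ℂ} (hf : Integrable f arc) (hg : Integrable g arc) (n : ℤ) :
    coeff (fun t => f t + g t) n = coeff f n + coeff g n := by
  unfold coeff
  rw [← integral_add (integrable_mul_zpow hf _) (integrable_mul_zpow hg _)]
  simp_rw [add_mul]

theorem coeff_sub {f g : Circle → ℂ} (hf : Integrable f arc) (hg : Integrable g arc) (n : ℤ) :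
    coeff (fun t => f t - g t) n = coeff f n - coeff g n := by
  unfold coeff
  rw [← integral_sub (integrable_mul_zpow hf _) (integrable_mul_zpow hg _)]
  simp_rw [sub_mul]

theorem coeff_const_mul (c : ℂ) (f : Circle → ℂ) (n : ℤ) :
    coeff (fun t => c * f t) n = c * coeff f n := by
  unfold coeff
  rw [← integral_const_mul]
  simp_rw [mul_assoc]

theorem coeff_mul_zpow (f : Circle → ℂ) (k n : ℤ) :
    coeff (fun t => f t * (t : ℂ) ^ k) n = coeff f (n - k) := by
  unfold coeff
  congr 1
  funext t
  rw [mul_assoc, ← zpow_add₀ (Circle.coe_ne_zero t)]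
  congr 2
  ring

theorem coeff_conj (f : Circle → ℂ) (n : ℤ) :
    coeff (fun t => conj (f t)) n = conj (coeff f (-n)) := by
  unfold coeff
  rw [← integral_conj]
  congr 1
  funext t
  rw [map_mul, map_zpow₀, ← Circle.coe_inv_eq_conj, Circle.coe_inv, inv_zpow', neg_neg]

theorem integral_zpow (n : ℤ) : ∫ t : Circle, (t : ℂ) ^ n ∂arc = if n = 0 then 1 else 0 := by
  have h := fourierCoeff_fourier (T := 2 * Real.pi) n
  have h0 := congrFun h 0
  rw [fourierCoeff] at h0
  rw [integral_arc]
  convert h0 using 1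
  · congr 1
    funext x
    rw [neg_zero, fourier_zero, one_smul, fourier_apply, AddCircle.toCircle_zsmul, Circle.coe_zpow]
  · rcases eq_or_ne n 0 with rfl | hn
    · simp
    · rw [if_neg hn, Pi.single_eq_of_ne hn.symm]

theorem coeff_zpow (k n : ℤ) : coeff (fun t => (t : ℂ) ^ k) n = if n = k then 1 else 0 := by
  unfold coeff
  have : (fun t : Circle => (t : ℂ) ^ k * (t : ℂ) ^ (-n)) = fun t : Circle => (t : ℂ) ^ (k - n) := by
    funext t
    rw [← zpow_add₀ (Circle.coe_ne_zero t), sub_eq_add_neg]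
  rw [this, integral_zpow]
  simp only [sub_eq_zero, eq_comm]

theorem coeff_const (c : ℂ) (n : ℤ) : coeff (fun _ => c) n = if n = 0 then c else 0 := by
  have h := coeff_const_mul c (fun t => (t : ℂ) ^ (0 : ℤ)) n
  rw [coeff_zpow] at h
  simpa using h

theorem ae_eq_of_coeff {f g : Circle → ℂ} (hf : Integrable f arc) (hg : Integrable g arc)
    (h : ∀ n, coeff f n = coeff g n) : f =ᵐ[arc] g := by
  have h0 := ae_eq_zero_of_coeff (hf.sub hg) fun n => by
    change coeff (fun t => f t - g t) n = 0
    rw [coeff_sub hf hg, h, sub_self]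
  filter_upwards [h0] with t ht
  exact sub_eq_zero.1 ht

theorem norm_coeff_le (f : Circle → ℂ) (n : ℤ) : ‖coeff f n‖ ≤ ∫ t, ‖f t‖ ∂arc := by
  refine (norm_integral_le_integral_norm _).trans_eq ?_
  congr 1
  funext t
  rw [norm_mul, norm_zpow, Circle.norm_coe, one_zpow, mul_one]

/-- A conjugated integral against a monomial is a Fourier coefficient. -/
theorem integral_mul_conj_zpow (f : Circle → ℂ) (n : ℤ) :
    ∫ t, f t * conj ((t : ℂ) ^ n) ∂arc = coeff f n := by
  unfold coeff
  congr 1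
  funext t
  rw [map_zpow₀, ← Circle.coe_inv_eq_conj, Circle.coe_inv, inv_zpow']

end Coeff

/-! ### Existence of the Riesz projection on `L^p` and `L^q` -/

section Riesz

variable {p q : ℝ≥0∞}

/-- The Riesz projection exists on `L^p`. -/
def HasRiesz (p : ℝ≥0∞) [Fact (1 ≤ p)] : Prop := ∃ P : LpT p →L[ℂ] LpT p, IsRieszProjection p P

/-- `f ↦ ∫ f g` as a bounded functional on `L^p`, where `g ∈ L^q`. -/
def pairL [Fact (1 ≤ p)] [Fact (1 ≤ q)] [ENNReal.HolderConjugate p q] {g : Circle → ℂ}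
    (hg : MemLp g q arc) : LpT p →L[ℂ] ℂ :=
  ((ContinuousLinearMap.mul ℂ ℂ).lpPairing arc p q).flip (hg.toLp g)

theorem pairL_apply [Fact (1 ≤ p)] [Fact (1 ≤ q)] [ENNReal.HolderConjugate p q] {g : Circle → ℂ}
    (hg : MemLp g q arc) (f : LpT p) : pairL hg f = ∫ t, f t * g t ∂arc := by
  rw [pairL, ContinuousLinearMap.flip_apply, ContinuousLinearMap.lpPairing_eq_integral]
  refine integral_congr_ae ?_
  filter_upwards [hg.coeFn_toLp] with x hx
  rw [hx]
  rfl

theorem continuous_coeff [Fact (1 ≤ p)] [Fact (1 ≤ q)] [ENNReal.HolderConjugate p q] (n : ℤ) :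
    Continuous fun f : LpT p => coeff f n := by
  have h := (pairL (p := p) (memLp_of_continuous (continuous_coe_zpow (-n)) q)).continuous
  convert h using 2 with f
  rw [pairL_apply]
  rfl

/-- The monomial `t ↦ t ^ n` in `L^p`. -/
def monoLp (p : ℝ≥0∞) (n : ℤ) : LpT p :=
  (memLp_of_continuous (continuous_coe_zpow n) p).toLp _

theorem monoLp_ae (p : ℝ≥0∞) (n : ℤ) : monoLp p n =ᵐ[arc] fun t => (t : ℂ) ^ n :=
  MemLp.coeFn_toLp _

theorem coeff_LpT_add [Fact (1 ≤ p)] (f g : LpT p) (n : ℤ) :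
    coeff (f + g : LpT p) n = coeff f n + coeff g n := by
  rw [← coeff_add (integrable_LpT f) (integrable_LpT g)]
  exact coeff_congr (Lp.coeFn_add f g) n

theorem coeff_LpT_smul (c : ℂ) (f : LpT p) (n : ℤ) :
    coeff (c • f : LpT p) n = c * coeff f n := by
  rw [← coeff_const_mul]
  exact coeff_congr (Lp.coeFn_smul c f) n

theorem LpT_ext_coeff [Fact (1 ≤ p)] {f g : LpT p} (h : ∀ n, coeff f n = coeff g n) : f = g :=
  Lp.ext (ae_eq_of_coeff (integrable_LpT f) (integrable_LpT g) h)

theorem riesz_monoLp [Fact (1 ≤ p)] {P : LpT p →L[ℂ] LpT p} (hP : IsRieszProjection p P) (n : ℤ) :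
    P (monoLp p n) = if 0 ≤ n then monoLp p n else 0 := by
  refine LpT_ext_coeff fun k => ?_
  rw [hP, coeff_congr (monoLp_ae p n), coeff_zpow]
  split_ifs with h1 h2 h3 h3 h2
  · rw [coeff_congr (monoLp_ae p n), coeff_zpow, if_pos h2]
  · omega
  · rw [coeff_congr (monoLp_ae p n), coeff_zpow, if_neg h2]
  · rw [coeff_congr (Lp.coeFn_zero ℂ p arc)]
    exact ((coeff_const 0 k).trans (ite_self 0)).symm
  · rw [coeff_congr (monoLp_ae p n), coeff_zpow, if_neg (by omega)]
  · rw [coeff_congr (Lp.coeFn_zero ℂ p arc)]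
    exact ((coeff_const 0 k).trans (ite_self 0)).symm

/-- The adjoint of P applied to g: the functional f ↦ ∫ (Pf) ḡ is represented by some k̄, and
testing it on monomials gives the coefficients of k. -/
theorem exists_rieszRep [Fact (1 ≤ p)] [Fact (1 ≤ q)] [ENNReal.HolderConjugate p q] (hp1 : 1 < p)
    (hp : p ≠ ∞) {P : LpT p →L[ℂ] LpT p} (hP : IsRieszProjection p P) {g : Circle → ℂ}
    (hg : MemLp g q arc) : ∃ k : Circle → ℂ, MemLp k q arc ∧
      (∀ f : LpT p, ∫ t, P f t * conj (g t) ∂arc = ∫ t, f t * conj (k t) ∂arc) ∧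
      ∀ n, coeff k n = if 0 ≤ n then coeff g n else 0 := by
  have hg' : MemLp (fun t => conj (g t)) q arc := hg.star
  obtain ⟨k, hk, hk'⟩ := exists_memLp_forall_eq_integral (q := q) hp1 hp (pairL hg' ∘L P)
  have hrep : ∀ f : LpT p, ∫ t, P f t * conj (g t) ∂arc = ∫ t, f t * k t ∂arc := fun f => by
    rw [← hk', ContinuousLinearMap.comp_apply, pairL_apply]
  refine ⟨fun t => conj (k t), hk.star, fun f => ?_, fun n => ?_⟩
  · simp_rw [conj_conj]
    exact hrep f
  · have h := hrep (monoLp p n)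
    rw [riesz_monoLp hP] at h
    have h2 : ∫ t, monoLp p n t * k t ∂arc = coeff k (-n) := by
      refine integral_congr_ae ?_
      filter_upwards [monoLp_ae p n] with t ht
      rw [ht, neg_neg, mul_comm]
    rw [coeff_conj, ← h2, ← h]
    split_ifs with hn
    · rw [← integral_conj]
      refine integral_congr_ae ?_
      filter_upwards [monoLp_ae p n] with t ht
      rw [ht, map_mul, conj_conj, mul_comm, map_zpow₀, ← Circle.coe_inv_eq_conj, Circle.coe_inv,
        inv_zpow']
    · have : ∫ t, (0 : LpT p) t * conj (g t) ∂arc = ∫ t : Circle, (0 : ℂ) ∂arc := by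
        refine integral_congr_ae ?_
        filter_upwards [Lp.coeFn_zero ℂ p arc] with t ht
        rw [ht, Pi.zero_apply, zero_mul]
      rw [this, integral_zero, map_zero]

/-- The adjoint provides the projected function for each g. It is linear because Fourier
coefficients determine a function, and bounded by the closed graph theorem because they depend
continuously on it. -/
theorem HasRiesz.dual [Fact (1 ≤ p)] [Fact (1 ≤ q)] [ENNReal.HolderConjugate p q] (hp1 : 1 < p)
    (hp : p ≠ ∞) (h : HasRiesz p) : HasRiesz q := by
  obtain ⟨P, hP⟩ := h
  have hex : ∀ g : LpT q, ∃ u : LpT q, ∀ n, coeff u n = if 0 ≤ n then coeff g n else 0 := by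
    intro g
    obtain ⟨k, hk, -, hk'⟩ := exists_rieszRep (q := q) hp1 hp hP (Lp.memLp g)
    refine ⟨hk.toLp k, fun n => ?_⟩
    rw [coeff_congr hk.coeFn_toLp, hk']
  choose R hR using hex
  let L : LpT q →ₗ[ℂ] LpT q :=
    { toFun := R
      map_add' := fun f g => LpT_ext_coeff fun n => by
        rw [coeff_LpT_add, hR, hR, hR, coeff_LpT_add]
        split_ifs <;> simp
      map_smul' := fun c f => LpT_ext_coeff fun n => by
        rw [RingHom.id_apply, coeff_LpT_smul, hR, hR, coeff_LpT_smul]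
        split_ifs <;> simp }
  have : ENNReal.HolderConjugate q p := ENNReal.HolderConjugate.symm
  have hL : Continuous L := by
    refine L.continuous_of_seq_closed_graph fun u x y hx hy => ?_
    refine LpT_ext_coeff fun n => ?_
    have h1 := ((continuous_coeff (p := q) (q := p) n).tendsto x).comp hx
    have h2 := ((continuous_coeff (p := q) (q := p) n).tendsto y).comp hy
    have e : coeff (L x) n = if 0 ≤ n then coeff x n else 0 := hR x n
    rw [e]
    have e2 : ((fun f : LpT q => coeff f n) ∘ (L ∘ u)) =
        fun k => if 0 ≤ n then coeff (u k) n else 0 := funext fun k => hR (u k) n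
    rw [e2] at h2
    split_ifs at h2 ⊢ with hn
    · exact tendsto_nhds_unique h2 h1
    · exact tendsto_nhds_unique h2 tendsto_const_nhds
  exact ⟨⟨L, hL⟩, fun f n => hR f n⟩

theorem rieszP_spec [Fact (1 ≤ p)] (h : HasRiesz p) : IsRieszProjection p (rieszP p) := by
  have h' : ∃ P : LpT p →L[ℂ] LpT p, IsRieszProjection p P := h
  unfold rieszP
  rw [dif_pos h']
  exact h'.choose_spec

/-- If the Riesz projection did not exist, Toeplitz operators would be zero, of index zero. -/
theorem hasRiesz_of_index_ne_zero [Fact (1 ≤ p)] {g : Circle → ℂ}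
    (h : fredholmIndex (toeplitz p g) ≠ 0) : HasRiesz p := by
  by_contra hno
  apply h
  have hno' : ¬ ∃ P : LpT p →L[ℂ] LpT p, IsRieszProjection p P := hno
  have h0 : toeplitz p g = 0 := by
    ext f
    change (rieszP p (mulOp p g (f : LpT p)) : Circle → ℂ) =ᵐ[arc] _
    unfold rieszP
    rw [dif_neg hno']
    rfl
  -- For the zero operator both the kernel and the quotient by the range are copies of H^p, so the
  -- two dimensions cancel whatever value `finrank` takes on H^p.
  rw [h0, fredholmIndex, ContinuousLinearMap.toLinearMap_zero, LinearMap.ker_zero,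
    LinearMap.range_zero, finrank_top, (Submodule.quotEquivOfEqBot ⊥ rfl).finrank_eq, sub_self]

/-- `1 < p < ∞`, `1/p + 1/q = 1`, and the Riesz projection acts on `L^p` and on `L^q`. -/
structure RieszPair (p q : ℝ≥0∞) [Fact (1 ≤ p)] [Fact (1 ≤ q)] : Prop where
  holder : ENNReal.HolderConjugate p q
  one_lt : 1 < p
  ne_top : p ≠ ∞
  left : HasRiesz p
  right : HasRiesz q

theorem RieszPair.mk' [Fact (1 ≤ p)] [Fact (1 ≤ q)] (h : ENNReal.HolderConjugate p q)
    (hp1 : 1 < p) (hp : p ≠ ∞) (hl : HasRiesz p) : RieszPair p q :=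
  ⟨h, hp1, hp, hl, hl.dual hp1 hp⟩

theorem RieszPair.symm [Fact (1 ≤ p)] [Fact (1 ≤ q)] (h : RieszPair p q) : RieszPair q p where
  holder := by
    have := h.holder
    exact ENNReal.HolderConjugate.symm
  one_lt := by
    have := h.holder
    exact (ENNReal.HolderConjugate.lt_top_iff_one_lt p q).1 h.ne_top.lt_top
  ne_top := by
    have := h.holder
    have : ENNReal.HolderConjugate q p := ENNReal.HolderConjugate.symm
    exact ((ENNReal.HolderConjugate.lt_top_iff_one_lt q p).2 h.one_lt).ne
  left := h.right
  right := h.left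

end Riesz

/-! ### Calculus in Hardy spaces -/

section Hardy

variable {p q : ℝ≥0∞}

/-- The function `f` belongs to the complement of `H^p` in `L^p`. -/
def MemNeg (p : ℝ≥0∞) (f : Circle → ℂ) : Prop :=
  MemLp f p arc ∧ ∀ n : ℤ, 0 ≤ n → coeff f n = 0

theorem MemHardy.congr {f g : Circle → ℂ} (hf : MemHardy p f) (h : f =ᵐ[arc] g) : MemHardy p g :=
  ⟨hf.1.ae_eq h, fun n hn => by rw [← coeff_congr h, hf.2 n hn]⟩

theorem MemNeg.congr {f g : Circle → ℂ} (hf : MemNeg p f) (h : f =ᵐ[arc] g) : MemNeg p g :=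
  ⟨hf.1.ae_eq h, fun n hn => by rw [← coeff_congr h, hf.2 n hn]⟩

theorem MemHardyConj.congr {f g : Circle → ℂ} (hf : MemHardyConj p f) (h : f =ᵐ[arc] g) :
    MemHardyConj p g :=
  ⟨hf.1.ae_eq h, fun n hn => by rw [← coeff_congr h, hf.2 n hn]⟩

theorem MemHardy.mono {f : Circle → ℂ} (hf : MemHardy p f) (h : q ≤ p) : MemHardy q f :=
  ⟨hf.1.mono_exponent h, hf.2⟩

theorem MemNeg.mono {f : Circle → ℂ} (hf : MemNeg p f) (h : q ≤ p) : MemNeg q f :=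
  ⟨hf.1.mono_exponent h, hf.2⟩

theorem MemHardyConj.mono {f : Circle → ℂ} (hf : MemHardyConj p f) (h : q ≤ p) :
    MemHardyConj q f :=
  ⟨hf.1.mono_exponent h, hf.2⟩

theorem MemHardy.conj {f : Circle → ℂ} (hf : MemHardy p f) :
    MemHardyConj p fun t => conj (f t) :=
  ⟨hf.1.star, fun n hn => by rw [coeff_conj, hf.2 (-n) (by omega), map_zero]⟩

theorem MemHardyConj.conj {f : Circle → ℂ} (hf : MemHardyConj p f) :
    MemHardy p fun t => conj (f t) :=
  ⟨hf.1.star, fun n hn => by rw [coeff_conj, hf.2 (-n) (by omega), map_zero]⟩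

theorem memLp_mul_zpow {f : Circle → ℂ} (hf : MemLp f p arc) (k : ℤ) :
    MemLp (fun t => f t * (t : ℂ) ^ k) p arc := by
  have h : MemLp (fun t : Circle => (t : ℂ) ^ k) ∞ arc :=
    memLp_of_continuous (continuous_coe_zpow k) ∞
  exact MemLp.mul' (p := p) (q := ∞) (r := p) h hf

theorem MemNeg.conj_mul {f : Circle → ℂ} (hf : MemNeg p f) :
    MemHardy p fun t => conj (f t) * (t : ℂ) ^ (-1 : ℤ) :=
  ⟨memLp_mul_zpow hf.1.star _, fun n hn => by
    rw [coeff_mul_zpow, coeff_conj, hf.2 _ (by omega), map_zero]⟩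

theorem MemHardy.mul_zpow {f : Circle → ℂ} (hf : MemHardy p f) {k : ℤ} (hk : 0 ≤ k) :
    MemHardy p fun t => f t * (t : ℂ) ^ k :=
  ⟨memLp_mul_zpow hf.1 _, fun n hn => by rw [coeff_mul_zpow, hf.2 _ (by omega)]⟩

theorem MemHardyConj.mul_zpow {f : Circle → ℂ} (hf : MemHardyConj p f) {k : ℤ} (hk : k ≤ 0) :
    MemHardyConj p fun t => f t * (t : ℂ) ^ k :=
  ⟨memLp_mul_zpow hf.1 _, fun n hn => by rw [coeff_mul_zpow, hf.2 _ (by omega)]⟩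

theorem MemHardyConj.mul_zpow_neg {f : Circle → ℂ} (hf : MemHardyConj p f) {k : ℤ} (hk : k < 0) :
    MemNeg p fun t => f t * (t : ℂ) ^ k :=
  ⟨memLp_mul_zpow hf.1 _, fun n hn => by rw [coeff_mul_zpow, hf.2 _ (by omega)]⟩

theorem MemNeg.mul_zpow {f : Circle → ℂ} (hf : MemNeg p f) {k : ℤ} (hk : k ≤ 0) :
    MemNeg p fun t => f t * (t : ℂ) ^ k :=
  ⟨memLp_mul_zpow hf.1 _, fun n hn => by rw [coeff_mul_zpow, hf.2 _ (by omega)]⟩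

theorem MemNeg.mul_self {f : Circle → ℂ} (hf : MemNeg p f) :
    MemHardyConj p fun t => f t * (t : ℂ) ^ (1 : ℤ) :=
  ⟨memLp_mul_zpow hf.1 _, fun n hn => by rw [coeff_mul_zpow, hf.2 _ (by omega)]⟩

section Linear

variable [hp : Fact (1 ≤ p)]

theorem MemHardy.sub {f g : Circle → ℂ} (hf : MemHardy p f) (hg : MemHardy p g) :
    MemHardy p fun t => f t - g t :=
  ⟨hf.1.sub hg.1, fun n hn => by
    rw [coeff_sub (hf.1.integrable hp.out) (hg.1.integrable hp.out), hf.2 n hn, hg.2 n hn, sub_zero]⟩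

theorem MemNeg.add {f g : Circle → ℂ} (hf : MemNeg p f) (hg : MemNeg p g) :
    MemNeg p fun t => f t + g t :=
  ⟨hf.1.add hg.1, fun n hn => by
    rw [coeff_add (hf.1.integrable hp.out) (hg.1.integrable hp.out), hf.2 n hn, hg.2 n hn, add_zero]⟩

theorem MemNeg.sub {f g : Circle → ℂ} (hf : MemNeg p f) (hg : MemNeg p g) :
    MemNeg p fun t => f t - g t :=
  ⟨hf.1.sub hg.1, fun n hn => by
    rw [coeff_sub (hf.1.integrable hp.out) (hg.1.integrable hp.out), hf.2 n hn, hg.2 n hn, sub_zero]⟩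

omit hp in
theorem MemHardy.const_mul {f : Circle → ℂ} (hf : MemHardy p f) (c : ℂ) :
    MemHardy p fun t => c * f t :=
  ⟨hf.1.const_mul c, fun n hn => by rw [coeff_const_mul, hf.2 n hn, mul_zero]⟩

omit hp in
theorem MemHardyConj.const_mul {f : Circle → ℂ} (hf : MemHardyConj p f) (c : ℂ) :
    MemHardyConj p fun t => c * f t :=
  ⟨hf.1.const_mul c, fun n hn => by rw [coeff_const_mul, hf.2 n hn, mul_zero]⟩

omit hp in
theorem MemNeg.const_mul {f : Circle → ℂ} (hf : MemNeg p f) (c : ℂ) :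
    MemNeg p fun t => c * f t :=
  ⟨hf.1.const_mul c, fun n hn => by rw [coeff_const_mul, hf.2 n hn, mul_zero]⟩

/-- `H^p` meets its complement trivially. -/
theorem MemHardy.eq_zero {f : Circle → ℂ} (hf : MemHardy p f) (hf' : MemNeg p f) :
    f =ᵐ[arc] 0 :=
  ae_eq_zero_of_coeff (hf.1.integrable hp.out) fun n => by
    rcases lt_or_ge n 0 with hn | hn
    · exact hf.2 n hn
    · exact hf'.2 n hn

end Linear

theorem memHardy_const (p : ℝ≥0∞) (c : ℂ) : MemHardy p fun _ => c :=
  ⟨memLp_of_continuous continuous_const p, fun n hn => by rw [coeff_const, if_neg hn.ne]⟩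

theorem memHardyConj_const (p : ℝ≥0∞) (c : ℂ) : MemHardyConj p fun _ => c :=
  ⟨memLp_of_continuous continuous_const p, fun n hn => by rw [coeff_const, if_neg hn.ne']⟩

section Pair

variable [Fact (1 ≤ p)] [Fact (1 ≤ q)] (H : RieszPair p q)
include H

theorem RieszPair.integrable_mul {f g : Circle → ℂ} (hf : MemLp f p arc) (hg : MemLp g q arc) :
    Integrable (fun t => f t * g t) arc :=
  have := H.holder
  hf.integrable_mul hg

/-- `H^p` annihilates the complement of `H^q`. -/
theorem RieszPair.integral_eq_zero {f g : Circle → ℂ} (hf : MemHardy p f) (hg : MemNeg q g) :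
    ∫ t, f t * conj (g t) ∂arc = 0 := by
  have := H.holder
  obtain ⟨P, hP⟩ := H.left
  -- Here k is the adjoint projection of g, which vanishes, while Pf = f.
  obtain ⟨k, hk, hk1, hk2⟩ := exists_rieszRep (q := q) H.one_lt H.ne_top hP hg.1
  have hk0 : k =ᵐ[arc] 0 := ae_eq_zero_of_coeff (hk.integrable Fact.out) fun n => by
    rw [hk2]
    split_ifs with hn
    · exact hg.2 n hn
    · rfl
  have hPf : P (hf.1.toLp f) = hf.1.toLp f := LpT_ext_coeff fun n => by
    rw [hP]
    split_ifs with hn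
    · rfl
    · rw [coeff_congr hf.1.coeFn_toLp, hf.2 n (by omega)]
  have h := hk1 (hf.1.toLp f)
  rw [hPf] at h
  have e1 : ∫ t, (hf.1.toLp f) t * conj (g t) ∂arc = ∫ t, f t * conj (g t) ∂arc := by
    refine integral_congr_ae ?_
    filter_upwards [hf.1.coeFn_toLp] with t ht
    rw [ht]
  refine e1.symm.trans (h.trans ?_)
  refine (integral_congr_ae ?_).trans (integral_zero Circle ℂ (μ := arc))
  filter_upwards [hk0] with t ht
  rw [ht, Pi.zero_apply, map_zero, mul_zero]

theorem RieszPair.integral_eq_zero' {f g : Circle → ℂ} (hf : MemNeg p f) (hg : MemHardy q g) :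
    ∫ t, f t * conj (g t) ∂arc = 0 := by
  have h := H.symm.integral_eq_zero hg hf
  have h2 := congrArg conj h
  rw [← integral_conj, map_zero] at h2
  rw [← h2]
  congr 1
  funext t
  rw [map_mul, conj_conj, mul_comm]

/-- For n < 0 the coefficient is the pairing of f with ḡ t^n, which has only negative frequencies.
-/
theorem RieszPair.coeff_mul_eq_zero {f g : Circle → ℂ} (hf : MemHardy p f) (hg : MemHardy q g)
    {n : ℤ} (hn : n < 0) : coeff (fun t => f t * g t) n = 0 := by
  have h := H.integral_eq_zero hf (hg.conj.mul_zpow_neg hn)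
  rw [← h]
  unfold coeff
  congr 1
  funext t
  rw [map_mul, conj_conj, map_zpow₀, ← Circle.coe_inv_eq_conj, Circle.coe_inv, inv_zpow', mul_assoc]

/-- Once its mean is removed, f is still in the Hardy space after division by t, so its product with
g has no coefficient at -1. -/
theorem RieszPair.coeff_mul_zero {f g : Circle → ℂ} (hf : MemHardy p f) (hg : MemHardy q g) :
    coeff (fun t => f t * g t) 0 = coeff f 0 * coeff g 0 := by
  have h1 : MemHardy p fun t => (f t - coeff f 0) * (t : ℂ) ^ (-1 : ℤ) := by
    have hs := hf.sub (memHardy_const p (coeff f 0))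
    refine ⟨memLp_mul_zpow hs.1 _, fun n hn => ?_⟩
    rw [coeff_mul_zpow, coeff_sub (hf.1.integrable Fact.out) (integrable_const _), coeff_const]
    split_ifs with h0
    · rw [h0, sub_self]
    · rw [hf.2 _ (by omega), sub_zero]
  have h2 := H.coeff_mul_eq_zero h1 hg (n := -1) (by norm_num)
  have e : (fun t : Circle => (f t - coeff f 0) * (t : ℂ) ^ (-1 : ℤ) * g t) =
      fun t : Circle => (f t * g t - coeff f 0 * g t) * (t : ℂ) ^ (-1 : ℤ) := by
    funext t
    ring
  have hi := H.integrable_mul hf.1 hg.1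
  rw [e, coeff_mul_zpow, sub_self, coeff_sub hi ((hg.1.integrable Fact.out).const_mul _),
    coeff_const_mul] at h2
  exact sub_eq_zero.1 h2

theorem RieszPair.mul_hardy {f g : Circle → ℂ} (hg : MemHardy ∞ g) (hf : MemHardy p f) :
    MemHardy p fun t => g t * f t :=
  ⟨hf.1.mul' hg.1, fun n hn => by
    have h := H.coeff_mul_eq_zero hf (hg.mono le_top) hn
    rwa [show (fun t => g t * f t) = fun t => f t * g t from funext fun t => mul_comm _ _]⟩

theorem RieszPair.mul_hardyConj {f g : Circle → ℂ} (hg : MemHardyConj ∞ g)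
    (hf : MemHardyConj p f) : MemHardyConj p fun t => g t * f t := by
  have h := (H.mul_hardy hg.conj hf.conj).conj
  simpa only [map_mul, conj_conj] using h

theorem RieszPair.mul_neg {f g : Circle → ℂ} (hg : MemHardyConj ∞ g) (hf : MemNeg p f) :
    MemNeg p fun t => g t * f t := by
  have h := (H.mul_hardyConj hg hf.mul_self).mul_zpow_neg (k := -1) (by norm_num)
  refine h.congr (Filter.Eventually.of_forall fun t => ?_)
  have := Circle.coe_ne_zero t
  simp only [zpow_neg, zpow_one]
  field_simp

theorem RieszPair.mul_hardy_top {f g : Circle → ℂ} (hg : MemHardy ∞ g) (hf : MemHardy ∞ f) :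
    MemHardy ∞ fun t => g t * f t :=
  ⟨hf.1.mul' hg.1, (H.mul_hardy hg (hf.mono le_top)).2⟩

theorem RieszPair.mul_hardyConj_top {f g : Circle → ℂ} (hg : MemHardyConj ∞ g)
    (hf : MemHardyConj ∞ f) : MemHardyConj ∞ fun t => g t * f t :=
  ⟨hf.1.mul' hg.1, (H.mul_hardyConj hg (hf.mono le_top)).2⟩

theorem RieszPair.pow_hardyConj_top {f : Circle → ℂ} (hf : MemHardyConj ∞ f) (n : ℕ) :
    MemHardyConj ∞ fun t => f t ^ n := by
  induction n with
  | zero => simpa using memHardyConj_const ∞ 1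
  | succ n ih =>
    simp_rw [pow_succ]
    exact H.mul_hardyConj_top ih hf

theorem RieszPair.pow_hardy_top {f : Circle → ℂ} (hf : MemHardy ∞ f) (n : ℕ) :
    MemHardy ∞ fun t => f t ^ n := by
  induction n with
  | zero => simpa using memHardy_const ∞ 1
  | succ n ih =>
    simp_rw [pow_succ]
    exact H.mul_hardy_top ih hf

theorem RieszPair.coeff_mul_conj_zero {f g : Circle → ℂ} (hf : MemHardyConj p f)
    (hg : MemHardyConj q g) :
    coeff (fun t => f t * g t) 0 = coeff f 0 * coeff g 0 := by
  have h := H.coeff_mul_zero hf.conj hg.conj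
  rw [coeff_conj, coeff_conj, neg_zero, ← map_mul] at h
  have e : coeff (fun t => conj (f t) * conj (g t)) 0 = conj (coeff (fun t => f t * g t) 0) := by
    simp_rw [← map_mul]
    rw [coeff_conj, neg_zero]
  rw [e] at h
  exact (starRingEnd ℂ).injective h

theorem RieszPair.coeff_mul_conj_eq_zero {f g : Circle → ℂ} (hf : MemHardyConj p f)
    (hg : MemHardyConj q g) {n : ℤ} (hn : 0 < n) : coeff (fun t => f t * g t) n = 0 := by
  have h := H.coeff_mul_eq_zero hf.conj hg.conj (n := -n) (by omega)
  simp_rw [← map_mul] at h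
  rw [coeff_conj, neg_neg] at h
  exact (map_eq_zero _).1 h

theorem RieszPair.coeff_pow_conj_zero {f : Circle → ℂ} (hf : MemHardyConj ∞ f) (n : ℕ) :
    coeff (fun t => f t ^ n) 0 = coeff f 0 ^ n := by
  induction n with
  | zero =>
    simp_rw [pow_zero]
    rw [coeff_const, if_pos rfl]
  | succ n ih =>
    simp_rw [pow_succ]
    rw [H.coeff_mul_conj_zero ((H.pow_hardyConj_top hf n).mono le_top) (hf.mono le_top), ih]

end Pair

end Hardy

/-! ### The rational functions attached to the shift -/

section Shift

variable {β : ℂ} (hβ : 1 < ‖β‖)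
include hβ

theorem num_ne_zero (t : Circle) : (t : ℂ) - β ≠ 0 := by
  intro h
  have h1 : ‖(t : ℂ)‖ = ‖β‖ := by rw [sub_eq_zero.1 h]
  rw [Circle.norm_coe] at h1
  linarith

theorem conj_beta_ne_zero : conj β ≠ 0 := by
  intro h
  rw [map_eq_zero] at h
  rw [h, norm_zero] at hβ
  linarith

theorem continuous_num_inv : Continuous fun t : Circle => ((t : ℂ) - β)⁻¹ :=
  Continuous.inv₀ (by fun_prop) (num_ne_zero hβ)

theorem continuous_denom_inv : Continuous fun t : Circle => (conj β * (t : ℂ) - 1)⁻¹ :=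
  Continuous.inv₀ (by fun_prop) (denom_ne_zero hβ)

/-- The recurrence expresses (t - β)(t - β)⁻¹ = 1 in Fourier coefficients. -/
theorem coeff_num_inv_succ (n : ℤ) :
    coeff (fun t : Circle => ((t : ℂ) - β)⁻¹) (n - 1) -
      β * coeff (fun t : Circle => ((t : ℂ) - β)⁻¹) n = if n = 0 then 1 else 0 := by
  have hi : Integrable (fun t : Circle => ((t : ℂ) - β)⁻¹) arc :=
    (memLp_of_continuous (continuous_num_inv hβ) 1).integrable le_rfl
  rw [← coeff_mul_zpow, ← coeff_const_mul, ← coeff_sub (integrable_mul_zpow hi 1) (hi.const_mul _),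
    ← coeff_const]
  congr 1
  funext t
  have := num_ne_zero hβ t
  rw [zpow_one, mul_comm, ← sub_mul, mul_inv_cancel₀ this]

/-- A nonzero coefficient of negative index would, by the recurrence, grow like |β|^k towards -∞,
although all coefficients are bounded by the L^1 norm. -/
theorem memHardy_num_inv : MemHardy ∞ fun t : Circle => ((t : ℂ) - β)⁻¹ := by
  refine ⟨memLp_of_continuous (continuous_num_inv hβ) ∞, fun n hn => ?_⟩
  set u : Circle → ℂ := fun t => ((t : ℂ) - β)⁻¹ with hu
  have hk : ∀ k : ℕ, coeff u (n - k) = β ^ k * coeff u n := by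
    intro k
    induction k with
    | zero => simp
    | succ k ih =>
      have h := coeff_num_inv_succ hβ (n - k)
      rw [if_neg (by omega), sub_eq_zero] at h
      rw [Nat.cast_succ, ← sub_sub, h, ih, pow_succ]
      ring
  by_contra h0
  obtain ⟨k, hk'⟩ := pow_unbounded_of_one_lt ((∫ t, ‖u t‖ ∂arc) / ‖coeff u n‖) hβ
  rw [div_lt_iff₀ (norm_pos_iff.2 h0), ← norm_pow, ← norm_mul, ← hk] at hk'
  exact absurd (norm_coeff_le u (n - k)) (not_le.2 hk')

/-- Conjugation carries the facts about (t - β)⁻¹ over to (β̄t - 1)⁻¹. -/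
theorem denom_inv_eq_conj (t : Circle) :
    (conj β * (t : ℂ) - 1)⁻¹ = conj (-(((t : ℂ) - β)⁻¹ * (t : ℂ) ^ (1 : ℤ))) := by
  have h1 := denom_ne_zero hβ t
  have ht := Circle.coe_ne_zero t
  have h2 : (t : ℂ)⁻¹ - conj β ≠ 0 := by
    intro h
    apply h1
    rw [← sub_eq_zero.1 h, inv_mul_cancel₀ ht, sub_self]
  rw [zpow_one, map_neg, map_mul, map_inv₀, map_sub, ← Circle.coe_inv_eq_conj, Circle.coe_inv]
  have h3 : 1 - conj β * (t : ℂ) ≠ 0 := fun h => h1 (by linear_combination -h)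
  field_simp
  ring

theorem memNeg_denom_inv : MemNeg ∞ fun t : Circle => (conj β * (t : ℂ) - 1)⁻¹ := by
  refine ⟨memLp_of_continuous (continuous_denom_inv hβ) ∞, fun n hn => ?_⟩
  simp_rw [denom_inv_eq_conj hβ]
  rw [coeff_conj]
  have e : (fun t : Circle => -(((t : ℂ) - β)⁻¹ * (t : ℂ) ^ (1 : ℤ))) =
    fun t : Circle => (-1) * (((t : ℂ) - β)⁻¹ * (t : ℂ) ^ (1 : ℤ)) := by
    funext t
    ring
  rw [e, coeff_const_mul, coeff_mul_zpow, (memHardy_num_inv hβ).2 _ (by omega), mul_zero, map_zero]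

/-- The analogous recurrence for (β̄t - 1)⁻¹, run downwards from index 0, where the coefficient
vanishes. -/
theorem coeff_denom_inv (k : ℕ) :
    coeff (fun t : Circle => (conj β * (t : ℂ) - 1)⁻¹) (-(k : ℤ) - 1) = (conj β)⁻¹ ^ (k + 1) := by
  set v : Circle → ℂ := fun t => (conj β * (t : ℂ) - 1)⁻¹ with hv
  have hi : Integrable v arc :=
    (memLp_of_continuous (continuous_denom_inv hβ) 1).integrable le_rfl
  have hrec : ∀ n : ℤ, conj β * coeff v (n - 1) - coeff v n = if n = 0 then 1 else 0 := by
    intro n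
    rw [← coeff_mul_zpow, ← coeff_const_mul, ← coeff_sub ((integrable_mul_zpow hi 1).const_mul _) hi,
      ← coeff_const]
    congr 1
    funext t
    have := denom_ne_zero hβ t
    simp only [hv, zpow_one]
    field_simp
  have hb := conj_beta_ne_zero hβ
  induction k with
  | zero =>
    have h := hrec 0
    rw [(memNeg_denom_inv hβ).2 0 le_rfl, sub_zero, if_pos rfl] at h
    rw [Nat.cast_zero, neg_zero, zero_add, pow_one]
    exact eq_inv_of_mul_eq_one_right h
  | succ k ih =>
    have h := hrec (-(k : ℤ) - 1)
    rw [if_neg (by omega), ih, sub_eq_zero] at h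
    rw [Nat.cast_succ, neg_add, ← sub_eq_add_neg, pow_succ' _ (k + 1), ← h, inv_mul_cancel_left₀ hb]

omit hβ in
theorem chi_inv_eq (t : Circle) : (chi β t)⁻¹ = lam β * (conj β * (t : ℂ) - 1)⁻¹ := by
  rw [chi_eq, inv_div, div_eq_mul_inv]

omit hβ in
theorem alphaMinus_eq (t : Circle) : alphaMinus β t = (chi β t)⁻¹ * (t : ℂ) ^ (1 : ℤ) := by
  rw [chi_inv_eq, alphaMinus, zpow_one]
  ring

theorem memNeg_chi_inv : MemNeg ∞ fun t => (chi β t)⁻¹ := by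
  simp_rw [chi_inv_eq]
  exact (memNeg_denom_inv hβ).const_mul _

omit hβ in
theorem memHardy_chi : MemHardy ∞ (chi β) := by
  have h1 : MemHardy ∞ fun t : Circle => (1 : ℂ) * (t : ℂ) ^ (1 : ℤ) :=
    (memHardy_const ∞ 1).mul_zpow zero_le_one
  have : Fact ((1 : ℝ≥0∞) ≤ ∞) := ⟨le_top⟩
  have h2 := ((h1.const_mul (conj β)).sub (memHardy_const ∞ 1)).const_mul (lam β)⁻¹
  refine h2.congr (Filter.Eventually.of_forall fun t => ?_)
  simp only [chi_eq, zpow_one]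
  field_simp

theorem memHardyConj_alphaMinus : MemHardyConj ∞ (alphaMinus β) := by
  rw [funext (alphaMinus_eq)]
  exact (memNeg_chi_inv hβ).mul_self

/-- The value of α₋ at infinity, which is the base of the power in the α-signature. -/
theorem coeff_alphaMinus : coeff (alphaMinus β) 0 = lam β / conj β := by
  rw [funext (alphaMinus_eq), coeff_mul_zpow]
  simp_rw [chi_inv_eq]
  have h := coeff_denom_inv hβ 0
  rw [Nat.cast_zero, neg_zero, zero_add, pow_one] at h
  rw [coeff_const_mul, h, div_eq_mul_inv]

theorem alphaMinus_ne_zero (t : Circle) : alphaMinus β t ≠ 0 := by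
  rw [alphaMinus_eq, zpow_one]
  exact mul_ne_zero (inv_ne_zero (chi_ne_zero hβ t)) (Circle.coe_ne_zero t)

theorem memHardyConj_alphaMinus_inv : MemHardyConj ∞ fun t => (alphaMinus β t)⁻¹ := by
  refine ⟨?_, fun n hn => ?_⟩
  · refine memLp_of_continuous ?_ ∞
    refine Continuous.inv₀ ?_ (alphaMinus_ne_zero hβ)
    rw [funext (alphaMinus_eq)]
    exact ((continuous_chi β).inv₀ (chi_ne_zero hβ)).mul (continuous_coe_zpow 1)
  · have e : (fun t => (alphaMinus β t)⁻¹) = fun t => chi β t * (t : ℂ) ^ (-1 : ℤ) := by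
      funext t
      rw [alphaMinus_eq, mul_inv, inv_inv, zpow_neg]
    have e2 : chi β = fun t : Circle => (lam β)⁻¹ * (conj β * (t : ℂ) ^ (1 : ℤ) - 1) := by
      funext t
      rw [chi_eq, zpow_one]
      field_simp
    rw [e, coeff_mul_zpow, e2, coeff_const_mul, coeff_sub, coeff_const_mul, coeff_zpow, coeff_const,
      if_neg (by omega), if_neg (by omega), mul_zero, sub_zero, mul_zero]
    · exact ((memLp_of_continuous (continuous_coe_zpow 1) 1).integrable le_rfl).const_mul _
    · exact integrable_const _

theorem shift_eq (t : Circle) : (shift hβ t : ℂ) = ((t : ℂ) - β) * (conj β * (t : ℂ) - 1)⁻¹ :=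
  div_eq_mul_inv _ _

theorem memHardyConj_shift : MemHardyConj ∞ fun t => (shift hβ t : ℂ) := by
  have : Fact ((1 : ℝ≥0∞) ≤ ∞) := ⟨le_top⟩
  refine ⟨memLp_of_continuous (continuous_subtype_val.comp (continuous_shift hβ)) ∞, fun n hn => ?_⟩
  have h1 := (memNeg_denom_inv hβ).mul_self
  have h2 := (memNeg_denom_inv hβ).const_mul β
  have e : (fun t : Circle => (shift hβ t : ℂ)) = fun t : Circle =>
      (conj β * (t : ℂ) - 1)⁻¹ * (t : ℂ) ^ (1 : ℤ) - β * (conj β * (t : ℂ) - 1)⁻¹ := by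
    funext t
    rw [shift_eq, zpow_one]
    ring
  rw [e, coeff_sub (h1.1.integrable le_top) (h2.1.integrable le_top), h1.2 n hn, h2.2 n hn.le,
    sub_zero]

theorem coeff_shift : coeff (fun t => (shift hβ t : ℂ)) 0 = (conj β)⁻¹ := by
  have h1 := (memNeg_denom_inv hβ).mul_self
  have h2 := (memNeg_denom_inv hβ).const_mul β
  have e : (fun t : Circle => (shift hβ t : ℂ)) = fun t : Circle =>
      (conj β * (t : ℂ) - 1)⁻¹ * (t : ℂ) ^ (1 : ℤ) - β * (conj β * (t : ℂ) - 1)⁻¹ := by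
    funext t
    rw [shift_eq, zpow_one]
    ring
  have h := coeff_denom_inv hβ 0
  rw [Nat.cast_zero, neg_zero, zero_add, pow_one] at h
  rw [e, coeff_sub (h1.1.integrable le_top) (h2.1.integrable le_top), h2.2 0 le_rfl,
    sub_zero, coeff_mul_zpow, h]

/-- This identity makes J an involution and gives J(χ^m g) = χ^(-m) Jg. -/
theorem chi_shift (t : Circle) : chi β (shift hβ t) = (chi β t)⁻¹ := by
  have h1 := denom_ne_zero hβ t
  have hl := lam_ne_zero hβ
  have hn : conj β * β = (‖β‖ : ℂ) ^ 2 := Complex.conj_mul' β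
  rw [chi_inv_eq, chi_eq, coe_shift, div_eq_iff hl]
  field_simp
  have h2 := lam_sq hβ
  rw [h2]
  linear_combination -hn

theorem lam_mul_conj : lam β * conj (lam β) = (‖β‖ : ℂ) ^ 2 - 1 := by
  have h : conj (lam β) = - lam β := by
    rw [lam, map_mul, conj_I, conj_ofReal, neg_mul]
  rw [h, mul_neg, ← sq, lam_sq hβ]
  ring

/-- The density of the image of arc length under the shift, in partial fractions. -/
theorem chi_inv_mul_conj (t : Circle) : (chi β t)⁻¹ * conj ((chi β t)⁻¹) =
    (conj β * (t : ℂ) - 1)⁻¹ - β * ((t : ℂ) - β)⁻¹ := by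
  have h1 := denom_ne_zero hβ t
  have h2 := num_ne_zero hβ t
  have hn : conj β * β = (‖β‖ : ℂ) ^ 2 := Complex.conj_mul' β
  have e : conj ((conj β * (t : ℂ) - 1)⁻¹) = -(((t : ℂ) - β)⁻¹ * (t : ℂ)) := by
    rw [denom_inv_eq_conj hβ, conj_conj, zpow_one]
  rw [chi_inv_eq, map_mul, e]
  have e2 : lam β * (conj β * (t : ℂ) - 1)⁻¹ * (conj (lam β) * -(((t : ℂ) - β)⁻¹ * (t : ℂ))) =
      -((lam β * conj (lam β)) * (t : ℂ) * (conj β * (t : ℂ) - 1)⁻¹ * ((t : ℂ) - β)⁻¹) := by ring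
  rw [e2, lam_mul_conj hβ, ← hn]
  field_simp
  ring

end Shift

/-! ### Change of variables under the shift, and the symmetry of J_α -/

section ChangeOfVariables

variable {p q : ℝ≥0∞} [Fact (1 ≤ p)] [Fact (1 ≤ q)] {β : ℂ}

/-- The image of arc length has a density ρ, and it suffices to match its Fourier coefficients with
those of |χ|^(-2). At index -k with k ≥ 0, ρ has the coefficient ∫ α^k, the k-th power of the value
1/β̄ of α at infinity, because the mean is multiplicative on antianalytic functions. Partial
fractions give the same for |χ|^(-2). Positive indices follow as both densities are real. -/
theorem integral_comp_shift (H : RieszPair p q) (hβ : 1 < ‖β‖) (f : Circle → ℂ) :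
    ∫ t, f (shift hβ t) ∂arc = ∫ t, (chi β t)⁻¹ * conj ((chi β t)⁻¹) * f t ∂arc := by
  obtain ⟨K, hK, hKle⟩ := map_shift_le hβ
  set ν := Measure.map (shift hβ) arc with hν
  have hprob : IsProbabilityMeasure ν :=
    Measure.isProbabilityMeasure_map (continuous_shift hβ).measurable.aemeasurable
  have hac : ν ≪ arc := Measure.absolutelyContinuous_of_le_smul hKle
  let e : Circle ≃ₜ Circle :=
    { toFun := shift hβ
      invFun := shift hβ
      left_inv := shift_shift hβ
      right_inv := shift_shift hβ
      continuous_toFun := continuous_shift hβ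
      continuous_invFun := continuous_shift hβ }
  have hmap : ∀ f : Circle → ℂ, ∫ t, f (shift hβ t) ∂arc = ∫ t, f t ∂ν := fun f =>
    (e.measurableEmbedding.integral_map f).symm
  set ρ : Circle → ℂ := fun t => ((ν.rnDeriv arc t).toReal : ℂ) with hρ
  have hρi : Integrable ρ arc := Measure.integrable_toReal_rnDeriv.ofReal
  have hint : ∀ f : Circle → ℂ, ∫ t, f (shift hβ t) ∂arc = ∫ t, ρ t * f t ∂arc := by
    intro f
    rw [hmap, ← integral_rnDeriv_smul hac]
    congr 1
  set W : Circle → ℂ := fun t => (chi β t)⁻¹ * conj ((chi β t)⁻¹) with hW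
  have hWc : Continuous W := by
    have := (continuous_chi β).inv₀ (chi_ne_zero hβ)
    exact this.mul (Complex.continuous_conj.comp this)
  have hWi : Integrable W arc := (memLp_of_continuous hWc 1).integrable le_rfl
  have hWeq : W = fun t : Circle => (conj β * (t : ℂ) - 1)⁻¹ - β * ((t : ℂ) - β)⁻¹ :=
    funext (chi_inv_mul_conj hβ)
  have hneg : ∀ k : ℕ, coeff ρ (-(k : ℤ)) = coeff W (-(k : ℤ)) := by
    intro k
    have h1 : coeff ρ (-(k : ℤ)) = (conj β)⁻¹ ^ k := by
      unfold coeff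
      rw [← hint fun t => (t : ℂ) ^ (- -(k : ℤ))]
      simp_rw [neg_neg, zpow_natCast]
      rw [← coeff_shift hβ, ← H.coeff_pow_conj_zero (memHardyConj_shift hβ)]
      unfold coeff
      simp
    rw [h1, hWeq, coeff_sub ((memLp_of_continuous (continuous_denom_inv hβ) 1).integrable le_rfl)
      (((memLp_of_continuous (continuous_num_inv hβ) 1).integrable le_rfl).const_mul _),
      coeff_const_mul]
    cases k with
    | zero =>
      have h := coeff_num_inv_succ hβ 0
      rw [(memHardy_num_inv hβ).2 _ (by norm_num), if_pos rfl] at h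
      rw [Nat.cast_zero, neg_zero, (memNeg_denom_inv hβ).2 0 le_rfl, h, pow_zero]
    | succ k =>
      rw [(memHardy_num_inv hβ).2 _ (by omega), mul_zero, sub_zero, ← coeff_denom_inv hβ]
      congr 1
      push_cast
      ring
  have hreal : ∀ n, coeff ρ n = conj (coeff ρ (-n)) := fun n => by
    rw [← coeff_conj]
    simp only [hρ, conj_ofReal]
  have hreal' : ∀ n, coeff W n = conj (coeff W (-n)) := fun n => by
    rw [← coeff_conj]
    simp only [hW, map_mul, conj_conj, mul_comm]
  have hρW : ρ =ᵐ[arc] W := by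
    refine ae_eq_of_coeff hρi hWi fun n => ?_
    rcases le_total 0 n with hn | hn
    · obtain ⟨k, rfl⟩ := Int.eq_ofNat_of_zero_le hn
      rw [hreal, hreal', hneg]
    · obtain ⟨k, hk⟩ := Int.eq_ofNat_of_zero_le (neg_nonneg.2 hn)
      rw [← neg_neg n, hk, hneg]
  rw [hint]
  refine integral_congr_ae ?_
  filter_upwards [hρW] with t ht
  rw [ht]

/-- The weighted shift `(J_α f)(t) = χ(t)⁻¹ f(α(t))` of functions. -/
def flip {β : ℂ} (hβ : 1 < ‖β‖) (f : Circle → ℂ) : Circle → ℂ :=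
  fun t => (chi β t)⁻¹ * f (shift hβ t)

theorem flip_congr (hβ : 1 < ‖β‖) {f g : Circle → ℂ} (h : f =ᵐ[arc] g) :
    flip hβ f =ᵐ[arc] flip hβ g := by
  filter_upwards [ae_shift hβ h] with t ht
  rw [flip, flip, ht]

theorem flip_flip (hβ : 1 < ‖β‖) (f : Circle → ℂ) : flip hβ (flip hβ f) = f := by
  funext t
  rw [flip, flip, shift_shift, chi_shift, inv_inv, inv_mul_cancel_left₀ (chi_ne_zero hβ t)]

theorem memLp_flip (hβ : 1 < ‖β‖) {r : ℝ≥0∞} {f : Circle → ℂ} (hf : MemLp f r arc) :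
    MemLp (flip hβ f) r arc :=
  (memLp_comp_shift hβ hf).mul' (memLp_chi_inv hβ)

theorem flipJ_ae_flip (hβ : 1 < ‖β‖) (f : LpT p) : flipJ hβ p f =ᵐ[arc] flip hβ f := by
  filter_upwards [flipJ_ae hβ p f] with t ht
  rw [ht, flip, chi, inv_div, div_eq_inv_mul]

/-- `J_α` is symmetric. -/
theorem integral_flip_mul_conj (H : RieszPair p q) (hβ : 1 < ‖β‖) (f g : Circle → ℂ) :
    ∫ t, flip hβ f t * conj (g t) ∂arc = ∫ t, f t * conj (flip hβ g t) ∂arc := by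
  -- This function is the left integrand composed with α; the density |χ|^(-2) cancels its factor χ
  -- and leaves conj(χ⁻¹).
  have h := integral_comp_shift H hβ fun s => chi β s * f s * conj (g (shift hβ s))
  have e1 : ∀ t, flip hβ f t * conj (g t) = chi β (shift hβ t) * f (shift hβ t) *
      conj (g (shift hβ (shift hβ t))) := fun t => by
    rw [flip, chi_shift, shift_shift]
  simp_rw [e1]
  rw [h]
  congr 1
  funext t
  have := chi_ne_zero hβ t
  rw [flip, map_mul]
  field_simp

theorem memHardy_shift_inv (hβ : 1 < ‖β‖) : MemHardy ∞ fun t => (shift hβ t : ℂ)⁻¹ := by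
  have h := (memHardyConj_shift hβ).conj
  simp_rw [← Circle.coe_inv_eq_conj, Circle.coe_inv] at h
  exact h

/-- By symmetry the coefficient of Jf at k ≥ 0 is the pairing of f with J(t^k) = χ⁻¹ α^k. This has
only negative frequencies, since χ⁻¹ has and α is antianalytic. -/
theorem memNeg_flip (H : RieszPair p q) (hβ : 1 < ‖β‖) {f : Circle → ℂ} (hf : MemHardy p f) :
    MemNeg p (flip hβ f) := by
  refine ⟨memLp_flip hβ hf.1, fun n hn => ?_⟩
  obtain ⟨k, rfl⟩ := Int.eq_ofNat_of_zero_le hn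
  rw [← integral_mul_conj_zpow, integral_flip_mul_conj H hβ]
  refine H.integral_eq_zero hf ?_
  have h := H.symm.mul_neg (H.pow_hardyConj_top (memHardyConj_shift hβ) k)
    ((memNeg_chi_inv hβ).mono le_top)
  refine h.congr (Filter.Eventually.of_forall fun t => ?_)
  simp only [flip, zpow_natCast]
  ring

/-- Dual to `memNeg_flip`: J(t^(-k-1)) = χ⁻¹ α^(-k-1) = λ (t - β)⁻¹ α^(-k) is analytic, because α⁻¹
is the conjugate of α on the circle. -/
theorem memHardy_flip (H : RieszPair p q) (hβ : 1 < ‖β‖) {f : Circle → ℂ} (hf : MemNeg p f) :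
    MemHardy p (flip hβ f) := by
  refine ⟨memLp_flip hβ hf.1, fun n hn => ?_⟩
  obtain ⟨k, hk⟩ := Int.eq_ofNat_of_zero_le (show 0 ≤ -n - 1 by omega)
  rw [← integral_mul_conj_zpow, integral_flip_mul_conj H hβ]
  refine H.integral_eq_zero' hf ?_
  have h := H.symm.mul_hardy (H.pow_hardy_top (memHardy_shift_inv hβ) k)
    (((memHardy_num_inv hβ).const_mul (lam β)).mono le_top)
  refine h.congr (Filter.Eventually.of_forall fun t => ?_)
  have hn' : n = -((k : ℤ) + 1) := by omega
  simp only [flip, hn', zpow_neg]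
  rw [← Nat.cast_succ, zpow_natCast, pow_succ, mul_inv, ← inv_pow, chi_inv_eq]
  have h1 := denom_ne_zero hβ t
  have h2 := num_ne_zero hβ t
  have e : (shift hβ t : ℂ)⁻¹ = ((t : ℂ) - β)⁻¹ * (conj β * (t : ℂ) - 1) := by
    rw [coe_shift, inv_div, div_eq_inv_mul]
  nth_rw 3 [e]
  generalize conj β * (t : ℂ) - 1 = d at h1
  field_simp

end ChangeOfVariables

/-! ### Toeplitz and Hankel operators through functions -/

section Dictionary

variable {r s : ℝ≥0∞} [hr : Fact (1 ≤ r)] [hs : Fact (1 ≤ s)]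

omit hs

/-- A function in `H^r` as an element of `hardy r`. -/
def MemHardy.toHardy {f : Circle → ℂ} (hf : MemHardy r f) : hardy r :=
  ⟨hf.1.toLp f, fun n hn => by rw [coeff_congr hf.1.coeFn_toLp, hf.2 n hn]⟩

theorem MemHardy.toHardy_ae {f : Circle → ℂ} (hf : MemHardy r f) :
    (hf.toHardy : LpT r) =ᵐ[arc] f :=
  hf.1.coeFn_toLp

theorem memHardy_coe (f : hardy r) : MemHardy r (f : LpT r) := ⟨Lp.memLp _, f.2⟩

theorem hardy_ext {f g : hardy r} (h : (f : LpT r) =ᵐ[arc] (g : LpT r)) : f = g :=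
  Subtype.ext (Lp.ext h)

theorem hardy_add_ae (f g : hardy r) :
    ((f + g : hardy r) : LpT r) =ᵐ[arc] fun t => (f : LpT r) t + (g : LpT r) t :=
  Lp.coeFn_add _ _

theorem hardy_sub_ae (f g : hardy r) :
    ((f - g : hardy r) : LpT r) =ᵐ[arc] fun t => (f : LpT r) t - (g : LpT r) t :=
  Lp.coeFn_sub _ _

theorem hardy_smul_ae (c : ℂ) (f : hardy r) :
    ((c • f : hardy r) : LpT r) =ᵐ[arc] fun t => c * (f : LpT r) t :=
  Lp.coeFn_smul _ _

theorem hardy_zero_ae : ((0 : hardy r) : LpT r) =ᵐ[arc] fun _ => 0 := Lp.coeFn_zero _ _ _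

theorem hardy_eq_zero_iff (f : hardy r) : f = 0 ↔ (f : LpT r) =ᵐ[arc] 0 :=
  ⟨fun h => by rw [h]; exact hardy_zero_ae, fun h => hardy_ext (h.trans hardy_zero_ae.symm)⟩

theorem mulOp_congr {g g' : Circle → ℂ} (h : g =ᵐ[arc] g') : mulOp r g = mulOp r g' := by
  by_cases hg : MemLp g ∞ arc
  · refine ContinuousLinearMap.ext fun f => Lp.ext ?_
    filter_upwards [mulOp_ae r hg f, mulOp_ae r (hg.ae_eq h) f, h] with t h1 h2 h3
    rw [h1, h2, h3]
  · have hg' : ¬ MemLp g' ∞ arc := fun h' => hg (h'.ae_eq h.symm)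
    rw [mulOp, mulOp, dif_neg hg, dif_neg hg']

theorem toeplitz_congr {g g' : Circle → ℂ} (h : g =ᵐ[arc] g') : toeplitz r g = toeplitz r g' := by
  rw [toeplitz, toeplitz, mulOp_congr h]

theorem pAlpha_congr {β : ℂ} (hβ : 1 < ‖β‖) {g g' : Circle → ℂ} (h : g =ᵐ[arc] g') :
    pAlpha hβ r g = pAlpha hβ r g' := by
  rw [pAlpha, pAlpha, mulOp_congr h]

theorem memNeg_sub_projP (h : HasRiesz r) (f : LpT r) :
    MemNeg r fun t => f t - (projP r f : LpT r) t := by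
  refine ⟨(Lp.memLp f).sub (Lp.memLp _), fun n hn => ?_⟩
  rw [coeff_sub (integrable_LpT f) (integrable_LpT _)]
  have := rieszP_spec h f n
  rw [if_pos hn] at this
  exact sub_eq_zero.2 this.symm

/-- H^r and its complement meet only in 0. Through this lemma identities between operators become
memberships in `MemNeg`. -/
theorem projP_eq_iff (h : HasRiesz r) {f : LpT r} {u : hardy r} :
    projP r f = u ↔ MemNeg r fun t => f t - (u : LpT r) t := by
  constructor
  · rintro rfl
    exact memNeg_sub_projP h f
  · intro hu
    refine hardy_ext ?_
    have h1 := (hu.sub (memNeg_sub_projP h f)).congr (g := fun t =>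
      (projP r f : LpT r) t - (u : LpT r) t) (Filter.Eventually.of_forall fun t => by
        simp only [sub_sub_sub_cancel_left])
    have h2 := ((memHardy_coe (projP r f)).sub (memHardy_coe u)).eq_zero h1
    filter_upwards [h2] with t ht
    exact sub_eq_zero.1 ht

theorem projQ_ae (f : LpT r) : projQ r f =ᵐ[arc] fun t => f t - (projP r f : LpT r) t :=
  Lp.coeFn_sub _ _

theorem toeplitz_eq_iff (h : HasRiesz r) {g : Circle → ℂ} (hg : MemLp g ∞ arc) {f u : hardy r} :
    toeplitz r g f = u ↔ MemNeg r fun t => g t * (f : LpT r) t - (u : LpT r) t := by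
  change projP r (mulOp r g (f : LpT r)) = u ↔ _
  rw [projP_eq_iff h]
  have e : (fun t => mulOp r g (f : LpT r) t - (u : LpT r) t) =ᵐ[arc]
      fun t => g t * (f : LpT r) t - (u : LpT r) t := by
    filter_upwards [mulOp_ae r hg (f : LpT r)] with t ht
    rw [ht]
  exact ⟨fun h => h.congr e, fun h => h.congr e.symm⟩

theorem toeplitz_spec (h : HasRiesz r) {g : Circle → ℂ} (hg : MemLp g ∞ arc) (f : hardy r) :
    MemNeg r fun t => g t * (f : LpT r) t - (toeplitz r g f : LpT r) t :=
  (toeplitz_eq_iff h hg).1 rfl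

theorem toeplitz_eq_zero_iff (h : HasRiesz r) {g : Circle → ℂ} (hg : MemLp g ∞ arc) {f : hardy r} :
    toeplitz r g f = 0 ↔ MemNeg r fun t => g t * (f : LpT r) t := by
  rw [toeplitz_eq_iff h hg]
  have e : (fun t => g t * (f : LpT r) t - ((0 : hardy r) : LpT r) t) =ᵐ[arc]
      fun t => g t * (f : LpT r) t := by
    filter_upwards [hardy_zero_ae (r := r)] with t ht
    rw [ht, sub_zero]
  exact ⟨fun h => h.congr e, fun h => h.congr e.symm⟩

omit hr in
theorem memNeg_zero : MemNeg r fun _ => 0 :=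
  ⟨memLp_of_continuous continuous_const r, fun n _ => (coeff_const 0 n).trans (ite_self 0)⟩

include hs

theorem toeplitz_hardy_ae (H : RieszPair r s) {k : Circle → ℂ} (hk : MemHardy ∞ k) (f : hardy r) :
    (toeplitz r k f : LpT r) =ᵐ[arc] fun t => k t * (f : LpT r) t := by
  have h := H.mul_hardy hk (memHardy_coe f)
  have e : toeplitz r k f = h.toHardy := by
    rw [toeplitz_eq_iff H.left hk.1]
    refine memNeg_zero.congr ?_
    filter_upwards [h.toHardy_ae] with t ht
    rw [ht, sub_self]
  rw [e]
  exact h.toHardy_ae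

/-- An analytic k keeps kf in the Hardy space, so the inner projection does nothing. -/
theorem toeplitz_mul_hardy (H : RieszPair r s) {g k : Circle → ℂ} (hg : MemLp g ∞ arc)
    (hk : MemHardy ∞ k) (f : hardy r) :
    toeplitz r (fun t => g t * k t) f = toeplitz r g (toeplitz r k f) := by
  have hgk : MemLp (fun t => g t * k t) ∞ arc := hk.1.mul' hg
  rw [toeplitz_eq_iff H.left hgk]
  refine (toeplitz_spec H.left hg (toeplitz r k f)).congr ?_
  filter_upwards [toeplitz_hardy_ae H hk f] with t ht
  rw [ht, mul_assoc]

/-- An antianalytic g maps the part removed by the inner projection into the complement, where the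
outer projection removes it anyway. -/
theorem toeplitz_conj_mul (H : RieszPair r s) {g k : Circle → ℂ} (hg : MemHardyConj ∞ g)
    (hk : MemLp k ∞ arc) (f : hardy r) :
    toeplitz r (fun t => g t * k t) f = toeplitz r g (toeplitz r k f) := by
  have hgk : MemLp (fun t => g t * k t) ∞ arc := hk.mul' hg.1
  rw [toeplitz_eq_iff H.left hgk]
  have h1 := H.mul_neg hg (toeplitz_spec H.left hk f)
  refine (h1.add (toeplitz_spec H.left hg.1 (toeplitz r k f))).congr
    (Filter.Eventually.of_forall fun t => ?_)
  ring

omit hs in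
theorem toeplitz_one (h : HasRiesz r) {g : Circle → ℂ} (hg : g =ᵐ[arc] fun _ => 1) (f : hardy r) :
    toeplitz r g f = f := by
  have h1 : MemLp g ∞ arc := (memLp_of_continuous continuous_const ∞).ae_eq hg.symm
  rw [toeplitz_eq_iff h h1]
  refine memNeg_zero.congr ?_
  filter_upwards [hg] with t ht
  rw [ht, one_mul, sub_self]

/-- Since J sends H^r into the complement, the factor Q is inert and H_α(b)f = P(b Jf). -/
theorem hankel_spec (H : RieszPair r s) {β : ℂ} (hβ : 1 < ‖β‖) {b : Circle → ℂ}
    (hb : MemLp b ∞ arc) (f : hardy r) :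
    MemNeg r fun t => b t * flip hβ (f : LpT r) t - (hankel hβ r b f : LpT r) t := by
  have hJ := memNeg_flip H hβ (memHardy_coe f)
  have hJ' := flipJ_ae_flip hβ (f : LpT r)
  have hP : projP r (flipJ hβ r (f : LpT r)) = 0 := by
    rw [projP_eq_iff H.left]
    refine hJ.congr ?_
    filter_upwards [hJ', hardy_zero_ae (r := r)] with t h1 h2
    rw [h1, h2, sub_zero]
  have h := memNeg_sub_projP H.left (mulOp r b (projQ r (flipJ hβ r (f : LpT r))))
  refine h.congr ?_
  filter_upwards [mulOp_ae r hb (projQ r (flipJ hβ r (f : LpT r))),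
    projQ_ae (flipJ hβ r (f : LpT r)), hJ', hardy_zero_ae (r := r)] with t h1 h2 h3 h4
  rw [h1, h2, h3, hP, h4, sub_zero]
  rfl

/-- The outer projection in `flipQ` is inert, because J sends the complement into H^r. -/
theorem pAlpha_ae (H : RieszPair r s) {β : ℂ} (hβ : 1 < ‖β‖) {g : Circle → ℂ}
    (hg : MemLp g ∞ arc) (f : hardy r) :
    (pAlpha hβ r g f : LpT r) =ᵐ[arc]
      flip hβ fun t => g t * (f : LpT r) t - (toeplitz r g f : LpT r) t := by
  have h1 := memHardy_flip H hβ (toeplitz_spec H.left hg f)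
  have hQ : projQ r (mulOp r g (f : LpT r)) =ᵐ[arc]
      fun t => g t * (f : LpT r) t - (toeplitz r g f : LpT r) t := by
    filter_upwards [projQ_ae (mulOp r g (f : LpT r)), mulOp_ae r hg (f : LpT r)] with t h1 h2
    rw [h1, h2]
    rfl
  have e : pAlpha hβ r g f = h1.toHardy := by
    change projP r (flipJ hβ r (projQ r (mulOp r g (f : LpT r)))) = _
    rw [projP_eq_iff H.left]
    refine memNeg_zero.congr ?_
    filter_upwards [h1.toHardy_ae, flipJ_ae_flip hβ (projQ r (mulOp r g (f : LpT r))),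
      flip_congr hβ hQ] with t h2 h3 h4
    rw [h2, h3, h4, sub_self]
  rw [e]
  exact h1.toHardy_ae

/-- The combination `T(a) + ε H_α(b)` annihilates `f` iff `a f + ε b J_α f` is in the complement
of the Hardy space. -/
theorem toeplitz_add_hankel_eq_zero_iff (H : RieszPair r s) {β : ℂ} (hβ : 1 < ‖β‖)
    {a b : Circle → ℂ} (ha : MemLp a ∞ arc) (hb : MemLp b ∞ arc) (ε : ℂ) (f : hardy r) :
    (toeplitz r a + ε • hankel hβ r b) f = 0 ↔
      MemNeg r fun t => a t * (f : LpT r) t + ε * (b t * flip hβ (f : LpT r) t) := by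
  have h1 := toeplitz_spec H.left ha f
  have h2 := (hankel_spec H hβ hb f).const_mul ε
  have h3 := h1.add h2
  have e : ((toeplitz r a + ε • hankel hβ r b) f : LpT r) =ᵐ[arc]
      fun t => (toeplitz r a f : LpT r) t + ε * (hankel hβ r b f : LpT r) t := by
    filter_upwards [hardy_add_ae (toeplitz r a f) (ε • hankel hβ r b f),
      hardy_smul_ae ε (hankel hβ r b f)] with t h1 h2
    rw [← h2, ← h1]
    rfl
  constructor
  · intro h
    rw [hardy_eq_zero_iff] at h
    refine h3.congr ?_
    filter_upwards [h, e] with t h4 h5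
    rw [h4, Pi.zero_apply] at h5
    linear_combination h5
  · intro h
    rw [hardy_eq_zero_iff]
    refine (memHardy_coe _).eq_zero ((h.sub h3).congr ?_)
    filter_upwards [e] with t h5
    rw [h5]
    ring

/-- The image of `𝐏_α^ε(g)` consists of the `u ∈ H^r` with `g u = ε J_α u`. -/
theorem mem_imPAlpha_iff (H : RieszPair r s) {β : ℂ} (hβ : 1 < ‖β‖) {g : Circle → ℂ}
    (hg : MemLp g ∞ arc) (hgg : ∀ᵐ t ∂arc, g t * g (shift hβ t) = 1) {ε : ℂ} (hε : ε * ε = 1)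
    (u : hardy r) : u ∈ imPAlpha hβ r ε g ↔
      (fun t => g t * (u : LpT r) t) =ᵐ[arc] fun t => ε * flip hβ (u : LpT r) t := by
  have key : ∀ f : hardy r, ((((1 / 2 : ℂ) • (ContinuousLinearMap.id ℂ (hardy r) +
      ε • pAlpha hβ r g)) f : hardy r) : LpT r) =ᵐ[arc]
      fun t => (1 / 2) * ((f : LpT r) t + ε * (pAlpha hβ r g f : LpT r) t) := by
    intro f
    filter_upwards [hardy_smul_ae (1 / 2) (f + ε • pAlpha hβ r g f),
      hardy_add_ae f (ε • pAlpha hβ r g f), hardy_smul_ae ε (pAlpha hβ r g f)] with t h1 h2 h3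
    rw [← h3, ← h2, ← h1]
    rfl
  have hT : ∀ f : hardy r, toeplitz r g f = 0 → (pAlpha hβ r g f : LpT r) =ᵐ[arc]
      fun t => (chi β t)⁻¹ * (g (shift hβ t) * (f : LpT r) (shift hβ t)) := by
    intro f hf
    have h0 : (fun t => g t * (f : LpT r) t - (toeplitz r g f : LpT r) t) =ᵐ[arc]
        fun t => g t * (f : LpT r) t := by
      rw [hf]
      filter_upwards [hardy_zero_ae (r := r)] with t ht
      rw [ht, sub_zero]
    exact (pAlpha_ae H hβ hg f).trans (flip_congr hβ h0)
  constructor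
  · rintro ⟨f, hf, rfl⟩
    have hP := (key f)
    have hf' := hT f hf
    filter_upwards [hP, hf', ae_shift hβ hP, ae_shift hβ hf', hgg] with t h1 h2 h3 h4 h5
    rw [flip]
    simp only [ContinuousLinearMap.coe_coe]
    rw [h1, h3, h2, h4, shift_shift, chi_shift]
    have := chi_ne_zero hβ t
    field_simp
    linear_combination ((f : LpT r) (shift hβ t)) * ε * h5 -
      g t * (f : LpT r) t * chi β t * hε
  · intro hu
    -- Ju has only negative frequencies, so gu = εJu puts u in the kernel; then J(gu) = εu, and u is
    -- fixed by 𝐏^ε(g).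
    have hker : toeplitz r g u = 0 := by
      rw [toeplitz_eq_zero_iff H.left hg]
      exact ((memNeg_flip H hβ (memHardy_coe u)).const_mul ε).congr hu.symm
    refine ⟨u, hker, hardy_ext ?_⟩
    refine (key u).trans ?_
    filter_upwards [hT u hker, ae_shift hβ hu] with t h1 h2
    rw [h1, h2, flip, shift_shift, chi_shift]
    have := chi_ne_zero hβ t
    field_simp
    linear_combination (u : LpT r) t * hε

end Dictionary

/-! ### Matching pairs -/

namespace IsMatchingPair

variable {β : ℂ} {hβ : 1 < ‖β‖} {a b : Circle → ℂ} (h : IsMatchingPair hβ a b)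
include h

theorem right_ne_zero : ∀ᵐ t ∂arc, b t ≠ 0 := by
  filter_upwards [h.left_ne_zero, ae_shift hβ h.left_ne_zero, h.matching] with t h1 h2 h3 h4
  rw [h4, zero_mul] at h3
  exact mul_ne_zero h1 h2 h3

/-- Matching gives b⁻¹ = a⁻¹ a_α⁻¹ b_α. -/
theorem right_inv_mem : MemLp b⁻¹ ∞ arc := by
  have h1 := memLp_comp_shift hβ h.left_inv_mem
  have h2 := memLp_comp_shift hβ h.right_mem
  have h3 : MemLp (fun t => a⁻¹ t * a⁻¹ (shift hβ t)) ∞ arc := h1.mul' h.left_inv_mem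
  have h4 : MemLp (fun t => a⁻¹ t * a⁻¹ (shift hβ t) * b (shift hβ t)) ∞ arc := h2.mul' h3
  refine h4.ae_eq ?_
  filter_upwards [h.left_ne_zero, ae_shift hβ h.left_ne_zero, h.matching, h.right_ne_zero]
    with t h1 h2 h3 h4
  simp only [Pi.inv_apply]
  field_simp
  linear_combination -h3

theorem subC_mem : MemLp (subC a b) ∞ arc := h.right_inv_mem.mul' h.left_mem

theorem subD_mem : MemLp (subD hβ a b) ∞ arc :=
  (memLp_comp_shift hβ h.left_inv_mem).mul' h.right_mem

theorem subC_mul_shift : ∀ᵐ t ∂arc, subC a b t * subC a b (shift hβ t) = 1 := by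
  filter_upwards [h.matching, h.right_ne_zero, ae_shift hβ h.right_ne_zero] with t h1 h2 h3
  rw [subC, subC]
  field_simp
  exact h1

theorem subD_mul_shift : ∀ᵐ t ∂arc, subD hβ a b t * subD hβ a b (shift hβ t) = 1 := by
  filter_upwards [h.matching, h.left_ne_zero, ae_shift hβ h.left_ne_zero] with t h1 h2 h3
  rw [subD, subD, shift_shift]
  field_simp
  linear_combination -h1

end IsMatchingPair

/-! ### The kernel of a Toeplitz plus Hankel operator -/

section Kernel

variable {r s : ℝ≥0∞} [hr : Fact (1 ≤ r)] [hs : Fact (1 ≤ s)]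
  {β : ℂ} {hβ : 1 < ‖β‖} {a b : Circle → ℂ}

/-- On the image of `𝐏_α^ε(d)`, the map `φ_α^ε` is a section of
`f ↦ ε J_α (a f + ε b J_α f)`. -/
theorem phiAlpha_spec (H : RieszPair r s) (h : IsMatchingPair hβ a b)
    (hR : ∀ f, toeplitz r (subC a b) (toeplitzRightInv r (subC a b) f) = f) {ε : ℂ}
    (hε : ε * ε = 1) {u : hardy r} (hu : u ∈ imPAlpha hβ r ε (subD hβ a b)) :
    (fun t => a t * (phiAlpha hβ r ε a b u : LpT r) t +
      ε * (b t * flip hβ (phiAlpha hβ r ε a b u : LpT r) t)) =ᵐ[arc]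
      fun t => ε * flip hβ (u : LpT r) t := by
  rw [mem_imPAlpha_iff H hβ h.subD_mem h.subD_mul_shift hε] at hu
  have hai : MemLp (fun t => (a (shift hβ t))⁻¹) ∞ arc := memLp_comp_shift hβ h.left_inv_mem
  set v : hardy r := toeplitzRightInv r (subC a b) (toeplitz r (fun t => (a (shift hβ t))⁻¹) u)
    with hv
  have hTv : toeplitz r (subC a b) v = toeplitz r (fun t => (a (shift hβ t))⁻¹) u := hR _
  set w : hardy r := toeplitz r (subC a b) v with hw
  have h1 := pAlpha_ae H hβ h.subC_mem v
  have h2 := pAlpha_ae H hβ hai u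
  rw [← hw] at h1
  rw [← hTv] at h2
  have hphi : (phiAlpha hβ r ε a b u : LpT r) =ᵐ[arc] fun t => (1 / 2) * ((v : LpT r) t -
      ε * (pAlpha hβ r (subC a b) v : LpT r) t +
      ε * (pAlpha hβ r (fun t => (a (shift hβ t))⁻¹) u : LpT r) t) := by
    filter_upwards [
      hardy_smul_ae (1 / 2) (v - ε • pAlpha hβ r (subC a b) v +
        ε • pAlpha hβ r (fun t => (a (shift hβ t))⁻¹) u),
      hardy_add_ae (v - ε • pAlpha hβ r (subC a b) v)
        (ε • pAlpha hβ r (fun t => (a (shift hβ t))⁻¹) u),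
      hardy_sub_ae v (ε • pAlpha hβ r (subC a b) v),
      hardy_smul_ae ε (pAlpha hβ r (subC a b) v),
      hardy_smul_ae ε (pAlpha hβ r (fun t => (a (shift hβ t))⁻¹) u)] with t e1 e2 e3 e4 e5
    rw [← e5, ← e4, ← e3, ← e2, ← e1]
    rfl
  -- T(c)v = T(a_α⁻¹)u, so the analytic parts subtracted in the two J Q terms cancel and only the
  -- full products remain.
  have hphi2 : (phiAlpha hβ r ε a b u : LpT r) =ᵐ[arc] fun t => (1 / 2) * ((v : LpT r) t -
      ε * ((chi β t)⁻¹ * (subC a b (shift hβ t) * (v : LpT r) (shift hβ t) -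
        (a t)⁻¹ * (u : LpT r) (shift hβ t)))) := by
    filter_upwards [hphi, h1, h2] with t e1 e2 e3
    rw [e1, e2, e3, flip, flip, shift_shift]
    ring
  filter_upwards [hphi2, ae_shift hβ hphi2, hu, h.matching, h.left_ne_zero,
    ae_shift hβ h.left_ne_zero, h.right_ne_zero, ae_shift hβ h.right_ne_zero]
    with t e1 e2 e3 e4 e5 e6 e7 e8
  rw [flip, e1, e2, shift_shift, chi_shift]
  simp only [flip, subD, subC] at e3 ⊢
  have hχ := chi_ne_zero hβ t
  generalize (u : LpT r) (shift hβ t) = U at *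
  generalize (u : LpT r) t = V at *
  generalize (v : LpT r) (shift hβ t) = X at *
  generalize (v : LpT r) t = Y at *
  generalize a (shift hβ t) = a' at *
  generalize b (shift hβ t) = b' at *
  have hca : a t * (a' * b'⁻¹) = b t := by
    field_simp
    linear_combination e4
  have hcb : b t * (a t * (b t)⁻¹) = a t := by
    field_simp
  have haa := mul_inv_cancel₀ e5
  have hx := inv_mul_cancel₀ hχ
  rw [inv_inv]
  -- The terms in v cancel by a c_α = b and bc = a. One half of εJu comes from a a⁻¹ = 1, the other
  -- from du = εJu.
  linear_combination (-(1 / 2) * ε * (chi β t)⁻¹ * X) * hca + (1 / 2) * ε * (chi β t)⁻¹ * U * haa -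
    (1 / 2) * Y * (b t * (a t * (b t)⁻¹) * ((chi β t)⁻¹ * chi β t) * hε +
      b t * (a t * (b t)⁻¹) * hx + hcb) +
    (1 / 2) * (((chi β t)⁻¹ * chi β t) * b t * a'⁻¹ * V * hε + b t * a'⁻¹ * V * hx + e3)

/-- The map `φ_α^ε` is injective on the image of `𝐏_α^ε(d)`, and its values there meet the image
of `𝐏_α^{-ε}(c)` trivially. -/
theorem eq_zero_of_phiAlpha_mem (H : RieszPair r s) (h : IsMatchingPair hβ a b)
    (hR : ∀ f, toeplitz r (subC a b) (toeplitzRightInv r (subC a b) f) = f) {ε : ℂ}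
    (hε : ε * ε = 1) {u : hardy r} (hu : u ∈ imPAlpha hβ r ε (subD hβ a b))
    (hφ : phiAlpha hβ r ε a b u ∈ imPAlpha hβ r (-ε) (subC a b)) : u = 0 := by
  have h1 := phiAlpha_spec H h hR hε hu
  rw [mem_imPAlpha_iff H hβ h.subC_mem h.subC_mul_shift (by rw [neg_mul_neg, hε])] at hφ
  -- cφ = -εJφ means aφ + εbJφ = 0, and by `phiAlpha_spec` that sum is εJu.
  have h2 : flip hβ (u : LpT r) =ᵐ[arc] 0 := by
    filter_upwards [h1, hφ, h.right_ne_zero] with t e1 e2 e3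
    rw [subC] at e2
    have e4 : a t * (phiAlpha hβ r ε a b u : LpT r) t =
        -ε * (b t * flip hβ (phiAlpha hβ r ε a b u : LpT r) t) := by
      field_simp at e2
      linear_combination e2
    rw [e4] at e1
    have : ε * (ε * flip hβ (u : LpT r) t) = 0 := by
      rw [← e1]
      ring
    rwa [← mul_assoc, hε, one_mul] at this
  rw [hardy_eq_zero_iff]
  have h3 := flip_congr hβ h2
  rw [flip_flip] at h3
  filter_upwards [h3] with t ht
  rw [ht, flip, Pi.zero_apply, mul_zero, Pi.zero_apply]

theorem disjoint_map_phiAlpha (H : RieszPair r s) (h : IsMatchingPair hβ a b)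
    (hR : ∀ f, toeplitz r (subC a b) (toeplitzRightInv r (subC a b) f) = f) {ε : ℂ}
    (hε : ε * ε = 1) : Disjoint (imPAlpha hβ r (-ε) (subC a b))
      (Submodule.map (phiAlpha hβ r ε a b).toLinearMap (imPAlpha hβ r ε (subD hβ a b))) := by
  rw [Submodule.disjoint_def]
  rintro _ hx ⟨u, hu, rfl⟩
  rw [eq_zero_of_phiAlpha_mem H h hR hε hu hx, map_zero]

/-- The kernel of `T(a) + ε H_α(b)`, when `T(c)` is right invertible. -/
theorem ker_toeplitz_add_hankel (H : RieszPair r s) (h : IsMatchingPair hβ a b)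
    (hR : ∀ f, toeplitz r (subC a b) (toeplitzRightInv r (subC a b) f) = f) {ε : ℂ}
    (hε : ε * ε = 1) : (toeplitz r a + ε • hankel hβ r b).ker =
      imPAlpha hβ r (-ε) (subC a b) ⊔
      Submodule.map (phiAlpha hβ r ε a b).toLinearMap (imPAlpha hβ r ε (subD hβ a b)) := by
  have hε' : -ε * -ε = 1 := by rw [neg_mul_neg, hε]
  apply le_antisymm
  · intro f hf
    have hf1 := (toeplitz_add_hankel_eq_zero_iff H hβ h.left_mem h.right_mem ε f).1 hf
    set G : Circle → ℂ := fun t => a t * (f : LpT r) t + ε * (b t * flip hβ (f : LpT r) t) with hG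
    -- The candidate is u = εJG; matching yields du = εJu.
    have hu := (memHardy_flip H hβ hf1).const_mul ε
    have huae := hu.toHardy_ae
    have hmem : hu.toHardy ∈ imPAlpha hβ r ε (subD hβ a b) := by
      rw [mem_imPAlpha_iff H hβ h.subD_mem h.subD_mul_shift hε]
      filter_upwards [huae, flip_congr hβ huae, h.matching, h.left_ne_zero,
        ae_shift hβ h.left_ne_zero] with t e1 e2 e3 e4 e5
      rw [e1, e2]
      simp only [flip, hG, shift_shift, chi_shift, subD]
      have hχ := chi_ne_zero hβ t
      field_simp
      linear_combination (-ε * b t * (f : LpT r) (shift hβ t) * a (shift hβ t)) * hε -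
        ε * ε * chi β t * (f : LpT r) t * e3
    have h1 := phiAlpha_spec H h hR hε hmem
    -- f and φ(u) have the same image under x ↦ ax + εbJx, so their difference x satisfies cx =
    -- -εJx.
    have hrest : f - phiAlpha hβ r ε a b hu.toHardy ∈ imPAlpha hβ r (-ε) (subC a b) := by
      rw [mem_imPAlpha_iff H hβ h.subC_mem h.subC_mul_shift hε']
      generalize phiAlpha hβ r ε a b hu.toHardy = ψ at h1 ⊢
      have hsub := hardy_sub_ae f ψ
      filter_upwards [hsub, ae_shift hβ hsub, h1, flip_congr hβ huae, h.right_ne_zero]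
        with t e1 e2 e3 e4 e5
      have e6 : flip hβ (fun t => ε * flip hβ G t) t = ε * G t := by
        have := congrFun (flip_flip hβ G) t
        rw [← this]
        simp only [flip]
        ring
      rw [e4, e6] at e3
      have hb := inv_mul_cancel₀ e5
      simp only [flip, subC]
      rw [e1, e2]
      simp only [flip, G] at e3
      linear_combination (-(b t)⁻¹) * e3 - (b t)⁻¹ * (a t * (f : LpT r) t +
        ε * b t * (chi β t)⁻¹ * (f : LpT r) (shift hβ t)) * hε -
        ε * (chi β t)⁻¹ * ((f : LpT r) (shift hβ t) - (ψ : LpT r) (shift hβ t)) * hb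
    rw [← sub_add_cancel f (phiAlpha hβ r ε a b hu.toHardy)]
    exact Submodule.add_mem_sup hrest (Submodule.mem_map_of_mem hmem)
  · refine sup_le ?_ ?_
    · intro f hf
      rw [mem_imPAlpha_iff H hβ h.subC_mem h.subC_mul_shift hε'] at hf
      refine (toeplitz_add_hankel_eq_zero_iff H hβ h.left_mem h.right_mem ε f).2
        (memNeg_zero.congr ?_)
      filter_upwards [hf, h.right_ne_zero] with t e1 e2
      rw [subC] at e1
      field_simp at e1
      linear_combination -e1
    · rintro _ ⟨u, hu, rfl⟩
      refine (toeplitz_add_hankel_eq_zero_iff H hβ h.left_mem h.right_mem ε _).2 ?_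
      exact ((memNeg_flip H hβ (memHardy_coe u)).const_mul ε).congr
        (phiAlpha_spec H h hR hε hu).symm

end Kernel

/-! ### Duality for Toeplitz operators, and the cokernel -/

section Adjoint

variable {p q : ℝ≥0∞} [hp : Fact (1 ≤ p)] [hq : Fact (1 ≤ q)]

theorem memLp_cj {g : Circle → ℂ} {r : ℝ≥0∞} (hg : MemLp g r arc) : MemLp (cj g) r arc := hg.star

omit hq in
/-- If `F ∈ L^q` annihilates `H^p`, then `F` is in the complement of `H^q`. -/
theorem memNeg_of_integral_eq_zero {F : Circle → ℂ} (hF : MemLp F q arc)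
    (h : ∀ f : hardy p, ∫ t, (f : LpT p) t * conj (F t) ∂arc = 0) : MemNeg q F := by
  refine ⟨hF, fun n hn => ?_⟩
  have h1 : MemHardy p fun t : Circle => (1 : ℂ) * (t : ℂ) ^ n := (memHardy_const p 1).mul_zpow hn
  have h2 := congrArg conj (h h1.toHardy)
  rw [map_zero, ← integral_conj] at h2
  rw [← integral_mul_conj_zpow, ← h2]
  refine integral_congr_ae ?_
  filter_upwards [h1.toHardy_ae] with t ht
  rw [ht, one_mul, map_mul, conj_conj, mul_comm]

theorem eq_zero_of_integral_eq_zero {h : hardy q}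
    (h0 : ∀ f : hardy p, ∫ t, (f : LpT p) t * conj ((h : LpT q) t) ∂arc = 0) : h = 0 := by
  rw [hardy_eq_zero_iff]
  exact (memHardy_coe h).eq_zero (memNeg_of_integral_eq_zero (Lp.memLp _) h0)

theorem integral_eq_of_memNeg_sub (H : RieszPair p q) {F G : Circle → ℂ} (hF : MemLp F p arc)
    (hG : MemLp G p arc) (h : MemNeg p fun t => F t - G t) (g : hardy q) :
    ∫ t, F t * conj ((g : LpT q) t) ∂arc = ∫ t, G t * conj ((g : LpT q) t) ∂arc := by
  have hi := H.integrable_mul hF (memHardy_coe g).1.star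
  have hi' := H.integrable_mul hG (memHardy_coe g).1.star
  have h0 := H.integral_eq_zero' h (memHardy_coe g)
  simp_rw [sub_mul] at h0
  rw [← sub_eq_zero, ← h0]
  exact (integral_sub hi hi').symm

theorem integral_conj_eq_of_memNeg_sub (H : RieszPair p q) {F G : Circle → ℂ} (hF : MemLp F q arc)
    (hG : MemLp G q arc) (h : MemNeg q fun t => F t - G t) (f : hardy p) :
    ∫ t, (f : LpT p) t * conj (F t) ∂arc = ∫ t, (f : LpT p) t * conj (G t) ∂arc := by
  have hi := H.integrable_mul (memHardy_coe f).1 hF.star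
  have hi' := H.integrable_mul (memHardy_coe f).1 hG.star
  have h0 := H.integral_eq_zero (memHardy_coe f) h
  simp_rw [map_sub, mul_sub] at h0
  rw [← sub_eq_zero, ← h0]
  exact (integral_sub hi hi').symm

/-- The adjoint of `T(g)` is the Toeplitz operator with the conjugate symbol. -/
theorem integral_toeplitz_mul_conj (H : RieszPair p q) {g : Circle → ℂ} (hg : MemLp g ∞ arc)
    (f : hardy p) (h : hardy q) :
    ∫ t, (toeplitz p g f : LpT p) t * conj ((h : LpT q) t) ∂arc =
      ∫ t, (f : LpT p) t * conj ((toeplitz q (cj g) h : LpT q) t) ∂arc := by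
  have h1 := integral_eq_of_memNeg_sub H ((memHardy_coe f).1.mul' hg) (Lp.memLp _)
    (toeplitz_spec H.left hg f) h
  have h2 := integral_conj_eq_of_memNeg_sub H ((memHardy_coe h).1.mul' (memLp_cj hg)) (Lp.memLp _)
    (toeplitz_spec H.right (memLp_cj hg) h) f
  rw [← h1, ← h2]
  congr 1
  funext t
  rw [map_mul, cj, conj_conj]
  ring

/-- Every bounded functional on `H^p` is represented by a function in `H^q`. -/
theorem exists_hardy_forall_eq_integral (H : RieszPair p q) (l : hardy p →L[ℂ] ℂ) :
    ∃ h : hardy q, ∀ f : hardy p, l f = ∫ t, (f : LpT p) t * conj ((h : LpT q) t) ∂arc := by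
  have := H.holder
  obtain ⟨k, hk, hk'⟩ := exists_memLp_forall_eq_integral (q := q) H.one_lt H.ne_top (l ∘L projP p)
  have hh : MemHardy q fun t => conj (k t) := by
    refine ⟨hk.star, fun n hn => ?_⟩
    have h1 : projP p (monoLp p n) = 0 := by
      refine Subtype.ext ?_
      change rieszP p (monoLp p n) = 0
      rw [riesz_monoLp (rieszP_spec H.left), if_neg (by omega)]
    have h2 := hk' (monoLp p n)
    rw [ContinuousLinearMap.comp_apply, h1, map_zero] at h2
    rw [coeff_conj, ← map_zero conj, h2]
    congr 1
    refine integral_congr_ae ?_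
    filter_upwards [monoLp_ae p n] with t ht
    rw [ht, neg_neg, mul_comm]
  refine ⟨hh.toHardy, fun f => ?_⟩
  have h1 : projP p (f : LpT p) = f := by
    rw [projP_eq_iff H.left]
    refine memNeg_zero.congr (Filter.Eventually.of_forall fun t => ?_)
    simp only [sub_self]
  have h2 := hk' (f : LpT p)
  rw [ContinuousLinearMap.comp_apply, h1] at h2
  rw [h2]
  refine integral_congr_ae ?_
  filter_upwards [hh.toHardy_ae] with t ht
  rw [ht, conj_conj]

theorem isClosed_hardy (H : RieszPair p q) : IsClosed (hardy p : Set (LpT p)) := by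
  have e : (hardy p : Set (LpT p)) = {f | rieszP p f = f} := by
    ext f
    constructor
    · intro hf
      refine LpT_ext_coeff fun n => ?_
      rw [rieszP_spec H.left]
      split_ifs with hn
      · rfl
      · exact (hf n (by omega)).symm
    · intro hf
      change rieszP p f = f at hf
      rw [← hf]
      exact rieszP_mem p f
  rw [e]
  exact isClosed_eq (rieszP p).continuous continuous_id

theorem completeSpace_hardy (H : RieszPair p q) : CompleteSpace (hardy p) :=
  (isClosed_hardy H).completeSpace_coe

/-- The adjoint of an invertible operator is invertible: injectivity comes from the surjectivity of
T(g), and a preimage of y is the representative of the functional f ↦ ∫ (T(g)⁻¹f) ȳ. -/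
theorem bijective_toeplitz_cj (H : RieszPair p q) {g : Circle → ℂ} (hg : MemLp g ∞ arc)
    (hb : Function.Bijective (toeplitz p g)) : Function.Bijective (toeplitz q (cj g)) := by
  have := completeSpace_hardy H
  constructor
  · refine (injective_iff_map_eq_zero _).2 fun h hh => ?_
    refine eq_zero_of_integral_eq_zero (p := p) fun f => ?_
    obtain ⟨f', rfl⟩ := hb.2 f
    rw [integral_toeplitz_mul_conj H hg, hh]
    refine (integral_congr_ae ?_).trans (integral_zero Circle ℂ (μ := arc))
    filter_upwards [hardy_zero_ae (r := q)] with t ht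
    rw [ht, map_zero, mul_zero]
  · intro y
    let E := ContinuousLinearEquiv.ofBijective (toeplitz p g) (LinearMap.ker_eq_bot.2 hb.1)
      (LinearMap.range_eq_top.2 hb.2)
    have := H.holder
    have hy : MemLp (fun t => conj ((y : LpT q) t)) q arc := (memHardy_coe y).1.star
    obtain ⟨h, hh⟩ := exists_hardy_forall_eq_integral H
      (pairL hy ∘L (hardy p).subtypeL ∘L (E.symm : hardy p →L[ℂ] hardy p))
    refine ⟨h, ?_⟩
    rw [← sub_eq_zero]
    refine eq_zero_of_integral_eq_zero (p := p) fun f => ?_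
    have h1 := hh (toeplitz p g f)
    have h2 : E.symm (toeplitz p g f) = f := E.symm_apply_apply f
    rw [ContinuousLinearMap.comp_apply, ContinuousLinearMap.comp_apply,
      ContinuousLinearEquiv.coe_coe, h2, pairL_apply, integral_toeplitz_mul_conj H hg] at h1
    have hi := H.integrable_mul (memHardy_coe f).1 (memHardy_coe (toeplitz q (cj g) h)).1.star
    have hi' := H.integrable_mul (memHardy_coe f).1 hy
    have h3 := integral_sub hi hi'
    have h4 : ∫ t, (f : LpT p) t * star ((toeplitz q (cj g) h : LpT q) t) ∂arc =
        ∫ t, (f : LpT p) t * conj ((y : LpT q) t) ∂arc := h1.symm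
    refine Eq.trans ?_ (h3.trans (sub_eq_zero.2 h4))
    refine integral_congr_ae ?_
    filter_upwards [hardy_sub_ae (toeplitz q (cj g) h) y] with t ht
    rw [ht, map_sub, mul_sub]
    rfl

/-- The cokernel of `T(a) + ε H_α(b)` is the kernel of `T(ā) + ε H_α(conj (b ∘ α))`. -/
theorem mem_coker_iff (H : RieszPair p q) [ENNReal.HolderConjugate p q] {β : ℂ} (hβ : 1 < ‖β‖)
    {a b : Circle → ℂ} (ha : MemLp a ∞ arc) (hb : MemLp b ∞ arc) {ε : ℂ} (hε : conj ε = ε)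
    (g : hardy q) : g ∈ coker p q (toeplitz p a + ε • hankel hβ p b) ↔
      MemNeg q fun t => conj (a t) * (g : LpT q) t +
        ε * (conj (b (shift hβ t)) * flip hβ (g : LpT q) t) := by
  set G : Circle → ℂ := fun t => conj (a t) * (g : LpT q) t +
        ε * (conj (b (shift hβ t)) * flip hβ (g : LpT q) t) with hG
  have hb' := memLp_comp_shift hβ hb
  have hGm : MemLp G q arc := by
    have h1 : MemLp (fun t => conj (a t) * (g : LpT q) t) q arc :=
      (memHardy_coe g).1.mul' (memLp_cj ha)
    have h2 : MemLp (fun t => conj (b (shift hβ t)) * flip hβ (g : LpT q) t) q arc :=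
      (memLp_flip hβ (memHardy_coe g).1).mul' (memLp_cj hb')
    exact h1.add (h2.const_mul ε)
  -- Symmetry moves J onto b̄g, and J(b̄g) = conj(b_α) Jg: this is where b gets composed with α.
  have key : ∀ f : hardy p, ∫ t, (((toeplitz p a + ε • hankel hβ p b) f : hardy p) : LpT p) t *
      conj ((g : LpT q) t) ∂arc = ∫ t, (f : LpT p) t * conj (G t) ∂arc := by
    intro f
    have h1 := toeplitz_spec H.left ha f
    have h2 := (hankel_spec H hβ hb f).const_mul ε
    have hF1 : MemLp (fun t => a t * (f : LpT p) t) p arc := (memHardy_coe f).1.mul' ha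
    have hF2 : MemLp (fun t => b t * flip hβ (f : LpT p) t) p arc :=
      (memLp_flip hβ (memHardy_coe f).1).mul' hb
    have h3 : MemNeg p fun t => (a t * (f : LpT p) t + ε * (b t * flip hβ (f : LpT p) t)) -
        (((toeplitz p a + ε • hankel hβ p b) f : hardy p) : LpT p) t := by
      refine (h1.add h2).congr ?_
      filter_upwards [hardy_add_ae (toeplitz p a f) (ε • hankel hβ p b f),
        hardy_smul_ae ε (hankel hβ p b f)] with t h1 h2
      have e : (((toeplitz p a + ε • hankel hβ p b) f : hardy p) : LpT p) t =
          (toeplitz p a f : LpT p) t + ε * (hankel hβ p b f : LpT p) t := by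
        rw [← h2, ← h1]
        rfl
      rw [e]
      ring
    have hF3 : MemLp (fun t => a t * (f : LpT p) t + ε * (b t * flip hβ (f : LpT p) t)) p arc :=
      hF1.add (hF2.const_mul ε)
    rw [← integral_eq_of_memNeg_sub H hF3 (Lp.memLp _) h3 g]
    have hgm := (memHardy_coe g).1
    have i1 : Integrable (fun t => a t * (f : LpT p) t * conj ((g : LpT q) t)) arc :=
      H.integrable_mul hF1 hgm.star
    have i2 : Integrable (fun t => ε * (flip hβ (f : LpT p) t *
        conj (conj (b t) * (g : LpT q) t))) arc := by
      have : Integrable (fun t => b t * flip hβ (f : LpT p) t * conj ((g : LpT q) t)) arc :=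
        H.integrable_mul hF2 hgm.star
      refine (this.const_mul ε).congr (Filter.Eventually.of_forall fun t => ?_)
      simp only [map_mul, conj_conj]
      ring
    have i3 : Integrable (fun t => ε * ((f : LpT p) t *
        conj (flip hβ (fun t => conj (b t) * (g : LpT q) t) t))) arc := by
      have h5 : MemLp (fun t => conj (b t) * (g : LpT q) t) q arc := hgm.mul' (memLp_cj hb)
      have : Integrable (fun t => (f : LpT p) t *
          conj (flip hβ (fun t => conj (b t) * (g : LpT q) t) t)) arc :=
        H.integrable_mul (memHardy_coe f).1 (memLp_flip hβ h5).star
      exact this.const_mul ε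
    have e1 : ∀ t, (a t * (f : LpT p) t + ε * (b t * flip hβ (f : LpT p) t)) *
        conj ((g : LpT q) t) = a t * (f : LpT p) t * conj ((g : LpT q) t) +
        ε * (flip hβ (f : LpT p) t * conj (conj (b t) * (g : LpT q) t)) := fun t => by
      rw [map_mul, conj_conj]
      ring
    have e2 : ∀ t, (f : LpT p) t * conj (G t) = a t * (f : LpT p) t * conj ((g : LpT q) t) +
        ε * ((f : LpT p) t * conj (flip hβ (fun t => conj (b t) * (g : LpT q) t) t)) := fun t => by
      simp only [hG, flip, map_add, map_mul, conj_conj, hε]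
      ring
    simp_rw [e1, e2]
    rw [integral_add i1 i2, integral_add i1 i3, integral_const_mul, integral_const_mul,
      integral_flip_mul_conj H hβ]
  constructor
  · intro hg
    exact memNeg_of_integral_eq_zero hGm fun f => by rw [← key f]; exact hg f
  · intro hg f
    rw [key f]
    exact H.integral_eq_zero (memHardy_coe f) hg

end Adjoint

/-! ### Symbols that are powers of χ -/

section ChiPow

variable {p q : ℝ≥0∞} [hp : Fact (1 ≤ p)] [hq : Fact (1 ≤ q)] {β : ℂ}

theorem chi_zpow_shift (hβ : 1 < ‖β‖) (t : Circle) (k : ℤ) :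
    chi β (shift hβ t) ^ k = chi β t ^ (-k) := by
  rw [chi_shift, inv_zpow']

theorem continuous_chi_zpow (hβ : 1 < ‖β‖) (k : ℤ) : Continuous fun t => chi β t ^ k :=
  (continuous_chi β).zpow₀ k fun t => Or.inl (chi_ne_zero hβ t)

theorem memHardy_chi_pow (H : RieszPair p q) (m : ℕ) :
    MemHardy ∞ fun t => chi β t ^ (m : ℤ) := by
  simp_rw [zpow_natCast]
  exact H.pow_hardy_top memHardy_chi m

theorem toeplitz_chi_leftInverse (H : RieszPair p q) (hβ : 1 < ‖β‖) (m : ℕ) (f : hardy p) :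
    toeplitz p (fun t => chi β t ^ (-(m : ℤ))) (toeplitz p (fun t => chi β t ^ (m : ℤ)) f) = f := by
  rw [← toeplitz_mul_hardy H (memLp_of_continuous (continuous_chi_zpow hβ _) ∞)
    (memHardy_chi_pow H m)]
  refine toeplitz_one H.left (Filter.Eventually.of_forall fun t => ?_) f
  simp only
  rw [← zpow_add₀ (chi_ne_zero hβ t), neg_add_cancel, zpow_zero]

/-- Shifting the symbols by powers of `χ`. -/
theorem memNeg_chi_pow_iff (H : RieszPair p q) (hβ : 1 < ‖β‖) {a b : Circle → ℂ} {m : ℕ}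
    (ha : MemLp (fun t => a t * chi β t ^ (-(m : ℤ))) ∞ arc)
    (hb : MemLp (fun t => b t * chi β t ^ (m : ℤ)) ∞ arc) (ε : ℂ) (g : hardy p) :
    (toeplitz p (fun t => a t * chi β t ^ (-(m : ℤ))) +
      ε • hankel hβ p (fun t => b t * chi β t ^ (m : ℤ)))
      (toeplitz p (fun t => chi β t ^ (m : ℤ)) g) = 0 ↔
    MemNeg p fun t => a t * (g : LpT p) t + ε * (b t * flip hβ (g : LpT p) t) := by
  rw [toeplitz_add_hankel_eq_zero_iff H hβ ha hb]
  have h1 := toeplitz_hardy_ae H (memHardy_chi_pow (β := β) H m) g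
  -- χ^m g absorbs the factor χ^(-m) of the first symbol, and J(χ^m g) = χ^(-m) Jg absorbs the
  -- factor χ^m of the second.
  have e : (fun t => a t * chi β t ^ (-(m : ℤ)) *
      (toeplitz p (fun t => chi β t ^ (m : ℤ)) g : LpT p) t +
      ε * (b t * chi β t ^ (m : ℤ) *
        flip hβ (toeplitz p (fun t => chi β t ^ (m : ℤ)) g : LpT p) t)) =ᵐ[arc]
      fun t => a t * (g : LpT p) t + ε * (b t * flip hβ (g : LpT p) t) := by
    filter_upwards [h1, flip_congr hβ h1] with t e1 e2
    rw [e1, e2]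
    simp only [flip]
    rw [chi_zpow_shift, zpow_neg]
    have := zpow_ne_zero (m : ℤ) (chi_ne_zero hβ t)
    field_simp
  exact ⟨fun h => h.congr e, fun h => h.congr e.symm⟩

end ChiPow

/-! ### Zero sets, and Coburn's lemma -/

section Zero

theorem normSq_coeff {h : Circle → ℂ} (n : ℤ) :
    coeff (fun t => h t * conj (h t)) (-n) = conj (coeff (fun t => h t * conj (h t)) n) := by
  rw [← neg_neg n, ← coeff_conj, neg_neg]
  simp only [map_mul, conj_conj, mul_comm]

/-- A function in `H^2` with nonzero mean value is nonzero almost everywhere. -/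
theorem ae_ne_zero_of_coeff_zero {h : LpT 2} (hh : h ∈ hardy 2) (h0 : coeff h 0 ≠ 0) :
    ∀ᵐ t ∂arc, h t ≠ 0 := by
  have h22 : ENNReal.HolderConjugate 2 2 := ENNReal.HolderConjugate.instTwoTwo
  have hmono : MemLp (fun t : Circle => (t : ℂ) ^ (1 : ℤ)) ∞ arc :=
    memLp_of_continuous (continuous_coe_zpow 1) ∞
  let S : LpT 2 →L[ℂ] LpT 2 := mulOp 2 fun t => (t : ℂ) ^ (1 : ℤ)
  have hS : ∀ f : LpT 2, S f =ᵐ[arc] fun t => (t : ℂ) ^ (1 : ℤ) * f t := mulOp_ae 2 hmono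
  have hScoeff : ∀ (f : LpT 2) n, coeff (S f) n = coeff f (n - 1) := fun f n => by
    rw [← coeff_mul_zpow]
    refine coeff_congr ?_ n
    filter_upwards [hS f] with t ht
    rw [ht, mul_comm]
  -- K is the closed span of th, t²h, and so on. Its elements have mean zero and vanish wherever h
  -- does. The component of h orthogonal to K will turn out to have constant modulus.
  let K : Submodule ℂ (LpT 2) :=
    (Submodule.span ℂ (Set.range fun n : ℕ => (S ^ (n + 1)) h)).topologicalClosure
  have hKmin : ∀ L : Submodule ℂ (LpT 2), IsClosed (L : Set (LpT 2)) →
      (∀ n : ℕ, (S ^ (n + 1)) h ∈ L) → K ≤ L := by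
    intro L hL hmem
    refine Submodule.topologicalClosure_minimal _ (Submodule.span_le.2 ?_) hL
    rintro _ ⟨n, rfl⟩
    exact hmem n
  have hKmem : ∀ n : ℕ, (S ^ (n + 1)) h ∈ K := fun n =>
    Submodule.le_topologicalClosure _ (Submodule.subset_span ⟨n, rfl⟩)
  have hKclosed : IsClosed (K : Set (LpT 2)) := Submodule.isClosed_topologicalClosure _
  have hKS : K ≤ K.comap S.toLinearMap := by
    refine hKmin _ (hKclosed.preimage S.continuous) fun n => ?_
    have := hKmem (n + 1)
    rw [pow_succ'] at this
    exact this
  have hK0 : ∀ k ∈ K, coeff k 0 = 0 := by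
    have hpow : ∀ (n : ℕ) (j : ℤ), coeff ((S ^ n) h) j = coeff h (j - n) := by
      intro n
      induction n with
      | zero => simp
      | succ n ih =>
        intro j
        rw [pow_succ', mul_apply_eq_comp, hScoeff, ih]
        congr 1
        push_cast
        ring
    intro k hk
    let l : LpT 2 →L[ℂ] ℂ := pairL (p := 2) (q := 2) (memLp_of_continuous (continuous_coe_zpow (-0)) 2)
    have hl : ∀ f, l f = coeff f 0 := fun f => pairL_apply _ f
    have := hKmin l.ker l.isClosed_ker fun n => by
      rw [LinearMap.mem_ker]
      refine (hl _).trans ?_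
      rw [hpow]
      exact hh _ (by push_cast; omega)
    rw [← hl]
    exact this hk
  let E : Set Circle := {t | h t = 0}
  have hE : MeasurableSet E :=
    (Lp.stronglyMeasurable h).measurable (measurableSet_singleton 0)
  have hEm : MemLp (E.indicator fun _ => (1 : ℂ)) ∞ arc :=
    memLp_indicator_const ∞ hE 1 (Or.inr (measure_ne_top _ _))
  let M : LpT 2 →L[ℂ] LpT 2 := mulOp 2 (E.indicator fun _ => (1 : ℂ))
  have hM : ∀ f : LpT 2, M f =ᵐ[arc] fun t => E.indicator (fun _ => (1 : ℂ)) t * f t :=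
    mulOp_ae 2 hEm
  have hMh : M h = 0 := by
    refine Lp.ext ?_
    filter_upwards [hM h, Lp.coeFn_zero ℂ 2 arc] with t h1 h2
    rw [h1, h2, Pi.zero_apply]
    by_cases ht : t ∈ E
    · rw [show h t = 0 from ht, mul_zero]
    · rw [Set.indicator_of_notMem ht, zero_mul]
  have hMS : ∀ f, M f = 0 → M (S f) = 0 := by
    intro f hf
    have e : M (S f) = S (M f) := by
      refine Lp.ext ?_
      filter_upwards [hM (S f), hS f, hS (M f), hM f] with t h1 h2 h3 h4
      rw [h1, h2, h3, h4]
      ring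
    rw [e, hf, map_zero]
  have hKM : K ≤ M.ker := by
    refine hKmin _ M.isClosed_ker fun n => ?_
    rw [LinearMap.mem_ker]
    change M ((S ^ (n + 1)) h) = 0
    generalize n + 1 = j
    induction j with
    | zero => exact hMh
    | succ j ih =>
      rw [pow_succ']
      exact hMS _ ih
  have hKc : CompleteSpace K := hKclosed.completeSpace_coe
  obtain ⟨y, hy, g, hg, hyg⟩ := K.exists_add_mem_mem_orthogonal h
  have hSg : S g ∈ K := by
    have h1 : S h ∈ K := by simpa using hKmem 0
    have h2 : S g = S h - S y := by rw [hyg, map_add, add_sub_cancel_left]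
    rw [h2]
    exact K.sub_mem h1 (hKS hy)
  have hSng : ∀ n : ℕ, (S ^ (n + 1)) g ∈ K := by
    intro n
    induction n with
    | zero => simpa using hSg
    | succ n ih =>
      rw [pow_succ']
      exact hKS ih
  have hpowg : ∀ n : ℕ, (S ^ n) g =ᵐ[arc] fun t => (t : ℂ) ^ (n : ℤ) * g t := by
    intro n
    induction n with
    | zero => exact Filter.Eventually.of_forall fun t => by simp
    | succ n ih =>
      rw [pow_succ']
      filter_upwards [hS ((S ^ n) g), ih] with t h1 h2
      rw [mul_apply_eq_comp, h1, h2, Nat.cast_succ, add_comm,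
        zpow_add₀ (Circle.coe_ne_zero t), mul_assoc]
  have hgi : Integrable (fun t => g t * conj (g t)) arc := integrable_pairing (p := 2) (q := 2) g g
  -- g is orthogonal to K, which contains t^(n+1) g; so |g|² has no frequency other than 0 and is
  -- constant.
  have hcpos : ∀ n : ℕ, coeff (fun t => g t * conj (g t)) (-((n + 1 : ℕ) : ℤ)) = 0 := by
    intro n
    have h1 := (K.mem_orthogonal' g).1 hg _ (hSng n)
    rw [L2.inner_def] at h1
    unfold coeff
    rw [← h1]
    refine integral_congr_ae ?_
    filter_upwards [hpowg (n + 1)] with t ht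
    rw [ht, neg_neg, RCLike.inner_apply]
    ring
  set c := coeff (fun t => g t * conj (g t)) 0 with hc
  have hgc : (fun t => g t * conj (g t)) =ᵐ[arc] fun _ => c := by
    refine ae_eq_of_coeff hgi (integrable_const _) fun n => ?_
    rw [coeff_const]
    split_ifs with hn
    · rw [hn]
    · rcases lt_or_gt_of_ne hn with hn | hn
      · obtain ⟨k, hk⟩ := Int.eq_ofNat_of_zero_le (show 0 ≤ -n - 1 by omega)
        have := hcpos k
        rwa [show -((k + 1 : ℕ) : ℤ) = n by push_cast; omega] at this
      · obtain ⟨k, hk⟩ := Int.eq_ofNat_of_zero_le (show 0 ≤ n - 1 by omega)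
        have := hcpos k
        rw [show -((k + 1 : ℕ) : ℤ) = -n by push_cast; omega, normSq_coeff] at this
        exact (map_eq_zero _).1 this
  -- If g vanished, h would lie in K and have mean zero.
  have hc0 : c ≠ 0 := by
    intro hc0
    have hg0 : coeff g 0 = 0 := by
      have : g =ᵐ[arc] fun _ => 0 := by
        filter_upwards [hgc] with t ht
        rw [hc0, Complex.mul_conj, Complex.ofReal_eq_zero, Complex.normSq_eq_zero] at ht
        exact ht
      rw [coeff_congr this, coeff_const, if_pos rfl]
    apply h0
    rw [hyg, coeff_LpT_add, hK0 y hy, hg0, add_zero]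
  -- g = h - y vanishes on the zero set of h, while |g|² is a nonzero constant: that set is null.
  have hMg : M g = 0 := by
    have h1 : g = h - y := by rw [hyg, add_sub_cancel_left]
    rw [h1, map_sub, hMh, show M y = 0 from hKM hy, sub_zero]
  filter_upwards [hgc, hM g, Lp.coeFn_zero ℂ 2 arc] with t h1 h2 h3 h4
  rw [hMg, h3, Set.indicator_of_mem (show t ∈ E from h4), one_mul, Pi.zero_apply] at h2
  rw [← h2, zero_mul] at h1
  exact hc0 h1.symm

/-- Dividing by t^N, with N the first index of a nonzero coefficient, reduces to nonzero mean; the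
condition 2 ≤ p gives access to the Hilbert space argument. -/
theorem ae_ne_zero_of_memHardy {p : ℝ≥0∞} (hp : 2 ≤ p) {h : Circle → ℂ} (hh : MemHardy p h)
    (h0 : ¬ h =ᵐ[arc] 0) : ∀ᵐ t ∂arc, h t ≠ 0 := by
  classical
  have hi : Integrable h arc := hh.1.integrable (one_le_two.trans hp)
  have hex : ∃ n : ℕ, coeff h n ≠ 0 := by
    by_contra! hall
    refine h0 (ae_eq_zero_of_coeff hi fun n => ?_)
    rcases lt_or_ge n 0 with hn | hn
    · exact hh.2 n hn
    · obtain ⟨k, rfl⟩ := Int.eq_ofNat_of_zero_le hn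
      exact hall k
  let N := Nat.find hex
  have hlt : ∀ n : ℤ, n < N → coeff h n = 0 := by
    intro n hn
    rcases lt_or_ge n 0 with hn0 | hn0
    · exact hh.2 n hn0
    · obtain ⟨k, rfl⟩ := Int.eq_ofNat_of_zero_le hn0
      by_contra hk
      exact Nat.find_min hex (m := k) (by exact_mod_cast hn) hk
  have h2 : MemLp (fun t => h t * (t : ℂ) ^ (-(N : ℤ))) 2 arc :=
    memLp_mul_zpow (hh.1.mono_exponent hp) _
  have hmem : h2.toLp _ ∈ hardy 2 := fun n hn => by
    rw [coeff_congr h2.coeFn_toLp, coeff_mul_zpow]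
    exact hlt _ (by omega)
  have hne : coeff (h2.toLp _) 0 ≠ 0 := by
    rw [coeff_congr h2.coeFn_toLp, coeff_mul_zpow, zero_sub, neg_neg]
    exact Nat.find_spec hex
  filter_upwards [ae_ne_zero_of_coeff_zero hmem hne, h2.coeFn_toLp] with t h3 h4 h5
  rw [h4, h5, zero_mul] at h3
  exact h3 rfl

variable {p q : ℝ≥0∞} [hp : Fact (1 ≤ p)] [hq : Fact (1 ≤ q)]

theorem RieszPair.two_le (H : RieszPair p q) : 2 ≤ p ∨ 2 ≤ q := by
  have := H.holder
  by_contra! h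
  have h1 := ENNReal.HolderConjugate.inv_add_inv_eq_one p q
  have h2 : (2 : ℝ≥0∞)⁻¹ + 2⁻¹ < p⁻¹ + q⁻¹ :=
    ENNReal.add_lt_add (ENNReal.inv_lt_inv.2 h.1) (ENNReal.inv_lt_inv.2 h.2)
  rw [h1, ENNReal.inv_two_add_inv_two] at h2
  exact lt_irrefl _ h2

/-- One of p, q is at least 2, and it is enough that the factor in that space be nonzero almost
everywhere. -/
theorem eq_zero_or_eq_zero_of_mul_conj (H : RieszPair p q) {f h : Circle → ℂ} (hf : MemHardy p f)
    (hh : MemHardy q h) (h0 : ∀ᵐ t ∂arc, f t * conj (h t) = 0) : f =ᵐ[arc] 0 ∨ h =ᵐ[arc] 0 := by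
  rcases H.two_le with h2 | h2
  · by_cases hf0 : f =ᵐ[arc] 0
    · exact Or.inl hf0
    · right
      filter_upwards [ae_ne_zero_of_memHardy h2 hf hf0, h0] with t h3 h4
      exact (map_eq_zero _).1 ((mul_eq_zero.1 h4).resolve_left h3)
  · by_cases hf0 : h =ᵐ[arc] 0
    · exact Or.inr hf0
    · left
      filter_upwards [ae_ne_zero_of_memHardy h2 hh hf0, h0] with t h3 h4
      exact (mul_eq_zero.1 h4).resolve_right fun h5 => h3 ((map_eq_zero _).1 h5)

/-- Coburn's lemma: the kernels of a Toeplitz operator and of its adjoint are not both nonzero. -/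
theorem coburn (H : RieszPair p q) {g : Circle → ℂ} (hg : MemLp g ∞ arc)
    (hg0 : ∀ᵐ t ∂arc, g t ≠ 0) {f : hardy p} {h : hardy q} (hf : toeplitz p g f = 0)
    (hh : toeplitz q (cj g) h = 0) : f = 0 ∨ h = 0 := by
  rw [toeplitz_eq_zero_iff H.left hg] at hf
  rw [toeplitz_eq_zero_iff H.right (memLp_cj hg)] at hh
  -- F is gf, with only negative frequencies, times an antianalytic function; it is also f times
  -- conj(ḡh), with only positive ones. So all its coefficients vanish.
  set F : Circle → ℂ := fun t => g t * (f : LpT p) t * conj ((h : LpT q) t) with hF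
  have hFi : Integrable F arc := H.integrable_mul hf.1 (memHardy_coe h).1.star
  have hF0 : F =ᵐ[arc] 0 := by
    refine ae_eq_zero_of_coeff hFi fun n => ?_
    rcases le_or_gt n 0 with hn | hn
    · have h1 := H.coeff_mul_eq_zero (memHardy_coe f) hh.conj_mul (n := n - 1) (by omega)
      rw [← h1]
      have e : (fun t : Circle => (f : LpT p) t * (conj (cj g t * (h : LpT q) t) *
          (t : ℂ) ^ (-1 : ℤ))) = fun t => F t * (t : ℂ) ^ (-1 : ℤ) := by
        funext t
        rw [map_mul, cj, conj_conj, hF]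
        ring
      rw [e, coeff_mul_zpow]
      congr 1
      ring
    · have h1 := H.coeff_mul_eq_zero hf.conj_mul (memHardy_coe h) (n := -n - 1) (by omega)
      have e : (fun t : Circle => conj (g t * (f : LpT p) t) * (t : ℂ) ^ (-1 : ℤ) *
          (h : LpT q) t) = fun t => conj (F t) * (t : ℂ) ^ (-1 : ℤ) := by
        funext t
        rw [hF, map_mul _ _ (conj _), conj_conj]
        ring
      rw [e, coeff_mul_zpow, coeff_conj] at h1
      have h2 := (map_eq_zero _).1 h1
      rw [← h2]
      congr 1
      ring
  rw [hardy_eq_zero_iff, hardy_eq_zero_iff]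
  refine eq_zero_or_eq_zero_of_mul_conj H (memHardy_coe f) (memHardy_coe h) ?_
  filter_upwards [hF0, hg0] with t h1 h2
  have h3 : g t * ((f : LpT p) t * conj ((h : LpT q) t)) = 0 := by
    rw [← mul_assoc]
    exact h1
  exact (mul_eq_zero.1 h3).resolve_left h2

end Zero

/-! ### Toeplitz operators of positive index -/

section Index

variable {p q : ℝ≥0∞} [hp : Fact (1 ≤ p)] [hq : Fact (1 ≤ q)]

/-- A Fredholm Toeplitz operator with nonzero kernel is onto. -/
theorem surjective_toeplitz_of_ker (H : RieszPair p q) {g : Circle → ℂ} (hg : MemLp g ∞ arc)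
    (hg0 : ∀ᵐ t ∂arc, g t ≠ 0) (hF : (toeplitz p g).IsFredholm) {f : hardy p} (hf : f ≠ 0)
    (hTf : toeplitz p g f = 0) : Function.Surjective (toeplitz p g) := by
  by_contra hs
  rw [Function.Surjective] at hs
  push Not at hs
  obtain ⟨y, hy⟩ := hs
  have hy' : y ∉ (toeplitz p g).range := by
    rintro ⟨x, hx⟩
    exact hy x hx
  -- The range is closed, so some functional separates y from it. Its real part is bounded above on
  -- a subspace, hence it vanishes there, and its representative in H^q is a nonzero element of the
  -- kernel of the adjoint, against Coburn's lemma.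
  obtain ⟨l, u, hl1, hl2⟩ := RCLike.geometric_hahn_banach_closed_point (𝕜 := ℂ)
    ((toeplitz p g).range.restrictScalars ℝ).convex hF.isClosed_range hy'
  have hl0 : ∀ x, l (toeplitz p g x) = 0 := by
    intro x
    by_contra hne
    obtain ⟨n, hn⟩ := exists_nat_gt (u / 1)
    have hmem : ((n : ℂ) * (l (toeplitz p g x))⁻¹) • toeplitz p g x ∈
        ((toeplitz p g).range.restrictScalars ℝ : Set (hardy p)) :=
      ⟨((n : ℂ) * (l (toeplitz p g x))⁻¹) • x, by simp⟩
    have h1 := hl1 _ hmem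
    rw [map_smul, smul_eq_mul, mul_assoc, inv_mul_cancel₀ hne, mul_one] at h1
    rw [div_one] at hn
    have h2 : RCLike.re ((n : ℂ)) = (n : ℝ) := by simp
    rw [h2] at h1
    linarith
  have hly : l y ≠ 0 := by
    intro h0
    have h1 := hl1 0 ⟨0, map_zero _⟩
    rw [map_zero] at h1
    rw [h0] at hl2
    exact absurd h1 (not_lt.2 hl2.le)
  obtain ⟨h, hh⟩ := exists_hardy_forall_eq_integral H l
  have hTh : toeplitz q (cj g) h = 0 :=
    eq_zero_of_integral_eq_zero (p := p) fun x => by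
      rw [← integral_toeplitz_mul_conj H hg, ← hh, hl0]
  rcases coburn H hg hg0 hTf hTh with h1 | h1
  · exact hf h1
  · apply hly
    rw [hh, h1]
    refine (integral_congr_ae ?_).trans (integral_zero Circle ℂ (μ := arc))
    filter_upwards [hardy_zero_ae (r := q)] with t ht
    rw [ht, map_zero, mul_zero]

theorem finrank_ker_of_surjective {A : hardy p →L[ℂ] hardy p} (hA : Function.Surjective A) :
    fredholmIndex A = Module.finrank ℂ A.ker := by
  have h : A.range = ⊤ := LinearMap.range_eq_top.2 hA
  have : Subsingleton (hardy p ⧸ A.range) := by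
    rw [h]
    exact Submodule.Quotient.subsingleton_iff.2 rfl
  have h0 : Module.finrank ℂ (hardy p ⧸ A.range) = 0 := Module.finrank_zero_of_subsingleton
  rw [fredholmIndex, h0, Nat.cast_zero, sub_zero]

/-- The mean value as a linear functional on `H^p`. -/
def meanValue (p : ℝ≥0∞) [Fact (1 ≤ p)] : hardy p →ₗ[ℂ] ℂ where
  toFun f := coeff (f : LpT p) 0
  map_add' _ _ := coeff_LpT_add _ _ 0
  map_smul' c _ := coeff_LpT_smul c _ 0

/-- A function in `H^p` whose Fourier coefficients of positive index vanish is constant. -/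
theorem eq_const_of_coeff {f : hardy p} (hf : ∀ n, 0 < n → coeff (f : LpT p) n = 0) :
    (f : LpT p) =ᵐ[arc] fun _ => coeff (f : LpT p) 0 := by
  refine ae_eq_of_coeff (integrable_LpT _) (integrable_const _) fun n => ?_
  rw [coeff_const]
  split_ifs with hn
  · rw [hn]
  · rcases lt_or_gt_of_ne hn with hn | hn
    · exact f.2 n hn
    · exact hf n hn

/-- The constant function `1` in `H^p`. -/
def oneHardy (p : ℝ≥0∞) [Fact (1 ≤ p)] : hardy p := (memHardy_const p 1).toHardy

theorem oneHardy_ae : (oneHardy p : LpT p) =ᵐ[arc] fun _ => 1 := MemHardy.toHardy_ae _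

theorem eq_smul_one_of_coeff {f : hardy p} (hf : ∀ n, 0 < n → coeff (f : LpT p) n = 0) :
    f = coeff (f : LpT p) 0 • oneHardy p := by
  refine hardy_ext ?_
  filter_upwards [eq_const_of_coeff hf, hardy_smul_ae (coeff (f : LpT p) 0) (oneHardy p),
    oneHardy_ae (p := p)] with t h1 h2 h3
  rw [h1, h2, h3, mul_one]

theorem oneHardy_ne_zero : oneHardy p ≠ 0 := by
  intro h
  have h1 := coeff_congr (oneHardy_ae (p := p)) 0
  rw [coeff_const, if_pos rfl, h, coeff_congr hardy_zero_ae, coeff_const, if_pos rfl] at h1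
  exact zero_ne_one h1

/-- `T(g t) f` is constant as soon as `g t f` has no positive Fourier coefficients up to a
function in `H^p`. -/
theorem toeplitz_mul_self_sub (h : HasRiesz p) {g : Circle → ℂ} (hg : MemLp g ∞ arc)
    {f y : hardy p}
    (hf : MemNeg p fun t => g t * (f : LpT p) t - (y : LpT p) t * (t : ℂ) ^ (-1 : ℤ)) :
    ∃ c : ℂ, toeplitz p (fun t => g t * (t : ℂ) ^ (1 : ℤ)) f - y = c • oneHardy p := by
  have h1 := toeplitz_spec h (memLp_mul_zpow hg 1) f
  set T := toeplitz p (fun t => g t * (t : ℂ) ^ (1 : ℤ)) f with hT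
  refine ⟨_, eq_smul_one_of_coeff fun n hn => ?_⟩
  have h2 := hf.mul_self
  have e : ((T - y : hardy p) : LpT p) =ᵐ[arc] fun t =>
      (g t * (f : LpT p) t - (y : LpT p) t * (t : ℂ) ^ (-1 : ℤ)) * (t : ℂ) ^ (1 : ℤ) -
      (g t * (t : ℂ) ^ (1 : ℤ) * (f : LpT p) t - (T : LpT p) t) := by
    filter_upwards [hardy_sub_ae T y] with t ht
    have := Circle.coe_ne_zero t
    rw [ht, zpow_neg, zpow_one]
    field_simp
    ring
  rw [coeff_congr e, coeff_sub (h2.1.integrable hp.out) (h1.1.integrable hp.out), h2.2 n hn,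
    h1.2 n hn.le, sub_zero]

/-- Multiplication by `t` has no eigenvector in `H^p`. -/
theorem eq_zero_of_mul_self_eq {f : hardy p} {μ : ℂ}
    (h : (fun t : Circle => (t : ℂ) ^ (1 : ℤ) * (f : LpT p) t) =ᵐ[arc]
      fun t => μ * (f : LpT p) t) : f = 0 := by
  have hrec : ∀ n, coeff (f : LpT p) (n - 1) = μ * coeff (f : LpT p) n := by
    intro n
    rw [← coeff_mul_zpow, ← coeff_const_mul, ← coeff_congr h]
    simp_rw [mul_comm]
  rw [hardy_eq_zero_iff]
  refine ae_eq_zero_of_coeff (integrable_LpT _) fun n => ?_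
  rcases eq_or_ne μ 0 with rfl | hμ
  · have := hrec (n + 1)
    rwa [add_sub_cancel_right, zero_mul] at this
  · have hnat : ∀ k : ℕ, coeff (f : LpT p) ((k : ℤ) - 1) = 0 := by
      intro k
      induction k with
      | zero => exact f.2 _ (by norm_num)
      | succ k ih =>
        rw [hrec] at ih
        rw [Nat.cast_succ, add_sub_cancel_right]
        exact (mul_eq_zero.1 ih).resolve_left hμ
    rcases lt_or_ge n 0 with hn | hn
    · exact f.2 n hn
    · obtain ⟨k, hk⟩ := Int.eq_ofNat_of_zero_le (show 0 ≤ n + 1 by omega)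
      have := hnat k
      rwa [← hk, add_sub_cancel_right] at this

/-- Multiplying the symbol by `t` lowers the dimension of the kernel by one. -/
theorem toeplitz_mul_self_step (H : RieszPair p q) {g : Circle → ℂ} (hg : MemLp g ∞ arc)
    (hs : Function.Surjective (toeplitz p g)) {n : ℕ}
    (hn : Module.finrank ℂ (toeplitz p g).ker = n + 1) :
    Function.Surjective (toeplitz p fun t => g t * (t : ℂ) ^ (1 : ℤ)) ∧
      Module.finrank ℂ (toeplitz p fun t => g t * (t : ℂ) ^ (1 : ℤ)).ker = n := by
  have hg1 := memLp_mul_zpow hg 1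
  set T := toeplitz p fun t => g t * (t : ℂ) ^ (1 : ℤ) with hT
  set V := (toeplitz p g).ker with hV
  have hfin : FiniteDimensional ℂ V := Module.finite_of_finrank_pos (by rw [hn]; omega)
  have hker : ∀ f, f ∈ V ↔ MemNeg p fun t => g t * (f : LpT p) t := fun f =>
    toeplitz_eq_zero_iff H.left hg
  have hker' : ∀ f, f ∈ T.ker ↔ MemNeg p fun t => g t * (t : ℂ) ^ (1 : ℤ) * (f : LpT p) t :=
    fun f => toeplitz_eq_zero_iff H.left hg1
  have hle : T.ker ≤ V := by
    intro f hf
    rw [hker] at ⊢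
    rw [hker'] at hf
    refine (hf.mul_zpow (k := -1) (by norm_num)).congr (Filter.Eventually.of_forall fun t => ?_)
    have := Circle.coe_ne_zero t
    simp only [zpow_neg, zpow_one]
    field_simp
  -- For f in ker T(g) the product gtf has no positive frequencies, so its projection is constant.
  have hconst : ∀ f ∈ V, T f = meanValue p (T f) • oneHardy p := by
    intro f hf
    rw [hker] at hf
    have h0 : MemNeg p fun t => g t * (f : LpT p) t -
        ((0 : hardy p) : LpT p) t * (t : ℂ) ^ (-1 : ℤ) := by
      refine hf.congr ?_
      filter_upwards [hardy_zero_ae (r := p)] with t ht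
      rw [ht, zero_mul, sub_zero]
    obtain ⟨c, hc⟩ := toeplitz_mul_self_sub H.left hg h0
    rw [sub_zero] at hc
    have h1 : meanValue p (oneHardy p) = 1 := by
      change coeff (oneHardy p : LpT p) 0 = 1
      rw [coeff_congr oneHardy_ae, coeff_const, if_pos rfl]
    rw [← hT] at hc
    rw [hc, map_smul, h1, smul_eq_mul, mul_one]
  -- Otherwise multiplication by t maps the nonzero finite-dimensional space V into itself and has
  -- an eigenvector there.
  have hex : ∃ f ∈ V, T f ≠ 0 := by
    by_contra! hall
    have hinv : ∀ f ∈ V, toeplitz p (fun t => (t : ℂ) ^ (1 : ℤ)) f ∈ V := by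
      intro f hf
      have h1 : f ∈ T.ker := hall f hf
      rw [hker'] at h1
      rw [hker]
      have hmono : MemHardy ∞ fun t : Circle => (t : ℂ) ^ (1 : ℤ) := by
        simpa using (memHardy_const ∞ 1).mul_zpow (k := 1) zero_le_one
      refine h1.congr ?_
      filter_upwards [toeplitz_hardy_ae H hmono f] with t ht
      rw [ht, mul_assoc]
    have hnt : Nontrivial V := Module.nontrivial_of_finrank_pos (R := ℂ) (by rw [hn]; omega)
    obtain ⟨μ, hμ⟩ := Module.End.exists_eigenvalue
      ((toeplitz p (fun t => (t : ℂ) ^ (1 : ℤ))).toLinearMap.restrict hinv)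
    obtain ⟨v, hv⟩ := hμ.exists_hasEigenvector
    have h1 := congrArg Subtype.val hv.apply_eq_smul
    have hmono : MemHardy ∞ fun t : Circle => (t : ℂ) ^ (1 : ℤ) := by
      simpa using (memHardy_const ∞ 1).mul_zpow (k := 1) zero_le_one
    have h2 : toeplitz p (fun t => (t : ℂ) ^ (1 : ℤ)) (v : hardy p) = μ • (v : hardy p) := h1
    have h3 : (v : hardy p) = 0 := by
      refine eq_zero_of_mul_self_eq (μ := μ) ?_
      have h4 := toeplitz_hardy_ae H hmono (v : hardy p)
      rw [h2] at h4
      exact h4.symm.trans (hardy_smul_ae μ (v : hardy p))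
    exact hv.2 (Subtype.ext h3)
  obtain ⟨f₀, hf₀, hTf₀⟩ := hex
  obtain ⟨μ₀, hμ₀⟩ : ∃ μ₀, meanValue p (T f₀) = μ₀ := ⟨_, rfl⟩
  have hT₀ : T f₀ = μ₀ • oneHardy p := hμ₀ ▸ hconst f₀ hf₀
  have hm0 : μ₀ ≠ 0 := fun h0 => hTf₀ (by rw [hT₀, h0, zero_smul])
  constructor
  · intro y
    have hmono : MemLp (fun t : Circle => (t : ℂ) ^ (-1 : ℤ)) ∞ arc :=
      memLp_of_continuous (continuous_coe_zpow _) ∞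
    -- Solving T(g)f₁ = T(t⁻¹)y gives T(gt)f₁ = y up to a constant, which a multiple of f₀ removes.
    obtain ⟨f₁, hf₁⟩ := hs (toeplitz p (fun t => (t : ℂ) ^ (-1 : ℤ)) y)
    have h1 := (toeplitz_eq_iff H.left hg).1 hf₁
    have h2 := toeplitz_spec H.left hmono y
    obtain ⟨c, hc⟩ := toeplitz_mul_self_sub H.left hg (f := f₁) (y := y)
      ((h1.sub h2).congr (Filter.Eventually.of_forall fun t => by ring))
    rw [← hT] at hc
    refine ⟨f₁ - (c * μ₀⁻¹) • f₀, ?_⟩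
    rw [map_sub, map_smul, hT₀, smul_smul, mul_assoc, inv_mul_cancel₀ hm0, mul_one, ← hc,
      sub_sub_cancel]
  -- On V the operator T is a single nonzero functional times 1, with kernel ker T; rank-nullity
  -- lowers the dimension by one.
  · let l : V →ₗ[ℂ] ℂ := meanValue p ∘ₗ T.toLinearMap ∘ₗ V.subtype
    have hlker : l.ker = T.ker.comap V.subtype := by
      ext f
      constructor
      · intro h0
        change T f = 0
        rw [hconst f f.2]
        have : meanValue p (T f) = 0 := h0
        rw [this, zero_smul]
      · intro h0
        change meanValue p (T f) = 0
        rw [show T f = 0 from h0, map_zero]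
    have hrange : l.range = ⊤ := by
      rw [LinearMap.range_eq_top]
      refine LinearMap.surjective (f := l) fun h0 => hm0 ?_
      rw [← hμ₀]
      exact congrArg (fun k : V →ₗ[ℂ] ℂ => k ⟨f₀, hf₀⟩) h0
    have h1 := l.finrank_range_add_finrank_ker
    rw [hrange, finrank_top, Module.finrank_self, hn, hlker,
      (Submodule.comapSubtypeEquivOfLe hle).finrank_eq] at h1
    omega

/-- If `T(g)` is onto with `n`-dimensional kernel, then `T(g tⁿ)` is bijective. -/
theorem bijective_toeplitz_mul_pow (H : RieszPair p q) (n : ℕ) {g : Circle → ℂ}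
    (hg : MemLp g ∞ arc) (hs : Function.Surjective (toeplitz p g))
    (hfin : FiniteDimensional ℂ (toeplitz p g).ker)
    (hn : Module.finrank ℂ (toeplitz p g).ker = n) :
    Function.Bijective (toeplitz p fun t => g t * (t : ℂ) ^ (n : ℤ)) := by
  induction n generalizing g with
  | zero =>
    have e : (fun t : Circle => g t * (t : ℂ) ^ ((0 : ℕ) : ℤ)) = g := by
      funext t
      rw [Nat.cast_zero, zpow_zero, mul_one]
    rw [e]
    exact ⟨LinearMap.ker_eq_bot.1 (Submodule.finrank_eq_zero.1 hn), hs⟩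
  | succ n ih =>
    obtain ⟨h1, h2⟩ := toeplitz_mul_self_step H hg hs hn
    have hle : (toeplitz p fun t => g t * (t : ℂ) ^ (1 : ℤ)).ker ≤ (toeplitz p g).ker := by
      intro f hf
      have hf' := (toeplitz_eq_zero_iff H.left (memLp_mul_zpow hg 1)).1 hf
      refine (toeplitz_eq_zero_iff H.left hg).2 ?_
      refine (hf'.mul_zpow (k := -1) (by norm_num)).congr (Filter.Eventually.of_forall fun t => ?_)
      have := Circle.coe_ne_zero t
      simp only [zpow_neg, zpow_one]
      field_simp
    have hfin' := Submodule.finiteDimensional_of_le hle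
    have h3 := ih (memLp_mul_zpow hg 1) h1 hfin' h2
    have e : (fun t : Circle => g t * (t : ℂ) ^ (1 : ℤ) * (t : ℂ) ^ (n : ℤ)) =
        fun t => g t * (t : ℂ) ^ ((n + 1 : ℕ) : ℤ) := by
      funext t
      rw [mul_assoc, ← zpow_add₀ (Circle.coe_ne_zero t)]
      congr 2
      push_cast
      ring
    rwa [e] at h3

/-- A Fredholm Toeplitz operator of positive index `κ` becomes invertible when its symbol is
multiplied by `t^κ`. -/
theorem bijective_toeplitz_of_index_pos (H : RieszPair p q) {g : Circle → ℂ} (hg : MemLp g ∞ arc)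
    (hg0 : ∀ᵐ t ∂arc, g t ≠ 0) (hF : (toeplitz p g).IsFredholm)
    (hpos : 0 < fredholmIndex (toeplitz p g)) :
    Function.Bijective (toeplitz p fun t => g t * (t : ℂ) ^ fredholmIndex (toeplitz p g)) := by
  have hfin := hF.finite_ker
  have hker : 0 < Module.finrank ℂ (toeplitz p g).ker := by
    unfold fredholmIndex at hpos
    omega
  have hnt : Nontrivial (toeplitz p g).ker := Module.nontrivial_of_finrank_pos hker
  obtain ⟨f, hf⟩ := exists_ne (0 : (toeplitz p g).ker)
  have hs := surjective_toeplitz_of_ker H hg hg0 hF (f := f) (fun h => hf (Subtype.ext h)) f.2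
  have hidx := finrank_ker_of_surjective hs
  rw [hidx]
  exact bijective_toeplitz_mul_pow H _ hg hs hfin rfl

end Index

/-! ### Wiener–Hopf factorization -/

section Factorization

variable {p q : ℝ≥0∞} [hp : Fact (1 ≤ p)] [hq : Fact (1 ≤ q)]

theorem conj_zpow_coe (t : Circle) (k : ℤ) : conj ((t : ℂ) ^ k) = (t : ℂ) ^ (-k) := by
  rw [map_zpow₀, ← Circle.coe_inv_eq_conj, Circle.coe_inv, inv_zpow, zpow_neg]

/-- If `F - 1` has only negative frequencies, then `F` has no positive ones, and its mean value
is `1`. -/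
theorem memHardyConj_of_sub_one {F : Circle → ℂ} (hF : MemNeg p fun t => F t - 1) :
    MemHardyConj p F ∧ coeff F 0 = 1 := by
  have e : (fun t => (F t - 1) + 1) = F := funext fun t => sub_add_cancel _ _
  have hi := hF.1.integrable hp.out
  have hc : ∀ n, coeff F n = coeff (fun t => F t - 1) n + if n = 0 then 1 else 0 := fun n => by
    rw [← coeff_const, ← coeff_add hi (integrable_const _), e]
  refine ⟨⟨?_, fun n hn => ?_⟩, ?_⟩
  · rw [← e]
    exact hF.1.add (memLp_const 1)
  · rw [hc, hF.2 n hn.le, if_neg hn.ne', zero_add]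
  · rw [hc, hF.2 0 le_rfl, if_pos rfl, zero_add]

/-- An invertible Toeplitz operator has a weak Wiener–Hopf factorization of its symbol. -/
theorem exists_weakWienerHopf (H : RieszPair p q) {g : Circle → ℂ} (hg : MemLp g ∞ arc)
    (hg0 : ∀ᵐ t ∂arc, g t ≠ 0) {k : ℤ}
    (hb : Function.Bijective (toeplitz p fun t => g t * (t : ℂ) ^ k)) :
    ∃ gm gp, IsWeakWienerHopf p q g (-k) gm gp := by
  set e : Circle → ℂ := fun t => g t * (t : ℂ) ^ k with he
  have hem : MemLp e ∞ arc := memLp_mul_zpow hg k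
  have he0 : ∀ᵐ t ∂arc, e t ≠ 0 := by
    filter_upwards [hg0] with t ht
    exact mul_ne_zero ht (zpow_ne_zero _ (Circle.coe_ne_zero t))
  -- The factors come from the solutions of T(e)x = 1 and T(ē)h = 1. Then ex and ēh have no positive
  -- frequencies and mean 1.
  obtain ⟨x, hx⟩ := hb.2 (oneHardy p)
  obtain ⟨h, hh⟩ := (bijective_toeplitz_cj H hem hb).2 (oneHardy q)
  obtain ⟨hy, hy0⟩ := memHardyConj_of_sub_one (F := fun t => e t * (x : LpT p) t) <|
    ((toeplitz_eq_iff H.left hem).1 hx).congr (by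
      filter_upwards [oneHardy_ae (p := p)] with t ht
      rw [ht])
  obtain ⟨hv, hv0⟩ := memHardyConj_of_sub_one (F := fun t => cj e t * (h : LpT q) t) <|
    ((toeplitz_eq_iff H.right (memLp_cj hem)).1 hh).congr (by
      filter_upwards [oneHardy_ae (p := q)] with t ht
      rw [ht])
  have hv' : MemHardy q fun t => e t * conj ((h : LpT q) t) :=
    hv.conj.congr (Filter.Eventually.of_forall fun t => by simp only [map_mul, cj, conj_conj])
  have hv0' : coeff (fun t => e t * conj ((h : LpT q) t)) 0 = 1 := by
    have e1 : (fun t => e t * conj ((h : LpT q) t)) =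
        fun t => conj (cj e t * (h : LpT q) t) := by
      funext t
      rw [map_mul, cj, conj_conj]
    rw [e1, coeff_conj, neg_zero, hv0, map_one]
  set c := coeff (x : LpT p) 0 with hc
  -- z = x e h̄ is the analytic x times the analytic e h̄, and also the antianalytic ex times the
  -- antianalytic h̄; so it is a constant c.
  set z : Circle → ℂ := fun t => (x : LpT p) t * (e t * conj ((h : LpT q) t)) with hz
  have hz' : z = fun t => e t * (x : LpT p) t * conj ((h : LpT q) t) := by
    funext t
    rw [hz]
    ring
  have hzc : z =ᵐ[arc] fun _ => c := by
    refine ae_eq_of_coeff (H.integrable_mul (memHardy_coe x).1 hv'.1) (integrable_const _)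
      fun n => ?_
    rw [coeff_const]
    split_ifs with hn
    · rw [hn, hz, H.coeff_mul_zero (memHardy_coe x) hv', hv0', mul_one]
    · rcases lt_or_gt_of_ne hn with hn | hn
      · exact H.coeff_mul_eq_zero (memHardy_coe x) hv' hn
      · rw [hz']
        exact H.coeff_mul_conj_eq_zero hy (memHardy_coe h).conj hn
  -- If c = 0 then x h̄ = 0, so x or h vanishes, although ex and ēh have mean 1.
  have hc0 : c ≠ 0 := by
    intro hc0
    have h1 : ∀ᵐ t ∂arc, (x : LpT p) t * conj ((h : LpT q) t) = 0 := by
      filter_upwards [hzc, he0] with t h2 h3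
      have h4 : (x : LpT p) t * (e t * conj ((h : LpT q) t)) = 0 := h2.trans hc0
      rw [mul_left_comm] at h4
      exact (mul_eq_zero.1 h4).resolve_left h3
    have h00 : coeff (fun _ => (0 : ℂ)) 0 = 0 := by rw [coeff_const, ite_self]
    rcases eq_zero_or_eq_zero_of_mul_conj H (memHardy_coe x) (memHardy_coe h) h1 with h2 | h2
    · refine zero_ne_one (α := ℂ) ?_
      rw [← hy0, ← h00]
      refine coeff_congr ?_ 0
      filter_upwards [h2] with t ht
      rw [ht, Pi.zero_apply, mul_zero]
    · refine zero_ne_one (α := ℂ) ?_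
      rw [← hv0, ← h00]
      refine coeff_congr ?_ 0
      filter_upwards [h2] with t ht
      rw [ht, Pi.zero_apply, mul_zero]
  have hx0 : ∀ᵐ t ∂arc, (x : LpT p) t ≠ 0 := by
    filter_upwards [hzc] with t ht h0
    rw [hz] at ht
    simp only [h0, zero_mul] at ht
    exact hc0 ht.symm
  -- e = (ex) x⁻¹, and the constancy of z supplies the remaining memberships: x⁻¹ = c⁻¹ e h̄ and
  -- (ex)⁻¹ = c⁻¹ h̄.
  refine ⟨fun t => e t * (x : LpT p) t, (x : LpT p)⁻¹, ?_, ?_, hy, ?_, ?_, hy0, ?_⟩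
  · refine (hv'.const_mul c⁻¹).congr ?_
    filter_upwards [hx0, hzc] with t h1 h2
    have h4 : (x : LpT p) t * (e t * conj ((h : LpT q) t)) = c := h2
    have h3 : e t * conj ((h : LpT q) t) ≠ 0 := fun h0 => hc0 (by rw [← h4, h0, mul_zero])
    rw [Pi.inv_apply, ← h4, mul_inv, mul_assoc, inv_mul_cancel₀ h3, mul_one]
  · rw [inv_inv]
    exact memHardy_coe x
  · refine ((memHardy_coe h).conj.const_mul c⁻¹).congr ?_
    filter_upwards [hx0, hzc, he0] with t h1 h2 h4
    have h5 : e t * (x : LpT p) t * conj ((h : LpT q) t) = c := by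
      rw [← h2, hz']
    have h3 : conj ((h : LpT q) t) ≠ 0 := fun h0 => hc0 (by rw [← h5, h0, mul_zero])
    rw [Pi.inv_apply, ← h5, mul_inv, mul_assoc, inv_mul_cancel₀ h3, mul_one]
  · filter_upwards [hx0, he0] with t h1 h2
    exact ⟨mul_ne_zero h2 h1, inv_ne_zero h1⟩
  · filter_upwards [hx0] with t h1
    have := zpow_ne_zero k (Circle.coe_ne_zero t)
    rw [Pi.inv_apply, he, zpow_neg]
    field_simp

/-- If n < k, comparing the two factorizations equates an analytic function vanishing at 0 with an
antianalytic one. Both are then zero, although no factor vanishes. -/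
theorem IsWeakWienerHopf.index_le (H : RieszPair p q) {g gm gp hm hp : Circle → ℂ} {n k : ℤ}
    (hg : IsWeakWienerHopf p q g n gm gp) (hh : IsWeakWienerHopf p q g k hm hp) : k ≤ n := by
  by_contra! hlt
  have e : (fun t => gp⁻¹ t * hp t * (t : ℂ) ^ (k - n)) =ᵐ[arc] fun t => gm t * hm⁻¹ t := by
    filter_upwards [hg.eq, hh.eq, hg.ne_zero, hh.ne_zero] with t h1 h2 h3 h4
    rw [h1] at h2
    have ht := Circle.coe_ne_zero t
    have h5 := h3.2
    have h6 := h4.1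
    have h7 := zpow_ne_zero n ht
    rw [Pi.inv_apply, Pi.inv_apply, zpow_sub₀ ht]
    field_simp
    linear_combination -h2
  have h0 : (fun t => gm t * hm⁻¹ t) =ᵐ[arc] 0 := by
    refine ae_eq_zero_of_coeff (H.integrable_mul hg.minus_mem.1 hh.minus_inv_mem.1) fun j => ?_
    rcases le_or_gt j 0 with hj | hj
    · rw [← coeff_congr e, coeff_mul_zpow]
      exact H.coeff_mul_eq_zero hg.plus_inv_mem hh.plus_mem (by omega)
    · exact H.coeff_mul_conj_eq_zero hg.minus_mem hh.minus_inv_mem hj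
  obtain ⟨t, h1, h2, h3⟩ := (h0.and (hg.ne_zero.and hh.ne_zero)).exists
  exact mul_ne_zero h2.1 (inv_ne_zero h3.1) h1

/-- The index of a weak Wiener–Hopf factorization is unique. -/
theorem IsWeakWienerHopf.index_eq (H : RieszPair p q) {g gm gp hm hp : Circle → ℂ} {n k : ℤ}
    (hg : IsWeakWienerHopf p q g n gm gp) (hh : IsWeakWienerHopf p q g k hm hp) : n = k :=
  le_antisymm (hh.index_le H hg) (hg.index_le H hh)

/-- Complex conjugation turns a factorization in `H^p` into one in `H^q`. -/
theorem IsWeakWienerHopf.exists_cj (H : RieszPair p q) {g gm gp : Circle → ℂ} {n : ℤ}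
    (hg : IsWeakWienerHopf p q g n gm gp) :
    ∃ hm hp, IsWeakWienerHopf q p (cj g) (-n) hm hp := by
  -- Conjugation swaps the factors, and the new minus factor must be 1 at infinity, hence the
  -- division by c̄. The means of g₊ and g₊⁻¹ multiply to 1, so c ≠ 0.
  set c := coeff gp 0 with hc
  have hc0 : c ≠ 0 := by
    intro h0
    have h1 := H.coeff_mul_zero hg.plus_inv_mem hg.plus_mem
    have h2 : (fun t => gp⁻¹ t * gp t) =ᵐ[arc] fun _ => 1 := by
      filter_upwards [hg.ne_zero] with t ht
      rw [Pi.inv_apply, inv_mul_cancel₀ ht.2]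
    rw [coeff_congr h2, coeff_const, if_pos rfl, ← hc, h0, mul_zero] at h1
    exact one_ne_zero h1
  have hc0' : conj c ≠ 0 := (map_ne_zero _).2 hc0
  refine ⟨fun t => (conj c)⁻¹ * conj (gp t), fun t => conj c * conj (gm t),
    hg.minus_mem.conj.const_mul _, ?_, hg.plus_mem.conj.const_mul _, ?_, ?_, ?_, ?_⟩
  · refine (hg.minus_inv_mem.conj.const_mul (conj c)⁻¹).congr (Filter.Eventually.of_forall
      fun t => ?_)
    simp only [Pi.inv_apply, map_inv₀, mul_inv]
  · refine (hg.plus_inv_mem.conj.const_mul (conj c)).congr (Filter.Eventually.of_forall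
      fun t => ?_)
    simp only [Pi.inv_apply, map_inv₀, mul_inv, inv_inv]
  · filter_upwards [hg.ne_zero] with t ht
    exact ⟨mul_ne_zero (inv_ne_zero hc0') ((map_ne_zero _).2 ht.2),
      mul_ne_zero hc0' ((map_ne_zero _).2 ht.1)⟩
  · rw [coeff_const_mul, coeff_conj, neg_zero, ← hc, inv_mul_cancel₀ hc0']
  · filter_upwards [hg.eq] with t ht
    rw [cj, ht, map_mul, map_mul, conj_zpow_coe]
    field_simp

end Factorization

/-! ### Right inverses of Toeplitz operators of index `0` or `1` -/

section RightInverse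

variable {p q : ℝ≥0∞} [hp : Fact (1 ≤ p)] [hq : Fact (1 ≤ q)]

theorem memHardyConj_zpow_neg {k : ℤ} (hk : 0 ≤ k) :
    MemHardyConj ∞ fun t : Circle => (t : ℂ) ^ (-k) :=
  ((memHardyConj_const ∞ 1).mul_zpow (k := -k) (by omega)).congr
    (Filter.Eventually.of_forall fun _ => one_mul _)

theorem memHardy_zpow {k : ℤ} (hk : 0 ≤ k) : MemHardy ∞ fun t : Circle => (t : ℂ) ^ k :=
  ((memHardy_const ∞ 1).mul_zpow hk).congr (Filter.Eventually.of_forall fun _ => one_mul _)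

/-- Toeplitz operators with invertible antianalytic symbol are invertible. -/
theorem bijective_toeplitz_conj (H : RieszPair p q) {g : Circle → ℂ} (hg : MemHardyConj ∞ g)
    (hg' : MemHardyConj ∞ fun t => (g t)⁻¹) (hg0 : ∀ t, g t ≠ 0) :
    Function.Bijective (toeplitz p g) := by
  refine Function.bijective_iff_has_inverse.2 ⟨toeplitz p fun t => (g t)⁻¹, fun f => ?_, fun f => ?_⟩
  · rw [← toeplitz_conj_mul H hg' hg.1]
    exact toeplitz_one H.left (Filter.Eventually.of_forall fun t => inv_mul_cancel₀ (hg0 t)) f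
  · rw [← toeplitz_conj_mul H hg hg'.1]
    exact toeplitz_one H.left (Filter.Eventually.of_forall fun t => mul_inv_cancel₀ (hg0 t)) f

theorem toeplitz_zpow_mul (H : RieszPair p q) {k : Circle → ℂ} (hk : MemLp k ∞ arc) {n : ℤ}
    (hn : 0 ≤ n) (f : hardy p) :
    toeplitz p k f = toeplitz p (fun t => (t : ℂ) ^ (-n))
      (toeplitz p (fun t => k t * (t : ℂ) ^ n) f) := by
  rw [← toeplitz_conj_mul H (memHardyConj_zpow_neg hn) (memLp_mul_zpow hk n)]
  congr 1
  refine toeplitz_congr (Filter.Eventually.of_forall fun t => ?_)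
  simp only
  rw [mul_left_comm, ← zpow_add₀ (Circle.coe_ne_zero t), neg_add_cancel, zpow_zero, mul_one]

theorem toeplitz_zpow_leftInverse (H : RieszPair p q) {n : ℤ} (hn : 0 ≤ n) (f : hardy p) :
    toeplitz p (fun t => (t : ℂ) ^ (-n)) (toeplitz p (fun t => (t : ℂ) ^ n) f) = f := by
  rw [← toeplitz_conj_mul H (memHardyConj_zpow_neg hn) (memHardy_zpow hn).1]
  refine toeplitz_one H.left (Filter.Eventually.of_forall fun t => ?_) f
  simp only
  rw [← zpow_add₀ (Circle.coe_ne_zero t), neg_add_cancel, zpow_zero]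

theorem surjective_toeplitz_of_bijective (H : RieszPair p q) {k : Circle → ℂ} (hk : MemLp k ∞ arc)
    {n : ℤ} (hn : 0 ≤ n) (hb : Function.Bijective (toeplitz p fun t => k t * (t : ℂ) ^ n)) :
    Function.Surjective (toeplitz p k) := by
  intro y
  obtain ⟨f, hf⟩ := hb.2 (toeplitz p (fun t => (t : ℂ) ^ n) y)
  exact ⟨f, by rw [toeplitz_zpow_mul H hk hn, hf, toeplitz_zpow_leftInverse H hn]⟩

/-- For n = 1, T(k) = T(t⁻¹) T(kt) and T(t⁻¹) annihilates just the constants; so the kernel is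
spanned by the solution of T(kt)w = 1. -/
theorem finrank_ker_toeplitz (H : RieszPair p q) {k : Circle → ℂ} (hk : MemLp k ∞ arc)
    {n : ℤ} (hn : 0 ≤ n) (hn1 : n ≤ 1)
    (hb : Function.Bijective (toeplitz p fun t => k t * (t : ℂ) ^ n)) :
    (Module.finrank ℂ (toeplitz p k).ker : ℤ) = n := by
  obtain rfl | rfl : n = 0 ∨ n = 1 := by omega
  · have e : (fun t : Circle => k t * (t : ℂ) ^ (0 : ℤ)) = k :=
      funext fun t => by rw [zpow_zero, mul_one]
    rw [e] at hb
    have : (toeplitz p k).ker = ⊥ := LinearMap.ker_eq_bot.2 hb.1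
    rw [this, finrank_bot, Nat.cast_zero]
  · obtain ⟨w, hw⟩ := hb.2 (oneHardy p)
    have hw0 : w ≠ 0 := by
      rintro rfl
      exact oneHardy_ne_zero (p := p) (by rw [← hw, map_zero])
    have hone : toeplitz p (fun t => (t : ℂ) ^ (-1 : ℤ)) (oneHardy p) = 0 := by
      rw [toeplitz_eq_zero_iff H.left (memHardyConj_zpow_neg zero_le_one).1]
      refine ((memHardyConj_const p 1).mul_zpow_neg (k := -1) (by norm_num)).congr ?_
      filter_upwards [oneHardy_ae (p := p)] with t ht
      rw [ht, mul_comm]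
    have e : (toeplitz p k).ker = Submodule.span ℂ {w} := by
      ext f
      rw [Submodule.mem_span_singleton]
      constructor
      · intro hf
        have hf' := (toeplitz_eq_zero_iff H.left hk).1 hf
        obtain ⟨c, hc⟩ := toeplitz_mul_self_sub H.left hk (f := f) (y := 0) (hf'.congr (by
          filter_upwards [hardy_zero_ae (r := p)] with t ht
          rw [ht, zero_mul, sub_zero]))
        refine ⟨c, hb.1 ?_⟩
        rw [sub_zero] at hc
        rw [map_smul, hw, hc]
      · rintro ⟨c, rfl⟩
        change toeplitz p k (c • w) = 0
        rw [toeplitz_zpow_mul H hk zero_le_one, map_smul, hw, map_smul, hone, smul_zero]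
    rw [e, finrank_span_singleton hw0, Nat.cast_one]

/-- The right inverse of a Toeplitz operator of index `0` or `1`. -/
theorem toeplitz_toeplitzRightInv (H : RieszPair p q) {k : Circle → ℂ} (hk : MemLp k ∞ arc)
    {n : ℤ} (hn : 0 ≤ n) (hn1 : n ≤ 1)
    (hb : Function.Bijective (toeplitz p fun t => k t * (t : ℂ) ^ n)) (f : hardy p) :
    toeplitz p k (toeplitzRightInv p k f) = f := by
  have hidx : fredholmIndex (toeplitz p k) = n := by
    rw [finrank_ker_of_surjective (surjective_toeplitz_of_bijective H hk hn hb),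
      finrank_ker_toeplitz H hk hn hn1 hb]
  have := completeSpace_hardy H
  -- `Ring.inverse` is 0 off the units; bijectivity gives a unit because H^p is complete. Then T(k)
  -- T_r⁻¹(k) = T(t⁻ⁿ) T(ktⁿ) T(ktⁿ)⁻¹ T(tⁿ) = I.
  have hu := ContinuousLinearMap.isUnit_iff_bijective.2 hb
  have h1 := Ring.mul_inverse_cancel _ hu
  rw [toeplitzRightInv, hidx, toeplitz_zpow_mul H hk hn]
  have h2 := DFunLike.congr_fun h1 (toeplitz p (fun t => (t : ℂ) ^ n) f)
  change toeplitz p (fun t => (t : ℂ) ^ (-n)) ((toeplitz p (fun t => k t * (t : ℂ) ^ n))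
    (Ring.inverse (toeplitz p (fun t => k t * (t : ℂ) ^ n)) (toeplitz p (fun t => (t : ℂ) ^ n) f)))
    = f
  have h3 : (toeplitz p (fun t => k t * (t : ℂ) ^ n))
    (Ring.inverse (toeplitz p (fun t => k t * (t : ℂ) ^ n)) (toeplitz p (fun t => (t : ℂ) ^ n) f))
    = toeplitz p (fun t => (t : ℂ) ^ n) f := h2
  rw [h3, toeplitz_zpow_leftInverse H hn]

theorem imPAlpha_congr {β : ℂ} (hβ : 1 < ‖β‖) {ε : ℂ} {g g' : Circle → ℂ} (h : g =ᵐ[arc] g') :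
    imPAlpha hβ p ε g = imPAlpha hβ p ε g' := by
  rw [imPAlpha, imPAlpha, pAlpha_congr hβ h, toeplitz_congr h]

end RightInverse

/-! ### The adjoint matching pair -/

section AdjointPair

variable {β : ℂ} {hβ : 1 < ‖β‖} {a b : Circle → ℂ}

/-- The matching pair `(ā χ⁻ᵐ, conj (b ∘ α) χᵐ)`. -/
theorem IsMatchingPair.adjoint (h : IsMatchingPair hβ a b) (m : ℤ) :
    IsMatchingPair hβ (fun t => conj (a t) * chi β t ^ (-m))
      (fun t => conj (b (shift hβ t)) * chi β t ^ m) where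
  left_mem := (memLp_of_continuous (continuous_chi_zpow hβ (-m)) ∞).mul' (memLp_cj h.left_mem)
  right_mem := (memLp_of_continuous (continuous_chi_zpow hβ m) ∞).mul'
    (memLp_comp_shift hβ (memLp_cj h.right_mem))
  left_ne_zero := by
    filter_upwards [h.left_ne_zero] with t ht
    exact mul_ne_zero ((map_ne_zero _).2 ht) (zpow_ne_zero _ (chi_ne_zero hβ t))
  left_inv_mem := by
    have h1 : MemLp (fun t => conj (a⁻¹ t) * chi β t ^ m) ∞ arc :=
      (memLp_of_continuous (continuous_chi_zpow hβ m) ∞).mul' (memLp_cj h.left_inv_mem)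
    refine h1.ae_eq (Filter.Eventually.of_forall fun t => ?_)
    simp only [Pi.inv_apply, map_inv₀, mul_inv, zpow_neg, inv_inv]
  matching := by
    filter_upwards [h.matching] with t ht
    have h1 := chi_zpow_shift hβ t m
    have h2 := chi_zpow_shift hβ t (-m)
    rw [h1, h2, shift_shift, neg_neg, mul_mul_mul_comm, ← map_mul, ht, map_mul]
    ring

/-- Passing to the adjoint pair exchanges the roles of c and d: matching gives a b_α⁻¹ = b a_α⁻¹ =
d. -/
theorem subC_adjoint (h : IsMatchingPair hβ a b) (m : ℤ) :
    subC (fun t => conj (a t) * chi β t ^ (-m)) (fun t => conj (b (shift hβ t)) * chi β t ^ m)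
      =ᵐ[arc] fun t => cj (subD hβ a b) t * chi β t ^ (-(2 * m)) := by
  filter_upwards [h.matching, ae_shift hβ h.left_ne_zero, ae_shift hβ h.right_ne_zero]
    with t h1 h2 h3
  have h4 : a t * (b (shift hβ t))⁻¹ = b t * (a (shift hβ t))⁻¹ := by
    field_simp
    rw [h1, mul_comm]
  have h5 : chi β t ^ (-(2 * m)) = chi β t ^ (-m) * (chi β t ^ m)⁻¹ := by
    rw [← zpow_neg, ← zpow_add₀ (chi_ne_zero hβ t)]
    congr 1
    ring
  rw [cj, subD, ← h4, h5, subC, mul_inv, map_mul, map_inv₀]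
  ring

theorem subD_adjoint (h : IsMatchingPair hβ a b) (m : ℤ) :
    subD hβ (fun t => conj (a t) * chi β t ^ (-m))
      (fun t => conj (b (shift hβ t)) * chi β t ^ m) =ᵐ[arc] cj (subC a b) := by
  filter_upwards [h.matching, ae_shift hβ h.left_ne_zero, h.right_ne_zero] with t h1 h2 h3
  have h4 : a t * (b t)⁻¹ = b (shift hβ t) * (a (shift hβ t))⁻¹ := by
    field_simp
    rw [h1]
  have h5 := zpow_ne_zero m (chi_ne_zero hβ t)
  have h6 := chi_zpow_shift hβ t (-m)
  rw [subD, cj, subC, h4, h6, neg_neg, map_mul, map_inv₀, mul_inv]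
  field_simp

/-- α₋ is invertible among antianalytic functions, so inside a Toeplitz operator χ^(-n) shifts the
index just as t^(-n) does. -/
theorem chi_zpow_neg (t : Circle) (n : ℕ) :
    chi β t ^ (-(n : ℤ)) = alphaMinus β t ^ n * (t : ℂ) ^ (-(n : ℤ)) := by
  have ht := Circle.coe_ne_zero t
  have h1 : (chi β t)⁻¹ = alphaMinus β t * (t : ℂ)⁻¹ := by
    rw [alphaMinus_eq, zpow_one, mul_assoc, mul_inv_cancel₀ ht, mul_one]
  rw [zpow_neg, ← inv_zpow, h1, mul_zpow, inv_zpow', zpow_natCast]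

variable {p q : ℝ≥0∞} [hp : Fact (1 ≤ p)] [hq : Fact (1 ≤ q)]

/-- The symbol of the first subordinated function of the adjoint pair becomes invertible after
multiplication by `t^(2m-κ)`. -/
theorem bijective_toeplitz_subC_adjoint (H : RieszPair p q) (h : IsMatchingPair hβ a b) {κ : ℤ}
    (hb : Function.Bijective (toeplitz p fun t => subD hβ a b t * (t : ℂ) ^ κ)) (m : ℕ) :
    Function.Bijective (toeplitz q fun t =>
      subC (fun t => conj (a t) * chi β t ^ (-(m : ℤ)))
        (fun t => conj (b (shift hβ t)) * chi β t ^ (m : ℤ)) t * (t : ℂ) ^ (2 * (m : ℤ) - κ)) := by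
  have hem := memLp_mul_zpow h.subD_mem κ
  -- The powers t^(±2m) cancel, leaving α₋^(2m) conj(d t^κ): an invertible antianalytic factor times
  -- the symbol of an invertible adjoint.
  have e : (fun t => subC (fun t => conj (a t) * chi β t ^ (-(m : ℤ)))
      (fun t => conj (b (shift hβ t)) * chi β t ^ (m : ℤ)) t * (t : ℂ) ^ (2 * (m : ℤ) - κ))
      =ᵐ[arc] fun t => alphaMinus β t ^ (2 * m) *
        cj (fun t => subD hβ a b t * (t : ℂ) ^ κ) t := by
    filter_upwards [subC_adjoint h m] with t ht
    have h1 := chi_zpow_neg (β := β) t (2 * m)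
    rw [Nat.cast_mul, Nat.cast_ofNat] at h1
    have h2 : (t : ℂ) ^ (2 * (m : ℤ) - κ) = (t : ℂ) ^ (2 * (m : ℤ)) * (t : ℂ) ^ (-κ) := by
      rw [← zpow_add₀ (Circle.coe_ne_zero t), sub_eq_add_neg]
    have h3 := zpow_ne_zero (2 * (m : ℤ)) (Circle.coe_ne_zero t)
    rw [ht, h1, h2, cj, cj, map_mul, conj_zpow_coe, zpow_neg _ (2 * (m : ℤ))]
    field_simp
  have hA := bijective_toeplitz_conj H.symm
    (RieszPair.pow_hardyConj_top H (memHardyConj_alphaMinus hβ) (2 * m))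
    ((RieszPair.pow_hardyConj_top H (memHardyConj_alphaMinus_inv hβ) (2 * m)).congr
      (Filter.Eventually.of_forall fun t => inv_pow _ _))
    fun t => pow_ne_zero _ (alphaMinus_ne_zero hβ t)
  have hB := bijective_toeplitz_cj H hem hb
  rw [toeplitz_congr e]
  have e2 : ⇑(toeplitz q fun t => alphaMinus β t ^ (2 * m) *
      cj (fun t => subD hβ a b t * (t : ℂ) ^ κ) t) = toeplitz q (fun t => alphaMinus β t ^ (2 * m)) ∘
      toeplitz q (cj fun t => subD hβ a b t * (t : ℂ) ^ κ) := funext fun f =>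
    toeplitz_conj_mul H.symm (RieszPair.pow_hardyConj_top H (memHardyConj_alphaMinus hβ) (2 * m))
      (memLp_cj hem) f
  rw [e2]
  exact hA.comp hB

end AdjointPair

/-! ### One-dimensional kernels and the signature -/

section Signature

variable {p q : ℝ≥0∞} [hp : Fact (1 ≤ p)] [hq : Fact (1 ≤ q)] {β : ℂ}

theorem flip_const_mul (hβ : 1 < ‖β‖) (c : ℂ) (f : Circle → ℂ) :
    flip hβ (fun t => c * f t) = fun t => c * flip hβ f t := by
  funext t
  simp only [flip]
  ring

/-- If `k (k ∘ α) = 1` and `ker T(k)` is a line, then `k u = μ J u` on `ker T(k)`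
with a sign `μ`. -/
theorem exists_sign (H : RieszPair p q) (hβ : 1 < ‖β‖) {k : Circle → ℂ} (hk : MemLp k ∞ arc)
    (hkk : ∀ᵐ t ∂arc, k t * k (shift hβ t) = 1)
    (h1 : Module.finrank ℂ (toeplitz p k).ker = 1) :
    ∃ μ : ℂ, μ * μ = 1 ∧ ∀ u : hardy p, toeplitz p k u = 0 →
      (fun t => k t * (u : LpT p) t) =ᵐ[arc] fun t => μ * flip hβ (u : LpT p) t := by
  obtain ⟨⟨w, hw⟩, hw0, hspan⟩ := finrank_eq_one_iff'.1 h1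
  have hspan' : ∀ u : hardy p, toeplitz p k u = 0 → ∃ z : ℂ, u = z • w := fun u hu => by
    obtain ⟨z, hz⟩ := hspan ⟨u, hu⟩
    exact ⟨z, (congrArg Subtype.val hz).symm⟩
  have hwN : MemNeg p fun t => k t * (w : LpT p) t := (toeplitz_eq_zero_iff H.left hk).1 hw
  -- J(kw) lies in ker T(k) again, because k J(kw) = Jw has only negative frequencies. The kernel is
  -- a line, so J(kw) = μw.
  have hv := memHardy_flip H hβ hwN
  have hkv : (fun t => k t * flip hβ (fun t => k t * (w : LpT p) t) t) =ᵐ[arc]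
      flip hβ (w : LpT p) := by
    filter_upwards [hkk] with t ht
    simp only [flip]
    linear_combination ((chi β t)⁻¹ * (w : LpT p) (shift hβ t)) * ht
  obtain ⟨μ, hμ⟩ := hspan' hv.toHardy <| (toeplitz_eq_zero_iff H.left hk).2 <|
    (memNeg_flip H hβ (memHardy_coe w)).congr <| by
      filter_upwards [hkv, hv.toHardy_ae] with t h2 h3
      rw [h3, h2]
  have hμ' : flip hβ (fun t => k t * (w : LpT p) t) =ᵐ[arc] fun t => μ * (w : LpT p) t := by
    filter_upwards [hv.toHardy_ae, hardy_smul_ae μ w] with t h2 h3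
    rw [← h2, hμ, h3]
  have hkw : (fun t => k t * (w : LpT p) t) =ᵐ[arc] fun t => μ * flip hβ (w : LpT p) t := by
    have := flip_congr hβ hμ'
    rwa [flip_flip, flip_const_mul] at this
  refine ⟨μ, ?_, fun u hu => ?_⟩
  · have hwne : ¬ (w : LpT p) =ᵐ[arc] 0 := fun h0 =>
      hw0 (Subtype.ext ((hardy_eq_zero_iff w).2 h0))
    -- Using the relation twice gives Jw = k J(kw) = μ²Jw.
    by_contra hne
    apply hwne
    have h2 : flip hβ (w : LpT p) =ᵐ[arc] 0 := by
      filter_upwards [hkv, hμ', hkw] with t h3 h4 h5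
      rw [h4, mul_left_comm, h5, ← mul_assoc] at h3
      have h6 : (μ * μ - 1) * flip hβ (w : LpT p) t = 0 := by rw [sub_mul, h3, one_mul, sub_self]
      exact (mul_eq_zero.1 h6).resolve_left (sub_ne_zero.2 hne)
    have h3 := flip_congr hβ h2
    rw [flip_flip] at h3
    filter_upwards [h3] with t ht
    rw [ht, flip, Pi.zero_apply, mul_zero, Pi.zero_apply]
  · obtain ⟨z, rfl⟩ := hspan' u hu
    have h2 := hardy_smul_ae z w
    have h3 := flip_congr hβ h2
    rw [flip_const_mul] at h3
    filter_upwards [h2, h3, hkw] with t h4 h5 h6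
    rw [h4, h5, mul_left_comm, h6, mul_left_comm]

/-- The image of `𝐏_α(k)` when `ker T(k)` is a line. -/
theorem imPAlpha_eq_lineSpan (H : RieszPair p q) (hβ : 1 < ‖β‖) {k : Circle → ℂ}
    (hk : MemLp k ∞ arc) (hkk : ∀ᵐ t ∂arc, k t * k (shift hβ t) = 1)
    (h1 : Module.finrank ℂ (toeplitz p k).ker = 1) {μ ε : ℂ} (hμ : μ * μ = 1) (hε : ε * ε = 1)
    (hker : ∀ u : hardy p, toeplitz p k u = 0 →
      (fun t => k t * (u : LpT p) t) =ᵐ[arc] fun t => μ * flip hβ (u : LpT p) t)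
    {w : hardy p} (hw0 : w ≠ 0) (hw : toeplitz p k w = 0) {f : Circle → ℂ}
    (hf : (w : LpT p) =ᵐ[arc] f) :
    imPAlpha hβ p (-ε) k = lineSpan p ((1 - ε * μ) / 2) f := by
  have hL : lineSpan p ((1 - ε * μ) / 2) f = Submodule.span ℂ {((1 - ε * μ) / 2) • w} := by
    rw [lineSpan]
    congr 1
    ext h
    rw [Set.mem_singleton_iff, Set.mem_ofPred_eq]
    have h2 := hardy_smul_ae ((1 - ε * μ) / 2) w
    constructor
    · intro h3
      refine hardy_ext ?_
      filter_upwards [h2, h3, hf] with t h4 h5 h6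
      rw [h4, h5, h6]
    · rintro rfl
      filter_upwards [h2, hf] with t h4 h6
      rw [h4, h6]
  -- On the kernel ku = μJu, while membership asks for ku = -εJu; as J is injective, this means (μ +
  -- ε)u = 0.
  have hmem : ∀ u, u ∈ imPAlpha hβ p (-ε) k ↔ toeplitz p k u = 0 ∧ (μ + ε) • u = 0 := by
    intro u
    rw [mem_imPAlpha_iff H hβ hk hkk (by rw [neg_mul_neg, hε])]
    have key : toeplitz p k u = 0 → ((fun t => k t * (u : LpT p) t) =ᵐ[arc]
        (fun t => -ε * flip hβ (u : LpT p) t) ↔ (μ + ε) • u = 0) := by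
      intro hu
      have h2 := hker u hu
      have h4 := hardy_smul_ae (μ + ε) u
      rw [hardy_eq_zero_iff]
      constructor
      · intro h3
        have h5 : flip hβ (fun t => (μ + ε) * (u : LpT p) t) =ᵐ[arc] fun _ => 0 := by
          rw [flip_const_mul]
          filter_upwards [h2, h3] with t h6 h7
          rw [h6] at h7
          rw [add_mul, h7]
          ring
        have h6 := flip_congr hβ h5
        rw [flip_flip] at h6
        filter_upwards [h4, h6] with t h7 h8
        rw [h7, h8, flip, mul_zero, Pi.zero_apply]
      · intro h3
        have h5 := flip_congr hβ (h4.symm.trans h3)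
        rw [flip_const_mul] at h5
        filter_upwards [h2, h5] with t h6 h7
        have h8 : flip hβ 0 t = 0 := mul_zero _
        rw [h8] at h7
        rw [h6]
        linear_combination h7
    constructor
    · intro h3
      have hu : toeplitz p k u = 0 := (toeplitz_eq_zero_iff H.left hk).2 <|
        ((memNeg_flip H hβ (memHardy_coe u)).const_mul (-ε)).congr h3.symm
      exact ⟨hu, (key hu).1 h3⟩
    · rintro ⟨hu, h3⟩
      exact (key hu).2 h3
  -- In the first case the image is the whole line and (1 - εμ)/2 = 1; in the second both the image
  -- and the coefficient are zero.
  have hμε : μ = -ε ∨ μ = ε := by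
    have h2 : (μ + ε) * (μ - ε) = 0 := by linear_combination hμ - hε
    rcases mul_eq_zero.1 h2 with h3 | h3
    · exact Or.inl (eq_neg_of_add_eq_zero_left h3)
    · exact Or.inr (sub_eq_zero.1 h3)
  rw [hL]
  rcases hμε with rfl | rfl
  · have e : (1 - ε * -ε) / 2 = (1 : ℂ) := by
      rw [mul_neg, hε]
      norm_num
    rw [e, one_smul]
    ext u
    rw [hmem, neg_add_cancel, zero_smul, and_iff_left rfl, Submodule.mem_span_singleton]
    constructor
    · intro hu
      obtain ⟨z, hz⟩ := (finrank_eq_one_iff_of_nonzero' (⟨w, hw⟩ : (toeplitz p k).ker)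
        (fun h0 => hw0 (congrArg Subtype.val h0))).1 h1 ⟨u, hu⟩
      exact ⟨z, congrArg Subtype.val hz⟩
    · rintro ⟨z, rfl⟩
      rw [map_smul, hw, smul_zero]
  · have hμ0 : μ + μ ≠ 0 := by
      intro h0
      have : μ = 0 := by linear_combination h0 / 2
      rw [this, mul_zero] at hμ
      exact zero_ne_one hμ
    rw [hμ, sub_self, zero_div, zero_smul, Submodule.span_zero_singleton]
    ext u
    rw [hmem, smul_eq_zero, or_iff_right hμ0, Submodule.mem_bot]
    exact ⟨fun h => h.2, fun h => ⟨by rw [h, map_zero], h⟩⟩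

theorem conj_lam (β : ℂ) : conj (lam β) = -lam β := by
  rw [lam, map_mul, conj_I, conj_ofReal, neg_mul]

/-- J maps conj(α₋) to t⁻¹, so symmetry of J turns a pairing with conj(α₋) into a Fourier
coefficient. -/
theorem conj_flip_conj_alphaMinus (hβ : 1 < ‖β‖) (t : Circle) :
    conj (flip hβ (fun t => conj (alphaMinus β t)) t) = (t : ℂ) := by
  have ht := Circle.coe_ne_zero t
  have hl := lam_ne_zero hβ
  have hd := denom_ne_zero hβ t
  have hn := num_ne_zero hβ t
  have h1 : conj (t : ℂ) = (t : ℂ)⁻¹ := by rw [← Circle.coe_inv_eq_conj, Circle.coe_inv]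
  have h2 : β * (t : ℂ)⁻¹ - 1 ≠ 0 := by
    intro h0
    apply hn
    field_simp at h0
    linear_combination -h0
  have h3 : β - (t : ℂ) ≠ 0 := fun h0 => hn (by linear_combination -h0)
  rw [flip, map_mul, conj_conj, alphaMinus_eq, chi_shift, inv_inv, zpow_one, coe_shift, map_inv₀,
    chi_eq, map_div₀, map_sub, map_mul, map_one, conj_conj, h1, conj_lam]
  generalize conj β = w at hd ⊢
  have h4 : (t : ℂ) * w - 1 ≠ 0 := by rwa [mul_comm]
  field_simp
  ring

/-- The value at `1 / β̄` as an integral against `α₋`. -/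
theorem diskValue_inv (hβ : 1 < ‖β‖) (f : Circle → ℂ) :
    diskValue f (1 / conj β) = (lam β / conj β)⁻¹ * ∫ t, f t * alphaMinus β t ∂arc := by
  rw [diskValue, ← integral_const_mul]
  refine integral_congr_ae (Filter.Eventually.of_forall fun t => ?_)
  have hb := conj_beta_ne_zero hβ
  have hl := lam_ne_zero hβ
  have hd := denom_ne_zero hβ t
  have h1 : (t : ℂ) - 1 / conj β = (conj β * (t : ℂ) - 1) / conj β := by
    field_simp
  simp only [alphaMinus]
  rw [h1]
  field_simp

/-- The signature is the sign by which `J` acts on `ker T(g χ⁻²ᵐ)`. -/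
theorem alphaSignature_eq (H : RieszPair p q) (hβ : 1 < ‖β‖) {g k : Circle → ℂ} {m : ℕ} {n : ℤ}
    (hn : 2 * (m : ℤ) - n = 1) (hex : ∃ gm gp, IsWeakWienerHopf p q g n gm gp)
    (hk : MemLp k ∞ arc) (hkg : k =ᵐ[arc] fun t => g t * chi β t ^ (-(2 * (m : ℤ)))) {μ : ℂ}
    (hμ : μ * μ = 1)
    (hker : ∀ u : hardy p, toeplitz p k u = 0 →
      (fun t => k t * (u : LpT p) t) =ᵐ[arc] fun t => μ * flip hβ (u : LpT p) t) :
    alphaSignature β p q g = μ := by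
  obtain ⟨gm₀, gp₀, W₀⟩ := hex
  have hx : ∃ x : ℤ × (Circle → ℂ) × (Circle → ℂ), IsWeakWienerHopf p q g (-x.1) x.2.1 x.2.2 :=
    ⟨(-n, gm₀, gp₀), by rwa [neg_neg]⟩
  rw [alphaSignature, dif_pos hx]
  have W := hx.choose_spec
  -- The signature is computed from an arbitrarily chosen factorization; uniqueness of the index is
  -- all that is needed about the choice.
  have hidx : hx.choose.1 = -n := by rw [W₀.index_eq H W, neg_neg]
  rw [hidx, neg_neg] at W
  rw [hidx]
  set gm := hx.choose.2.1
  set gp := hx.choose.2.2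
  -- Since n - 2m = -1, k g₊⁻¹ = G t⁻¹ with G antianalytic. So g₊⁻¹ lies in ker T(k).
  set G : Circle → ℂ := fun t => alphaMinus β t ^ (2 * m) * gm t with hG
  have hGmem : MemHardyConj p G :=
    H.mul_hardyConj (H.pow_hardyConj_top (memHardyConj_alphaMinus hβ) (2 * m)) W.minus_mem
  set w := W.plus_inv_mem.toHardy with hw
  have hwae : (w : LpT p) =ᵐ[arc] gp⁻¹ := MemHardy.toHardy_ae _
  have hkw : (fun t => k t * (w : LpT p) t) =ᵐ[arc] fun t => G t * (t : ℂ) ^ (-1 : ℤ) := by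
    filter_upwards [hkg, hwae, W.eq, W.ne_zero] with t h1 h2 h3 h4
    have h5 := chi_zpow_neg (β := β) t (2 * m)
    rw [Nat.cast_mul, Nat.cast_ofNat] at h5
    have h6 : (t : ℂ) ^ (-1 : ℤ) = (t : ℂ) ^ n * (t : ℂ) ^ (-(2 * (m : ℤ))) := by
      rw [← zpow_add₀ (Circle.coe_ne_zero t)]
      congr 1
      omega
    have h7 := h4.2
    rw [h1, h2, h3, h5, h6, Pi.inv_apply, hG]
    field_simp
  have hTw : toeplitz p k w = 0 := (toeplitz_eq_zero_iff H.left hk).2 <|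
    (hGmem.mul_zpow_neg (k := -1) (by norm_num)).congr hkw.symm
  have hJ : (fun t => μ * gp⁻¹ t) =ᵐ[arc] flip hβ fun t => G t * (t : ℂ) ^ (-1 : ℤ) := by
    have h1 := flip_congr hβ (hkw.symm.trans (hker w hTw))
    rw [flip_const_mul, flip_flip] at h1
    filter_upwards [h1, hwae] with t h2 h3
    rw [h2, h3]
  -- Pairing μ g₊⁻¹ = J(G t⁻¹) with conj(α₋) and moving J across leaves the value of G at infinity,
  -- (λ/β̄)^(2m).
  have hint : μ * ∫ t, gp⁻¹ t * alphaMinus β t ∂arc = (lam β / conj β) ^ (2 * m) := by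
    have h1 := integral_flip_mul_conj H hβ (fun t => G t * (t : ℂ) ^ (-1 : ℤ))
      fun t => conj (alphaMinus β t)
    have h2 : ∫ t, G t * (t : ℂ) ^ (-1 : ℤ) *
        conj (flip hβ (fun t => conj (alphaMinus β t)) t) ∂arc = coeff G 0 := by
      refine integral_congr_ae (Filter.Eventually.of_forall fun t => ?_)
      have := Circle.coe_ne_zero t
      simp only [conj_flip_conj_alphaMinus, zpow_neg, zpow_one, neg_zero, zpow_zero]
      field_simp
    have h3 : coeff G 0 = (lam β / conj β) ^ (2 * m) := by
      have h4 := H.symm.coeff_mul_conj_zero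
        ((H.pow_hardyConj_top (memHardyConj_alphaMinus hβ) (2 * m)).mono le_top) W.minus_mem
      rw [hG, h4, W.at_infinity, mul_one,
        H.coeff_pow_conj_zero (memHardyConj_alphaMinus hβ), coeff_alphaMinus hβ]
    rw [← h3, ← h2, ← h1, ← integral_const_mul]
    refine integral_congr_ae ?_
    filter_upwards [hJ] with t ht
    rw [conj_conj, ← ht, mul_assoc]
  have hc : lam β / conj β ≠ 0 := div_ne_zero (lam_ne_zero hβ) (conj_beta_ne_zero hβ)
  rw [diskValue_inv hβ]
  set c := lam β / conj β
  set S := ∫ t, gp⁻¹ t * alphaMinus β t ∂arc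
  -- With g₊⁻¹(1/β̄) = c⁻¹S and 2m - n = 1 all powers of c cancel, so the signature is μ⁻¹ = μ.
  have h1 : c ^ (-n) * c⁻¹ * c ^ (2 * m) = 1 := by
    rw [← zpow_natCast, ← zpow_neg_one, ← zpow_add₀ hc, ← zpow_add₀ hc]
    have : -n + -1 + ((2 * m : ℕ) : ℤ) = 0 := by
      push_cast
      omega
    rw [this, zpow_zero]
  rw [← hint] at h1
  linear_combination μ * h1 - c ^ (-n) * c⁻¹ * S * hμ

end Signature

/-! ### The cokernel -/

section Cokernel

variable {p q : ℝ≥0∞} [hp : Fact (1 ≤ p)] [hq : Fact (1 ≤ q)] {β : ℂ} {hβ : 1 < ‖β‖}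
  {a b : Circle → ℂ}

/-- The cokernel in terms of the kernel of the operator with the adjoint matching pair. -/
theorem coker_eq_map [ENNReal.HolderConjugate p q] (H : RieszPair p q)
    (h : IsMatchingPair hβ a b) (m : ℕ) {ε : ℂ} (hε : conj ε = ε) :
    coker p q (toeplitz p a + ε • hankel hβ p b) =
      Submodule.map (toeplitz q fun t => chi β t ^ (-(m : ℤ))).toLinearMap
        ((toeplitz q (fun t => conj (a t) * chi β t ^ (-(m : ℤ))) +
          ε • hankel hβ q (fun t => conj (b (shift hβ t)) * chi β t ^ (m : ℤ))).ker ⊓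
        (toeplitz q fun t => chi β t ^ (m : ℤ)).range) := by
  have h' := h.adjoint (m : ℤ)
  have key : ∀ g : hardy q, g ∈ coker p q (toeplitz p a + ε • hankel hβ p b) ↔
      (toeplitz q (fun t => conj (a t) * chi β t ^ (-(m : ℤ))) +
        ε • hankel hβ q (fun t => conj (b (shift hβ t)) * chi β t ^ (m : ℤ)))
        (toeplitz q (fun t => chi β t ^ (m : ℤ)) g) = 0 := fun g => by
    rw [mem_coker_iff H hβ h.left_mem h.right_mem hε]
    exact (memNeg_chi_pow_iff H.symm hβ (a := fun t => conj (a t))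
      (b := fun t => conj (b (shift hβ t))) h'.left_mem h'.right_mem ε g).symm
  ext g
  rw [key, Submodule.mem_map]
  constructor
  · intro hg
    exact ⟨_, ⟨hg, ⟨g, rfl⟩⟩, toeplitz_chi_leftInverse H.symm hβ m g⟩
  · rintro ⟨_, ⟨hy, ⟨x, rfl⟩⟩, rfl⟩
    have h1 := toeplitz_chi_leftInverse H.symm hβ m x
    have h2 : toeplitz q (fun t => chi β t ^ (m : ℤ)) ((toeplitz q fun t =>
        chi β t ^ (-(m : ℤ))).toLinearMap ((toeplitz q fun t => chi β t ^ (m : ℤ)).toLinearMap x))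
        = (toeplitz q fun t => chi β t ^ (m : ℤ)).toLinearMap x :=
      congrArg (toeplitz q fun t => chi β t ^ (m : ℤ)) h1
    rw [h2]
    exact hy

end Cokernel

end ToeplitzHankel

end

/-! ### The description of the cokernel -/

theorem theorem5p3 {β : ℂ} (hβ : 1 < ‖β‖) {p q : ℝ≥0∞} [Fact (1 ≤ p)] [Fact (1 ≤ q)]
    [ENNReal.HolderConjugate p q] (hp : 1 < p) (hp' : p < ∞) {a b : Circle → ℂ}
    (hab : IsMatchingPair hβ a b)
    (hc : (toeplitz p (subC a b)).IsFredholm)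
    (hd : (toeplitz p (subD hβ a b)).IsFredholm)
    {κ₁ κ₂ : ℤ}
    (hκ₁ : fredholmIndex (toeplitz p (subC a b)) = κ₁)
    (hκ₂ : fredholmIndex (toeplitz p (subD hβ a b)) = κ₂)
    (hκ₁neg : κ₁ < 0) (hκ₂pos : 0 < κ₂) {m : ℕ} (hm₀ : 0 ≤ 2 * (m : ℤ) - κ₂)
    (hm₁ : 2 * (m : ℤ) - κ₂ ≤ 1) :
    let c := subC a b
    let d := subD hβ a b
    let χ := chi β
    let a' : Circle → ℂ := fun t => conj (a t) * χ t ^ (-(m : ℤ))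
    let b' : Circle → ℂ := fun t => conj (b (shift hβ t)) * χ t ^ (m : ℤ)
    let σ := alphaSignature β q p (cj d)
    let N : ℂ → Submodule ℂ (hardy q) := fun ε =>
      Submodule.map (phiAlpha hβ q ε a' b').toLinearMap
        (imPAlpha hβ q ε (cj c))
    let Tχ : ℤ → (hardy q →L[ℂ] hardy q) := fun k =>
      toeplitz q fun t => χ t ^ k
    (Odd κ₂ →
      (∃ dm dp : Circle → ℂ, IsWeakWienerHopf p q d (-κ₂) dm dp) ∧
      ∀ dm dp : Circle → ℂ, IsWeakWienerHopf p q d (-κ₂) dm dp →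
        ∀ ε : ℂ, ε = 1 ∨ ε = -1 →
          let L := lineSpan q ((1 - ε * σ) / 2) (cj dm⁻¹)
          Disjoint L (N ε) ∧
          coker p q
              (toeplitz p a + ε • hankel hβ p b) =
            Submodule.map (Tχ (-(m : ℤ))).toLinearMap ((L ⊔ N ε) ⊓ (Tχ (m : ℤ)).range)) ∧
    (Even κ₂ →
      ∀ ε : ℂ, ε = 1 ∨ ε = -1 →
        coker p q
            (toeplitz p a + ε • hankel hβ p b) =
          Submodule.map (Tχ (-(m : ℤ))).toLinearMap (N ε ⊓ (Tχ (m : ℤ)).range)) := by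
  intro c d χ a' b' σ N Tχ
  have hidx : 0 < fredholmIndex (toeplitz p d) := by rwa [hκ₂]
  have H : RieszPair p q :=
    -- The nonzero index of T(d) is what provides the Riesz projection on L^p, and duality the one
    -- on L^q.
    RieszPair.mk' inferInstance hp hp'.ne (hasRiesz_of_index_ne_zero hidx.ne')
  have hd0 : ∀ᵐ t ∂arc, d t ≠ 0 := by
    filter_upwards [hab.right_ne_zero, ae_shift hβ hab.left_ne_zero] with t h1 h2
    exact mul_ne_zero h1 (inv_ne_zero h2)
  have hb : Function.Bijective (toeplitz p fun t => d t * (t : ℂ) ^ κ₂) := by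
    rw [← hκ₂]
    exact bijective_toeplitz_of_index_pos H hab.subD_mem hd0 hd hidx
  have hab' : IsMatchingPair hβ a' b' := hab.adjoint (m : ℤ)
  have hb' : Function.Bijective (toeplitz q fun t =>
      subC a' b' t * (t : ℂ) ^ (2 * (m : ℤ) - κ₂)) :=
    bijective_toeplitz_subC_adjoint H hab hb m
  -- The bounds on m are used here: 2m - κ₂ is 0 or 1, which is the index of T(c').
  have hR := toeplitz_toeplitzRightInv H.symm hab'.subC_mem hm₀ hm₁ hb'
  have hfin := finrank_ker_toeplitz H.symm hab'.subC_mem hm₀ hm₁ hb'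
  have hN : ∀ ε : ℂ, Submodule.map (phiAlpha hβ q ε a' b').toLinearMap
      (imPAlpha hβ q ε (subD hβ a' b')) = N ε := fun ε => by
    rw [imPAlpha_congr hβ (subD_adjoint hab (m : ℤ))]
  have hsq : ∀ ε : ℂ, ε = 1 ∨ ε = -1 → ε * ε = 1 ∧ conj ε = ε := by
    rintro ε (rfl | rfl) <;> simp
  have hcoker : ∀ ε : ℂ, ε = 1 ∨ ε = -1 →
      coker p q (toeplitz p a + ε • hankel hβ p b) =
        Submodule.map (Tχ (-(m : ℤ))).toLinearMap
          ((imPAlpha hβ q (-ε) (subC a' b') ⊔ N ε) ⊓ (Tχ (m : ℤ)).range) := fun ε hε => by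
    rw [coker_eq_map H hab m (hsq ε hε).2, ← hN,
      ← ker_toeplitz_add_hankel H.symm hab' hR (hsq ε hε).1]
  constructor
  · intro hodd
    have hm : 2 * (m : ℤ) - κ₂ = 1 := by
      obtain ⟨j, hj⟩ := hodd
      omega
    have hex := exists_weakWienerHopf H hab.subD_mem hd0 hb
    refine ⟨hex, fun dm dp W ε hε => ?_⟩
    have hfin1 : Module.finrank ℂ (toeplitz q (subC a' b')).ker = 1 := by
      rw [hm] at hfin
      exact_mod_cast hfin
    have hcC := subC_adjoint hab (m : ℤ)
    obtain ⟨μ, hμ, hker⟩ := exists_sign H.symm hβ hab'.subC_mem hab'.subC_mul_shift hfin1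
    have hσ : σ = μ := by
      have hexc := W.exists_cj H
      rw [neg_neg] at hexc
      exact alphaSignature_eq H.symm hβ hm hexc hab'.subC_mem hcC hμ hker
    have hwmem : MemHardy q (cj dm⁻¹) := W.minus_inv_mem.conj
    have hwae := hwmem.toHardy_ae
    have hw0 : hwmem.toHardy ≠ 0 := by
      intro h0
      rw [hardy_eq_zero_iff] at h0
      obtain ⟨t, h1, h2, h3⟩ := (h0.and (hwae.and W.ne_zero)).exists
      rw [h1, Pi.zero_apply] at h2
      exact (map_ne_zero (starRingEnd ℂ)).2 (inv_ne_zero h3.1) h2.symm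
    -- c' conj(d₋⁻¹) = α₋^(2m) conj(d₊) t^(κ₂-2m), where κ₂ - 2m = -1: an antianalytic function
    -- times t⁻¹.
    have hwker : toeplitz q (subC a' b') hwmem.toHardy = 0 := by
      rw [toeplitz_eq_zero_iff H.right hab'.subC_mem]
      have h1 := H.symm.mul_hardyConj
        (H.pow_hardyConj_top (memHardyConj_alphaMinus hβ) (2 * m)) W.plus_mem.conj
      refine (h1.mul_zpow_neg (k := -1) (by norm_num)).congr ?_
      filter_upwards [hcC, hwae, W.eq, W.ne_zero] with t h2 h3 h4 h5
      have h6 := chi_zpow_neg (β := β) t (2 * m)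
      rw [Nat.cast_mul, Nat.cast_ofNat] at h6
      have h7 : (t : ℂ) ^ (-1 : ℤ) = (t : ℂ) ^ κ₂ * (t : ℂ) ^ (-(2 * (m : ℤ))) := by
        rw [← zpow_add₀ (Circle.coe_ne_zero t)]
        congr 1
        omega
      have h8 : conj (dm t) ≠ 0 := (map_ne_zero _).2 h5.1
      have h9 : subD hβ a b t = dm t * (t : ℂ) ^ (-κ₂) * dp t := h4
      rw [h2, h3, h6, h7, cj, h9, map_mul, map_mul, conj_zpow_coe, neg_neg, cj, Pi.inv_apply,
        map_inv₀]
      field_simp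
    have hL := imPAlpha_eq_lineSpan H.symm hβ hab'.subC_mem hab'.subC_mul_shift hfin1 hμ
      (hsq ε hε).1 hker hw0 hwker hwae
    intro L
    have hL' : imPAlpha hβ q (-ε) (subC a' b') = L := by rw [hL, ← hσ]
    rw [hcoker ε hε, hL', ← hL']
    refine ⟨?_, rfl⟩
    rw [← hN]
    exact disjoint_map_phiAlpha H.symm hab' hR (hsq ε hε).1
  · intro heven ε hε
    have hm : 2 * (m : ℤ) - κ₂ = 0 := by
      obtain ⟨j, hj⟩ := heven
      omega
    -- Here 2m = κ₂, so T(c') itself is invertible.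
    have hbot : (toeplitz q (subC a' b')).ker = ⊥ := by
      rw [hm] at hb'
      refine LinearMap.ker_eq_bot.2 ?_
      have e : (fun t : Circle => subC a' b' t * (t : ℂ) ^ (0 : ℤ)) = subC a' b' :=
        funext fun t => by rw [zpow_zero, mul_one]
      rw [e] at hb'
      exact hb'.1
    have hI : imPAlpha hβ q (-ε) (subC a' b') = ⊥ := by rw [imPAlpha, hbot, Submodule.map_bot]
    rw [hcoker ε hε, hI, bot_sup_eq]
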